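/- **Lemma (Norm equivalence).** Let $d\in\{2,3\}$, let $\Omega\subset\mathbb R^d$ be a bounded connected open polytopal domain, let $k\ge 0$ be an integer, $\rho\in(0,1)$ and $0<\lambda_*\le\lambda^*$. There is a constant $C>0$ depending only on $\Omega$, $\rho$, $k$ and on $\lambda_*,\lambda^*$ such that the following holds. *Mesh.* Let $\mathcal M_h=\mathcal T_h\cup\mathcal F_h$ be a polytopal mesh of $\Omega$. That is, $\mathcal T_h$ is a finite set of nonempty, pairwise disjoint polytopal sets (interiors of finite unions of closed simplices) whose closures cover $\overline\Omega$. The set $\mathcal F_h$ is a finite set of nonempty, pairwise disjoint, connected, relatively open subsets $F\subset\overline\Omega$ of hyperplanes, with $\overline F\setminus F$ of zero $(d-1)$-dimensional measure. Each $F$ either lies on $\partial T_1\cap\partial T_2$ for two distinct elements or on $\partial T\cap\partial\Omega$ for an element $T$, and $\bigcup_T\partial T=\bigcup_F\overline F$. For $T\in\mathcal T_h$, let $h_T$ be its diameter and $\mathcal F_T$ the set of faces contained in $\partial T$; let $\mathcal F_h^{\rm b}$ be the set of faces contained in $\partial\Omega$. Each face $F$ has a fixed unit normal $n_F$, and $\omega_{TF}\in\{-1,1\}$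 is such that $\omega_{TF}n_F$ points out of $T$ on $F\in\mathcal F_T$. Assume that $\mathcal M_h$ is regular with parameter $\rho$: it has a matching simplicial submesh (a matching simplicial mesh of $\Omega$, each simplex of which is contained in a unique element, and each open simplicial face of which is either contained in or disjoint from any given mesh face) such that every simplex $\tau$ of diameter $h_\tau$ has an inradius at least $\rho h_\tau$, and $\rho h_T\le h_\tau$ whenever $\tau\subset T\in\mathcal T_h$. *Coefficients.* Let $\mu,\nu:\Omega\to\mathbb R$ be piecewise constant on a polytopal partition of $\Omega$ such that each $T\in\mathcal T_h$ is contained in a set of the partition, with $0<\underline\mu\le\mu\le\overline\mu$ and $0\le\nu\le\overline\nu$ a.e. for some constants $\underline\mu,\overline\mu,\overline\nu$. Let $\mu_T,\nu_T$ be their values on $T$ and $C_{f,T}=\nu_Th_T^2/\mu_T\in[0,\infty)$; we set $\min(1,C_{f,T}^{-1})=1$ if $C_{f,T}=0$. Let $\lambda_T\in[\lambda_*,\lambda^*]$. *Discrete objects.* For $Y\in\{T\}\cup\mathcal F_T$ let $\mathcal P^m(Y)$ be the space of restrictions to $Y$ of $d$-variate polynomials of total degree $\le m$. A local HHO vector is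 $\underline v_T=(v_T,(v_F)_{F\in\mathcal F_T})$ with $v_T\in\mathcal P^k(T)^d$ and $v_F\in\mathcal P^k(F)^d$. The discrete gradient $G_T^k\underline v_T\in\mathcal P^k(T)^{d\times d}$ is defined by $$\int_T G_T^k\underline v_T:\tau=-\int_T v_T\cdot(\nabla\cdot\tau)+\sum_{F\in\mathcal F_T}\omega_{TF}\int_F v_F\cdot\tau n_F\qquad\forall\tau\in\mathcal P^k(T)^{d\times d},$$ with $\nabla$ and $\nabla\cdot$ acting row-wise. The Stokes potential $P_T\underline v_T\in\mathcal P^{k+1}(T)^d$ is defined by the conditions that each row of $\nabla P_T\underline v_T$ is the $L^2(T)$-orthogonal projection of the corresponding row of $G_T^k\underline v_T$ on $\nabla\mathcal P^{k+1}(T)$, and that $\int_TP_T\underline v_T=\int_Tv_T$. Let $\underline I_T w=(\pi_Tw,(\pi_Fw)_{F\in\mathcal F_T})$, where $\pi_Y$ is the $L^2(Y)$-orthogonal projector on $\mathcal P^k(Y)^d$, and set $$(\underline w_T,\underline v_T)_{U,T}=\lambda_T\int_Tw_T\cdot v_T+h_T\sum_{F\in\mathcal F_T,\ C_{f,T}<1\text{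 or }F\notin\mathcal F_h^{\rm b}}\int_Fw_F\cdot v_F .$$ With $\underline\delta_T=\underline v_T-\underline I_TP_T\underline v_T$, let $$\|\underline v_T\|_{S,T}^2=\|G_T^k\underline v_T\|_{L^2(T)}^2+\frac{\min(1,C_{f,T}^{-1})}{h_T^2}(\underline\delta_T,\underline\delta_T)_{U,T}.$$ *Conclusion.* For every such mesh, coefficients, element $T\in\mathcal T_h$, factor $\lambda_T$ and local HHO vector $\underline v_T$, $$\|\underline v_T\|_{S,T}^2\le C\Big(\|\nabla v_T\|_{L^2(T)}^2+\frac1{h_T}\sum_{F\in\mathcal F_T}\|v_T-v_F\|_{L^2(F)}^2\Big),$$ and, if moreover $C_{f,T}<1$, $$\|\nabla v_T\|_{L^2(T)}^2+\frac1{h_T}\sum_{F\in\mathcal F_T}\|v_T-v_F\|_{L^2(F)}^2\le C\,\|\underline v_T\|_{S,T}^2 .$$ -/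

import Mathlib

open MeasureTheory Filter Topology
open scoped InnerProductSpace

namespace HHO

noncomputable section

/-! ### Polytopal sets and meshes -/

/-- The Euclidean space `ℝ^d`. -/
abbrev E (d : ℕ) : Type := EuclideanSpace ℝ (Fin d)

/-- The closed simplex spanned by `d + 1` affinely independent points. -/
def closedSimplex {d : ℕ} (s : Affine.Simplex ℝ (E d) d) : Set (E d) :=
  convexHull ℝ (Set.range s.points)

/-- The open simplex spanned by `d + 1` affinely independent points. -/
def openSimplex {d : ℕ} (s : Affine.Simplex ℝ (E d) d) : Set (E d) :=
  interior (closedSimplex s)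

/-- The (relatively open) simplicial face opposite to the `i`-th vertex. -/
def openFacet {d : ℕ} (s : Affine.Simplex ℝ (E d) d) (i : Fin (d + 1)) : Set (E d) :=
  intrinsicInterior ℝ (convexHull ℝ (s.points '' {i}ᶜ))

/-- Polytopal sets: interiors of finite unions of closed simplices.  In particular such a set is
open, bounded, and equal to the interior of its closure. -/
def IsPolytopal {d : ℕ} (T : Set (E d)) : Prop :=
  ∃ S : Finset (Affine.Simplex ℝ (E d) d), T = interior (⋃ s ∈ S, closedSimplex s)

/-- A bounded connected open polytopal domain. -/
def IsPolytopalDomain {d : ℕ} (Ω : Set (E d)) : Prop :=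
  IsPolytopal Ω ∧ IsConnected Ω

/-- A finite family of nonempty, pairwise disjoint polytopal sets whose closures cover that
of `Ω`. -/
structure IsPolytopalPartition {d : ℕ} (Ω : Set (E d)) (P : Finset (Set (E d))) : Prop where
  nonempty : ∀ T ∈ P, T.Nonempty
  polytopal : ∀ T ∈ P, IsPolytopal T
  disjoint : ∀ T ∈ P, ∀ T' ∈ P, T ≠ T' → Disjoint T T'
  cover : closure Ω = ⋃ T ∈ P, closure T

/-- The `(d-1)`-dimensional surface measure on `ℝ^d`: the Hausdorff measure, normalised so as to
coincide with the Lebesgue measure on hyperplanes. -/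
def surface (d : ℕ) : Measure (E d) := Measure.euclideanHausdorffMeasure (d - 1)

/-- The unit vector `n` is normal to the face `F` and points out of `T`: almost everywhere on `F`,
one leaves `T` in the direction `n` and enters `T` in the direction `-n`. -/
def PointsOut {d : ℕ} (T F : Set (E d)) (n : E d) : Prop :=
  ∀ᵐ x ∂(surface d).restrict F, ∀ᶠ t : ℝ in 𝓝[>] 0, x + t • n ∉ closure T ∧ x - t • n ∈ T

/-- A polytopal mesh of `Ω`, with a fixed unit normal `n_F` on each face and the orientation
`ω_{TF} = ±1` of each face relative to the elements it bounds. -/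
structure PolytopalMesh {d : ℕ} (Ω : Set (E d)) where
  /-- the mesh elements -/
  elements : Finset (Set (E d))
  /-- the mesh faces -/
  faces : Finset (Set (E d))
  /-- the unit normals `n_F` -/
  normal : Set (E d) → E d
  /-- the orientations `ω_{TF}` (first argument `T`, second argument `F`) -/
  orient : Set (E d) → Set (E d) → ℝ
  partition : IsPolytopalPartition Ω elements
  face_nonempty : ∀ F ∈ faces, F.Nonempty
  face_connected : ∀ F ∈ faces, IsConnected F
  face_subset : ∀ F ∈ faces, F ⊆ closure Ω
  face_disjoint : ∀ F ∈ faces, ∀ F' ∈ faces, F ≠ F' → Disjoint F F'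
  norm_normal : ∀ F ∈ faces, ‖normal F‖ = 1
  /-- each face is a relatively open subset of a hyperplane (with normal `n_F`) -/
  face_hyperplane : ∀ F ∈ faces, ∃ (c : ℝ) (U : Set (E d)), IsOpen U ∧
    F = U ∩ {x | ⟪normal F, x⟫_ℝ = c}
  face_null : ∀ F ∈ faces, surface d (closure F \ F) = 0
  /-- each face is an interface or a boundary face -/
  face_kind : ∀ F ∈ faces,
    (∃ T₁ ∈ elements, ∃ T₂ ∈ elements, T₁ ≠ T₂ ∧ F ⊆ frontier T₁ ∩ frontier T₂) ∨
      (∃ T ∈ elements, F ⊆ frontier T ∩ frontier Ω)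
  /-- the faces cover the mesh skeleton -/
  skeleton : ⋃ T ∈ elements, frontier T = ⋃ F ∈ faces, closure F
  orient_sign : ∀ T ∈ elements, ∀ F ∈ faces, F ⊆ frontier T →
    orient T F = 1 ∨ orient T F = -1
  orient_out : ∀ T ∈ elements, ∀ F ∈ faces, F ⊆ frontier T →
    PointsOut T F (orient T F • normal F)

namespace PolytopalMesh

variable {d : ℕ} {Ω : Set (E d)}

open Classical in
/-- The faces lying on the boundary of `T`. -/
def facesOf (M : PolytopalMesh Ω) (T : Set (E d)) : Finset (Set (E d)) :=
  M.faces.filter fun F => F ⊆ frontier T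

open Classical in
/-- The boundary faces of the mesh. -/
def boundaryFaces (M : PolytopalMesh Ω) : Finset (Set (E d)) :=
  M.faces.filter fun F => F ⊆ frontier Ω

theorem mem_facesOf (M : PolytopalMesh Ω) {T F : Set (E d)} :
    F ∈ M.facesOf T ↔ F ∈ M.faces ∧ F ⊆ frontier T := by
  classical
  simp [facesOf]

/-- `S` is (the set of simplices of) a matching simplicial submesh of `M`. -/
structure IsMatchingSimplicialSubmesh (M : PolytopalMesh Ω)
    (S : Finset (Affine.Simplex ℝ (E d) d)) : Prop where
  disjoint : ∀ s ∈ S, ∀ s' ∈ S, s ≠ s' → Disjoint (openSimplex s) (openSimplex s')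
  cover : closure Ω = ⋃ s ∈ S, closedSimplex s
  matching : ∀ s ∈ S, ∀ s' ∈ S, closedSimplex s ∩ closedSimplex s' =
    convexHull ℝ (Set.range s.points ∩ Set.range s'.points)
  subordinate : ∀ s ∈ S, ∃! T, T ∈ M.elements ∧ openSimplex s ⊆ T
  facet : ∀ s ∈ S, ∀ i, ∀ F ∈ M.faces, openFacet s i ∩ F = ∅ ∨ openFacet s i ⊆ F

/-- The mesh is regular with parameter `ρ`: it has a matching simplicial submesh in which each
simplex `s` has an inradius at least `ρ h_s` (it contains a ball of that radius), and satisfies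
`ρ h_T ≤ h_s` if it is contained in the element `T`. -/
def IsRegular (M : PolytopalMesh Ω) (ρ : ℝ) : Prop :=
  ∃ S : Finset (Affine.Simplex ℝ (E d) d), M.IsMatchingSimplicialSubmesh S ∧
    (∀ s ∈ S, ∃ c, Metric.ball c (ρ * Metric.diam (openSimplex s)) ⊆ openSimplex s) ∧
    (∀ T ∈ M.elements, ∀ s ∈ S, openSimplex s ⊆ T →
      ρ * Metric.diam T ≤ Metric.diam (openSimplex s))

end PolytopalMesh

/-! ### Coefficients of the Brinkman problem -/

/-- The coefficients `μ`, `ν`, with their bounds, both piecewise constant on a polytopal partition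
of the domain. -/
structure Coefficients {d : ℕ} (Ω : Set (E d)) where
  /-- the viscosity `μ` -/
  mu : E d → ℝ
  /-- the inverse permeability `ν` -/
  nu : E d → ℝ
  /-- lower bound of `μ` -/
  muMin : ℝ
  /-- upper bound of `μ` -/
  muMax : ℝ
  /-- upper bound of `ν` -/
  nuMax : ℝ
  /-- the partition of the domain -/
  parts : Finset (Set (E d))
  muMin_pos : 0 < muMin
  mu_bounds : ∀ᵐ x ∂volume.restrict Ω, muMin ≤ mu x ∧ mu x ≤ muMax
  nu_bounds : ∀ᵐ x ∂volume.restrict Ω, 0 ≤ nu x ∧ nu x ≤ nuMax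
  partition : IsPolytopalPartition Ω parts
  mu_const : ∀ ω ∈ parts, ∃ c, ∀ᵐ x ∂volume.restrict ω, mu x = c
  nu_const : ∀ ω ∈ parts, ∃ c, ∀ᵐ x ∂volume.restrict ω, nu x = c

namespace Coefficients

variable {d : ℕ} {Ω : Set (E d)}

/-- Each mesh element is contained in a set of the partition underlying the coefficients. -/
def Compatible (D : Coefficients Ω) (M : PolytopalMesh Ω) : Prop :=
  ∀ T ∈ M.elements, ∃ ω ∈ D.parts, T ⊆ ω

/-- `μ_T`, the (a.e. constant) value of `μ` on `T`, computed as an average. -/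
def muOn (D : Coefficients Ω) (T : Set (E d)) : ℝ := ⨍ x in T, D.mu x

/-- `ν_T`, the (a.e. constant) value of `ν` on `T`, computed as an average. -/
def nuOn (D : Coefficients Ω) (T : Set (E d)) : ℝ := ⨍ x in T, D.nu x

/-- The local friction coefficient `C_{f,T} = ν_T h_T² / μ_T`. -/
def friction (D : Coefficients Ω) (T : Set (E d)) : ℝ :=
  D.nuOn T * Metric.diam T ^ 2 / D.muOn T

end Coefficients

/-- `min (1, C⁻¹)` for `C ≥ 0`, where `0⁻¹ = +∞`. -/
def minOneInv (C : ℝ) : ℝ := if C = 0 then 1 else min 1 C⁻¹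

/-! ### Polynomial fields and `L²`-projectors -/

/-- The value of a polynomial at a point. -/
def ev {d : ℕ} (p : MvPolynomial (Fin d) ℝ) (x : E d) : ℝ := MvPolynomial.eval (fun i => x i) p

/-- Polynomial fields of total degree at most `m` with components indexed by `ι`
(`ι = Fin d` for vector fields, `ι = Fin d × Fin d` for tensor fields).  On an element, which is
open, a polynomial is determined by its restriction.  On a face, a polynomial stands for
its restriction to the face, and only this restriction is ever used. -/
def polyFields (d : ℕ) (ι : Type) (m : ℕ) : Submodule ℝ (ι → MvPolynomial (Fin d) ℝ) :=
  Submodule.pi Set.univ fun _ => MvPolynomial.restrictTotalDegree (Fin d) ℝ m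

/-- The gradient of a polynomial. -/
def grad (d : ℕ) : MvPolynomial (Fin d) ℝ →ₗ[ℝ] (Fin d → MvPolynomial (Fin d) ℝ) :=
  LinearMap.pi fun j => (MvPolynomial.pderiv j).toLinearMap

/-- Gradients of polynomials of degree at most `m + 1`. -/
def gradFields (d m : ℕ) : Submodule ℝ (Fin d → MvPolynomial (Fin d) ℝ) :=
  (MvPolynomial.restrictTotalDegree (Fin d) ℝ (m + 1)).map (grad d)

/-- Row-wise gradient of a vector field: `(∇v)_{ij} = ∂_j v_i`. -/
def gradVec {d : ℕ} (v : Fin d → MvPolynomial (Fin d) ℝ) :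
    Fin d × Fin d → MvPolynomial (Fin d) ℝ :=
  fun ij => grad d (v ij.1) ij.2

/-- Row-wise divergence of a tensor field: `(∇·τ)_i = ∑_j ∂_j τ_{ij}`. -/
def divTensor {d : ℕ} (τ : Fin d × Fin d → MvPolynomial (Fin d) ℝ) :
    Fin d → MvPolynomial (Fin d) ℝ :=
  fun i => ∑ j, MvPolynomial.pderiv j (τ (i, j))

/-- The measure used for integration over an element. -/
def onElement {d : ℕ} (T : Set (E d)) : Measure (E d) := volume.restrict T

/-- The measure used for integration over a face. -/
def onFace {d : ℕ} (F : Set (E d)) : Measure (E d) := (surface d).restrict F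

/-- The `L²`-product of polynomial fields. -/
def innerL2 {d : ℕ} {ι : Type} [Fintype ι] (σ : Measure (E d))
    (f g : ι → MvPolynomial (Fin d) ℝ) : ℝ :=
  ∫ x, ∑ i, ev (f i) x * ev (g i) x ∂σ

/-- The element `g` of `X` such that `∫ g·w = ℓ w` for all `w ∈ X`. -/
def l2Rep {d : ℕ} {ι : Type} [Fintype ι] (σ : Measure (E d))
    (X : Submodule ℝ (ι → MvPolynomial (Fin d) ℝ)) (ℓ : X → ℝ) : X :=
  Classical.epsilon fun g : X => ∀ w : X, innerL2 σ g.1 w.1 = ℓ w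

/-- The `L²`-orthogonal projector on `X`. -/
def l2Proj {d : ℕ} {ι : Type} [Fintype ι] (σ : Measure (E d))
    (X : Submodule ℝ (ι → MvPolynomial (Fin d) ℝ)) (f : ι → MvPolynomial (Fin d) ℝ) : X :=
  l2Rep σ X fun w => innerL2 σ f w.1

/-! ### The local HHO space and the Stokes bilinear form -/

section Local

variable {d : ℕ} {Ω : Set (E d)} (M : PolytopalMesh Ω) (T : Set (E d)) (k : ℕ)

/-- The local HHO space: a vector polynomial of degree at most `k` on the element and one on each
of its faces. -/
abbrev LocalHHO : Type :=
  polyFields d (Fin d) k × (M.facesOf T → polyFields d (Fin d) k)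

variable {k}

/-- The right-hand side of the equation defining the discrete gradient:
`-∫_T v_T · (∇·τ) + ∑_F ω_{TF} ∫_F v_F · τ n_F`. -/
def gradRhs (v : LocalHHO M T k) (τ : Fin d × Fin d → MvPolynomial (Fin d) ℝ) : ℝ :=
  -innerL2 (onElement T) v.1.1 (divTensor τ) +
    ∑ F : M.facesOf T, M.orient T F *
      ∫ x, ∑ i, ev ((v.2 F).1 i) x * ∑ j, ev (τ (i, j)) x * M.normal F j ∂onFace F.1

/-- The discrete gradient `G_T^k v`. -/
def discreteGradient (v : LocalHHO M T k) : polyFields d (Fin d × Fin d) k :=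
  l2Rep (onElement T) (polyFields d (Fin d × Fin d) k) fun τ => gradRhs M T v τ.1

/-- The conditions defining the Stokes potential: its gradient is the row-wise `L²`-projection of
the discrete gradient on the gradients of polynomials of degree at most `k + 1`, and its integral
is that of the element component. -/
def IsStokesPotential (v : LocalHHO M T k) (P : polyFields d (Fin d) (k + 1)) : Prop :=
  ∀ i, grad d (P.1 i) =
      (l2Proj (onElement T) (gradFields d k) fun j => (discreteGradient M T v).1 (i, j)).1 ∧
    ∫ x, ev (P.1 i) x ∂onElement T = ∫ x, ev (v.1.1 i) x ∂onElement T

/-- The Stokes potential `P_{S,T}^{k+1} v`. -/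
def stokesPotential (v : LocalHHO M T k) : polyFields d (Fin d) (k + 1) :=
  Classical.epsilon (IsStokesPotential M T v)

variable (k) in
/-- The interpolator `I_T^k` (on polynomial vector fields). -/
def interpolate (w : Fin d → MvPolynomial (Fin d) ℝ) : LocalHHO M T k :=
  (l2Proj (onElement T) (polyFields d (Fin d) k) w,
    fun F => l2Proj (onFace F.1) (polyFields d (Fin d) k) w)

open Classical in
/-- The product `(w, v)_{U,T}`, where `C` is the local friction coefficient and `lam` the
factor `λ_T`. -/
def prodU (C lam : ℝ) (w v : LocalHHO M T k) : ℝ :=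
  lam * innerL2 (onElement T) w.1.1 v.1.1 +
    Metric.diam T * ∑ F : M.facesOf T,
      (if C < 1 ∨ F.1 ∉ M.boundaryFaces then 1 else 0) *
        innerL2 (onFace F.1) (w.2 F).1 (v.2 F).1

/-- The difference `v - I_T^k P_{S,T}^{k+1} v`. -/
def stokesDiff (v : LocalHHO M T k) : LocalHHO M T k :=
  v - interpolate M T k (stokesPotential M T v).1

/-- The bilinear form `a_{S,T}`. -/
def stokesForm (C lam : ℝ) (w v : LocalHHO M T k) : ℝ :=
  innerL2 (onElement T) (discreteGradient M T w).1 (discreteGradient M T v).1 +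
    minOneInv C / Metric.diam T ^ 2 *
      prodU M T C lam (stokesDiff M T w) (stokesDiff M T v)

/-- The seminorm `‖v‖_{S,T}`. -/
def stokesSeminorm (C lam : ℝ) (v : LocalHHO M T k) : ℝ := √(stokesForm M T C lam v v)

/-- `‖∇v_T‖²_{L²(T)} + h_T⁻¹ ∑_F ‖v_T - v_F‖²_{L²(F)}`. -/
def hhoNormSq (v : LocalHHO M T k) : ℝ :=
  innerL2 (onElement T) (gradVec v.1.1) (gradVec v.1.1) +
    (Metric.diam T)⁻¹ * ∑ F : M.facesOf T,
      innerL2 (onFace F.1) (v.1.1 - (v.2 F).1) (v.1.1 - (v.2 F).1)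

end Local

/-! ### Well-definedness of the operators -/

section WellDefined

variable {d : ℕ}

/-- A finite measure carried by a bounded set. -/
def Nice (σ : Measure (E d)) : Prop := IsFiniteMeasure σ ∧ ∃ R, ∀ᵐ x ∂σ, ‖x‖ ≤ R

theorem ev_continuous (p : MvPolynomial (Fin d) ℝ) : Continuous (ev p) :=
  (MvPolynomial.continuous_eval p).comp (by fun_prop)

theorem Nice.integrable {σ : Measure (E d)} (h : Nice σ) {f : E d → ℝ} (hf : Continuous f) :
    Integrable f σ := by
  obtain ⟨hfin, R, hR⟩ := h
  obtain ⟨C, hC⟩ := (isCompact_closedBall (0 : E d) R).exists_bound_of_continuousOn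
    hf.continuousOn
  refine Integrable.of_bound hf.aestronglyMeasurable C ?_
  filter_upwards [hR] with x hx
  exact hC x (by simpa using hx)

theorem continuous_inner_sum {ι : Type} [Fintype ι] (f g : ι → MvPolynomial (Fin d) ℝ) :
    Continuous fun x : E d => ∑ i, ev (f i) x * ev (g i) x :=
  continuous_finsetSum _ fun _ _ => (ev_continuous _).mul (ev_continuous _)

@[simp] theorem ev_add (p q : MvPolynomial (Fin d) ℝ) (x : E d) :
    ev (p + q) x = ev p x + ev q x := by simp [ev]

@[simp] theorem ev_smul (c : ℝ) (p : MvPolynomial (Fin d) ℝ) (x : E d) :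
    ev (c • p) x = c * ev p x := by simp [ev]

section
variable {ι : Type} [Fintype ι]

theorem innerL2_comm (σ : Measure (E d)) (f g : ι → MvPolynomial (Fin d) ℝ) :
    innerL2 σ f g = innerL2 σ g f := by
  simp only [innerL2, mul_comm]

theorem innerL2_add_right {σ : Measure (E d)} (h : Nice σ) (f g g' : ι → MvPolynomial (Fin d) ℝ) :
    innerL2 σ f (g + g') = innerL2 σ f g + innerL2 σ f g' := by
  rw [innerL2, innerL2, innerL2, ← integral_add (h.integrable (continuous_inner_sum f g))
    (h.integrable (continuous_inner_sum f g'))]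
  simp only [Pi.add_apply, ev_add, mul_add, Finset.sum_add_distrib]

theorem innerL2_smul_right (σ : Measure (E d)) (c : ℝ) (f g : ι → MvPolynomial (Fin d) ℝ) :
    innerL2 σ f (c • g) = c * innerL2 σ f g := by
  rw [innerL2, innerL2, ← integral_const_mul]
  simp only [Pi.smul_apply, ev_smul, Finset.mul_sum]
  congr 1; ext x; exact Finset.sum_congr rfl fun i _ => by ring

/-- The product `innerL2` as a bilinear form. -/
def innerLin {σ : Measure (E d)} (h : Nice σ) (X : Submodule ℝ (ι → MvPolynomial (Fin d) ℝ)) :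
    X →ₗ[ℝ] X →ₗ[ℝ] ℝ :=
  LinearMap.mk₂ ℝ (fun f g => innerL2 σ f.1 g.1)
    (fun f f' g => by
      rw [innerL2_comm, innerL2_comm σ f.1, innerL2_comm σ f'.1]
      exact innerL2_add_right h _ _ _)
    (fun c f g => by
      rw [innerL2_comm, innerL2_comm σ f.1]
      exact innerL2_smul_right _ _ _ _)
    (fun f g g' => innerL2_add_right h _ _ _)
    (fun c f g => innerL2_smul_right _ _ _ _)

theorem exists_riesz {V : Type*} [AddCommGroup V] [Module ℝ V] [FiniteDimensional ℝ V]
    (B : V →ₗ[ℝ] V →ₗ[ℝ] ℝ) (hB : ∀ v w, B v w = B w v) (ℓ : V →ₗ[ℝ] ℝ)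
    (hℓ : ∀ w, B w = 0 → ℓ w = 0) : ∃ v, ∀ w, B v w = ℓ w := by
  have hmem : ℓ ∈ (LinearMap.ker B).dualAnnihilator := by
    rw [Submodule.mem_dualAnnihilator]
    exact fun w hw => hℓ w hw
  rw [← LinearMap.range_dualMap_eq_dualAnnihilator_ker] at hmem
  obtain ⟨φ, hφ⟩ := hmem
  refine ⟨(Module.evalEquiv ℝ V).symm φ, fun w => ?_⟩
  rw [hB, ← hφ]
  simp

/-- The representative `l2Rep` satisfies its defining equation as soon as `ℓ` is linear and
vanishes on the fields that are null almost everywhere. -/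
theorem l2Rep_spec {σ : Measure (E d)} (h : Nice σ)
    (X : Submodule ℝ (ι → MvPolynomial (Fin d) ℝ)) [FiniteDimensional ℝ X] (ℓ : X →ₗ[ℝ] ℝ)
    (hℓ : ∀ w : X, (∀ᵐ x ∂σ, ∀ i, ev (w.1 i) x = 0) → ℓ w = 0) (w : X) :
    innerL2 σ (l2Rep σ X ℓ).1 w.1 = ℓ w := by
  have hex : ∃ g : X, ∀ w : X, innerL2 σ g.1 w.1 = ℓ w := by
    refine exists_riesz (innerLin h X) (fun v w => innerL2_comm _ _ _) ℓ fun w hw => hℓ w ?_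
    have h0 : innerL2 σ w.1 w.1 = 0 := by
      have := LinearMap.congr_fun hw w
      exact this
    rw [innerL2, integral_eq_zero_iff_of_nonneg
      (fun x => Finset.sum_nonneg fun i _ => mul_self_nonneg _)
      (h.integrable (continuous_inner_sum _ _))] at h0
    filter_upwards [h0] with x hx i
    have := (Finset.sum_eq_zero_iff_of_nonneg fun i _ => mul_self_nonneg _).1 hx i
      (Finset.mem_univ i)
    exact mul_self_eq_zero.1 this
  exact Classical.epsilon_spec hex w

/-- The orthogonality relation characterising the `L²`-projector. -/
theorem l2Proj_spec {σ : Measure (E d)} (h : Nice σ)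
    (X : Submodule ℝ (ι → MvPolynomial (Fin d) ℝ)) [FiniteDimensional ℝ X]
    (f : ι → MvPolynomial (Fin d) ℝ) (w : X) :
    innerL2 σ (l2Proj σ X f).1 w.1 = innerL2 σ f w.1 := by
  let ℓ : X →ₗ[ℝ] ℝ :=
    { toFun := fun w => innerL2 σ f w.1
      map_add' := fun _ _ => innerL2_add_right h _ _ _
      map_smul' := fun _ _ => innerL2_smul_right _ _ _ _ }
  refine l2Rep_spec h X ℓ (fun w hw => ?_) w
  change innerL2 σ f w.1 = 0
  refine integral_eq_zero_of_ae ?_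
  filter_upwards [hw] with x hx
  simp [hx]

end

instance (ι : Type) [Fintype ι] (m : ℕ) : FiniteDimensional ℝ (polyFields d ι m) := by
  let f : polyFields d ι m →ₗ[ℝ] (ι → MvPolynomial.restrictTotalDegree (Fin d) ℝ m) :=
    LinearMap.pi fun i => (LinearMap.proj i ∘ₗ (polyFields d ι m).subtype).codRestrict _
      fun v => v.2 i (Set.mem_univ i)
  refine FiniteDimensional.of_injective f fun v w hvw => ?_
  ext1
  funext i
  exact congrArg Subtype.val (congrFun hvw i)

instance (m : ℕ) : FiniteDimensional ℝ (gradFields d m) := by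
  unfold gradFields
  infer_instance

theorem isBounded_of_isPolytopal {T : Set (E d)} (hT : IsPolytopal T) :
    Bornology.IsBounded T := by
  obtain ⟨S, rfl⟩ := hT
  refine Bornology.IsBounded.subset ?_ interior_subset
  rw [Bornology.isBounded_biUnion_finset]
  intro s _
  exact isBounded_convexHull.2 (Set.finite_range _).isBounded

theorem isOpen_of_isPolytopal {T : Set (E d)} (hT : IsPolytopal T) : IsOpen T := by
  obtain ⟨S, rfl⟩ := hT
  exact isOpen_interior

theorem nice_onElement {T : Set (E d)} (hT : IsPolytopal T) : Nice (onElement T) := by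
  have hb := isBounded_of_isPolytopal hT
  obtain ⟨R, hR⟩ := hb.exists_norm_le
  refine ⟨⟨by simpa [onElement] using hb.measure_lt_top⟩, R, ?_⟩
  filter_upwards [ae_restrict_mem (isOpen_of_isPolytopal hT).measurableSet] with x hx
  exact hR x hx

theorem nice_onFace {F U : Set (E d)} {n : E d} {c : ℝ} (hn : ‖n‖ = 1) (hU : IsOpen U)
    (hF : F = U ∩ {x | ⟪n, x⟫_ℝ = c}) (hb : Bornology.IsBounded F) : Nice (onFace F) := by
  have hmeas : MeasurableSet F := by
    rw [hF]
    exact hU.measurableSet.inter (isClosed_eq (by fun_prop) continuous_const).measurableSet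
  obtain ⟨R, hR⟩ := hb.exists_norm_le
  refine ⟨⟨?_⟩, R, ?_⟩
  swap
  · filter_upwards [ae_restrict_mem hmeas] with x hx
    exact hR x hx
  rw [onFace, Measure.restrict_apply_univ]
  rcases F.eq_empty_or_nonempty with he | ⟨x₀, hx₀⟩
  · simp [he]
  let W := (ℝ ∙ n)ᗮ
  have hn0 : n ≠ 0 := by rintro rfl; simp at hn
  have hW : Module.finrank ℝ W = d - 1 := by
    have h1 := Submodule.finrank_add_finrank_orthogonal (ℝ ∙ n)
    rw [finrank_span_singleton hn0, finrank_euclideanSpace_fin] at h1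
    change Module.finrank ℝ (ℝ ∙ n)ᗮ = d - 1
    omega
  let φ : W → E d := fun w => x₀ + w
  have hφ : Isometry φ := (IsometryEquiv.addLeft x₀).isometry.comp isometry_subtype_coe
  have himg : φ '' (φ ⁻¹' F) = F := by
    rw [Set.image_preimage_eq_iff]
    intro x hx
    refine ⟨⟨x - x₀, ?_⟩, by simp [φ]⟩
    rw [Submodule.mem_orthogonal_singleton_iff_inner_right, inner_sub_right]
    have h1 : ⟪n, x⟫_ℝ = c := by rw [hF] at hx; exact hx.2
    have h2 : ⟪n, x₀⟫_ℝ = c := by rw [hF] at hx₀; exact hx₀.2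
    rw [h1, h2, sub_self]
  rw [surface, ← himg, hφ.euclideanHausdorffMeasure_image, ← hW]
  have hb' : Bornology.IsBounded (φ ⁻¹' F) := by
    rw [Metric.isBounded_iff] at hb ⊢
    obtain ⟨C, hC⟩ := hb
    exact ⟨C, fun x hx y hy => by rw [← hφ.dist_eq]; exact hC hx hy⟩
  exact hb'.measure_lt_top

theorem ev_zero_of_isOpen {T : Set (E d)} (hT : IsOpen T) (hne : T.Nonempty)
    {p : MvPolynomial (Fin d) ℝ} (hp : ∀ᵐ x ∂onElement T, ev p x = 0) : p = 0 := by
  have hz : ∀ x ∈ T, ev p x = 0 := by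
    have h1 : (ev p) =ᵐ[volume.restrict T] fun _ => 0 := hp
    exact Measure.eqOn_open_of_ae_eq h1 hT (ev_continuous p).continuousOn continuousOn_const
  obtain ⟨x₀, hx₀⟩ := hne
  have hT' : IsOpen ((WithLp.ofLp : E d → Fin d → ℝ) '' T) :=
    (PiLp.homeomorph 2 (fun _ : Fin d => ℝ)).isOpenMap T hT
  obtain ⟨r, hr, hball⟩ := Metric.isOpen_iff.1 hT' (WithLp.ofLp x₀) ⟨x₀, hx₀, rfl⟩
  refine MvPolynomial.funext_set (fun i => Metric.ball (x₀ i) r) (fun i => ?_) fun y hy => ?_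
  · rw [Real.ball_eq_Ioo]
    exact Set.Ioo_infinite (by linarith)
  · rw [← ball_pi _ hr] at hy
    obtain ⟨x, hx, rfl⟩ := hball hy
    simpa [ev] using hz x hx

variable {Ω : Set (E d)} (M : PolytopalMesh Ω) {T : Set (E d)} {k : ℕ}

theorem PolytopalMesh.nice_element (hT : T ∈ M.elements) : Nice (onElement T) :=
  nice_onElement (M.partition.polytopal T hT)

theorem PolytopalMesh.nice_face (hT : T ∈ M.elements) (F : M.facesOf T) : Nice (onFace F.1) := by
  obtain ⟨hF, hFT⟩ := M.mem_facesOf.1 F.2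
  obtain ⟨c, U, hU, h⟩ := M.face_hyperplane F.1 hF
  refine nice_onFace (M.norm_normal F.1 hF) hU h ?_
  exact (isBounded_of_isPolytopal (M.partition.polytopal T hT)).closure.subset
    (hFT.trans frontier_subset_closure)

/-- The discrete gradient satisfies its defining equation. -/
theorem discreteGradient_spec (hT : T ∈ M.elements) (v : LocalHHO M T k)
    (τ : polyFields d (Fin d × Fin d) k) :
    innerL2 (onElement T) (discreteGradient M T v).1 τ.1 = gradRhs M T v τ.1 := by
  have hcont : ∀ (F : M.facesOf T) (τ : Fin d × Fin d → MvPolynomial (Fin d) ℝ),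
      Continuous fun x => ∑ i, ev ((v.2 F).1 i) x * ∑ j, ev (τ (i, j)) x * M.normal F j := by
    intro F τ
    have := @ev_continuous d
    fun_prop
  let ℓ : polyFields d (Fin d × Fin d) k →ₗ[ℝ] ℝ :=
    { toFun := fun τ => gradRhs M T v τ.1
      map_add' := fun τ τ' => by
        have h1 : divTensor (τ + τ').1 = divTensor τ.1 + divTensor τ'.1 := by
          ext1 i; simp [divTensor, Finset.sum_add_distrib]
        have h2 : ∀ F : M.facesOf T, (∫ x, ∑ i, ev ((v.2 F).1 i) x *
              ∑ j, ev ((τ + τ').1 (i, j)) x * M.normal F j ∂onFace F.1) =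
            (∫ x, ∑ i, ev ((v.2 F).1 i) x * ∑ j, ev (τ.1 (i, j)) x * M.normal F j ∂onFace F.1) +
            ∫ x, ∑ i, ev ((v.2 F).1 i) x *
              ∑ j, ev (τ'.1 (i, j)) x * M.normal F j ∂onFace F.1 := by
          intro F
          rw [← integral_add ((M.nice_face hT F).integrable (hcont F τ.1))
            ((M.nice_face hT F).integrable (hcont F τ'.1))]
          simp [add_mul, Finset.sum_add_distrib, mul_add]
        simp only [gradRhs, h1, h2, innerL2_add_right (M.nice_element hT), mul_add,
          Finset.sum_add_distrib]
        ring
      map_smul' := fun c τ => by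
        have h1 : divTensor (c • τ).1 = c • divTensor τ.1 := by
          ext1 i; simp [divTensor, Finset.smul_sum]
        have h2 : ∀ F : M.facesOf T, (∫ x, ∑ i, ev ((v.2 F).1 i) x *
              ∑ j, ev ((c • τ).1 (i, j)) x * M.normal F j ∂onFace F.1) =
            c * ∫ x, ∑ i, ev ((v.2 F).1 i) x *
              ∑ j, ev (τ.1 (i, j)) x * M.normal F j ∂onFace F.1 := by
          intro F
          rw [← integral_const_mul]
          congr 1
          ext x
          simp only [Submodule.coe_smul, Pi.smul_apply, ev_smul, Finset.mul_sum]
          exact Finset.sum_congr rfl fun i _ => Finset.sum_congr rfl fun j _ => by ring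
        simp only [gradRhs, h1, h2, innerL2_smul_right, RingHom.id_apply, smul_eq_mul, mul_add]
        rw [Finset.mul_sum]
        congr 1
        · ring
        · exact Finset.sum_congr rfl fun F _ => by ring }
  refine l2Rep_spec (M.nice_element hT) _ ℓ (fun w hw => ?_) τ
  have hw0 : w = 0 := by
    ext1
    funext i
    refine ev_zero_of_isOpen (isOpen_of_isPolytopal (M.partition.polytopal T hT))
      (M.partition.nonempty T hT) ?_
    filter_upwards [hw] with x hx using hx i
  rw [hw0, map_zero]

/-- The Stokes potential satisfies its defining conditions. -/
theorem stokesPotential_spec (hT : T ∈ M.elements) (v : LocalHHO M T k) :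
    IsStokesPotential M T v (stokesPotential M T v) := by
  refine Classical.epsilon_spec (p := IsStokesPotential M T v) ?_
  have hopen := isOpen_of_isPolytopal (M.partition.polytopal T hT)
  have hnice := M.nice_element hT
  have := hnice.1
  have hpos : (onElement T).real Set.univ ≠ 0 := by
    rw [Measure.real, ENNReal.toReal_ne_zero]
    refine ⟨?_, measure_ne_top _ _⟩
    rw [onElement, Measure.restrict_apply_univ]
    exact (hopen.measure_pos volume (M.partition.nonempty T hT)).ne'
  have key : ∀ i, ∃ p ∈ MvPolynomial.restrictTotalDegree (Fin d) ℝ (k + 1),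
      grad d p =
        (l2Proj (onElement T) (gradFields d k) fun j => (discreteGradient M T v).1 (i, j)).1 ∧
      ∫ x, ev p x ∂onElement T = ∫ x, ev (v.1.1 i) x ∂onElement T := by
    intro i
    obtain ⟨q, hq, hqe⟩ :=
      (l2Proj (onElement T) (gradFields d k) fun j => (discreteGradient M T v).1 (i, j)).2
    let c : ℝ := ((∫ x, ev (v.1.1 i) x ∂onElement T) - ∫ x, ev q x ∂onElement T) /
      (onElement T).real Set.univ
    refine ⟨q + MvPolynomial.C c, Submodule.add_mem _ hq ?_, ?_, ?_⟩
    · rw [MvPolynomial.mem_restrictTotalDegree, MvPolynomial.totalDegree_C]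
      exact Nat.zero_le _
    · rw [← hqe, map_add]
      have : grad d (MvPolynomial.C c) = 0 := by
        ext1 j; simp [grad]
      rw [this, add_zero]
    · have h1 : ∀ x : E d, ev (q + MvPolynomial.C c) x = ev q x + c := by intro x; simp [ev]
      simp only [h1]
      rw [integral_add (hnice.integrable (ev_continuous q)) (integrable_const c), integral_const,
        smul_eq_mul, mul_div_cancel₀ _ hpos]
      ring
  choose p hp hp' using key
  exact ⟨⟨p, fun i _ => hp i⟩, hp'⟩

end WellDefined

end

end HHO

namespace HHO

noncomputable section

/-! Write `h` for the diameter of `T`, `G` for the discrete gradient, `P` for the Stokes potential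
and `N` for `hhoNormSq`. All estimates are local to `T` and follow from a few inequalities for
polynomials of degree at most `k + 1`.

Regularity enters only through two facts (`PolytopalMesh.IsRegular.geometry`): `T` lies in a ball of
radius `h` and contains the concentric ball of radius `ρ² h`, and its faces have total area at most
a constant times `h^(d-1)`. After rescaling, equivalence of norms in finite dimension bounds a
polynomial and its derivatives on the large ball by the `L²`-norm on the small one. The inverse,
Poincaré and trace inequalities follow with constants depending on `d`, `k`, `ρ` only; `T` need be
neither convex nor connected, since everything takes place in the balls.

Upper bound. Integrating by parts in the definition of `G` leaves `∇v_T` and the jumps `v_T - v_F`;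
testing with `G` and using the trace inequality gives `‖G‖² ≲ N` (`discreteGradient_le`). Since `∇P`
is a projection of `G`, `‖∇P‖ ≤ ‖G‖`. As `P - v_T` has zero mean, Poincaré gives `‖P - v_T‖² ≲ h²
N`, and best approximation by the projectors on `T` and on the faces bounds the components of `v - I
P v` (`stokesForm_le`).

Lower bound. Let `δ = v - I P v`. In `v_T = δ_T + π_T P`, the inverse inequality bounds `∇δ_T`, and
it bounds `∇π_T P` after subtraction of a constant close to `P`. In `v_T - v_F = δ_T - δ_F - (π_F P
- π_T P)`, the last bracket is the face projection of `P - π_T P`. When `C_{f,T} < 1` the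
stabilisation has weight one and sees every face, so both are controlled (`hhoNormSq_le`).

The integration by parts requires a divergence theorem under weak assumptions on the mesh. It is
obtained by slicing along lines parallel to each axis (`PolytopalMesh.integral_pderiv`). Almost
every line crosses the boundary of `T` only inside faces of `T`, transversally, at points where `T`
is locally a half space. The one-dimensional fundamental theorem then applies, and the area formula
for graphs turns the sum over crossings into face integrals. -/

/-! ### Integration over a bounded subset of the line -/

/-- The indicator function of a set which is locally constant except for finitely many jumps, and
vanishes near `+∞`, is a sum of Heaviside functions. -/
theorem indicator_eq_sum_jumps {ι : Type*} (I : Finset ι) (z w : ι → ℝ)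
    (hz : Set.InjOn z I) (A : Set ℝ) (hA : BddAbove A)
    (hloc : ∀ s, (∀ i ∈ I, z i ≠ s) → (∀ᶠ t in 𝓝 s, t ∈ A) ∨ ∀ᶠ t in 𝓝 s, t ∉ A)
    (hjump : ∀ i ∈ I,
      (w i = 1 ∧ (∀ᶠ t in 𝓝[<] z i, t ∈ A) ∧ ∀ᶠ t in 𝓝[>] z i, t ∉ A) ∨
      (w i = -1 ∧ (∀ᶠ t in 𝓝[<] z i, t ∉ A) ∧ ∀ᶠ t in 𝓝[>] z i, t ∈ A))
    {s : ℝ} (hs : ∀ i ∈ I, z i ≠ s) :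
    A.indicator (fun _ => (1 : ℝ)) s = ∑ i ∈ I, if s < z i then w i else 0 := by
  classical
  -- The indicator `a` and the step function `H` have the same jumps. Once the values of `a` at the
  -- jump points are replaced by right limits, their difference is locally constant on the line,
  -- hence constant, and it vanishes far to the right.
  let a : ℝ → ℝ := A.indicator fun _ => 1
  let H : ℝ → ℝ := fun s => ∑ i ∈ I, if s < z i then w i else 0
  -- right limits
  let r : ℝ → ℝ := fun s =>
    if ∃ i ∈ I, z i = s then (if ∀ᶠ t in 𝓝[>] s, t ∈ A then 1 else 0) else a s
  have ha1 : ∀ t, t ∈ A → a t = 1 := fun t ht => Set.indicator_of_mem ht _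
  have ha0 : ∀ t, t ∉ A → a t = 0 := fun t ht => Set.indicator_of_notMem ht _
  have hne : ∀ s : ℝ, ∀ᶠ t in 𝓝[≠] s, ∀ i ∈ I, z i ≠ t := by
    intro s
    rw [Filter.eventually_all_finset]
    intro i _
    rcases eq_or_ne (z i) s with h | h
    · rw [h]
      filter_upwards [self_mem_nhdsWithin] with t ht using fun h => ht h.symm
    · exact nhdsWithin_le_nhds (eventually_ne_nhds h.symm |>.mono fun t ht => ht.symm)
  have hHR : ∀ s : ℝ, ∀ᶠ t in 𝓝[>] s, H t = H s := by
    intro s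
    have : ∀ᶠ t in 𝓝[>] s, ∀ i ∈ I, (t < z i ↔ s < z i) := by
      rw [Filter.eventually_all_finset]
      intro i _
      rcases lt_or_ge s (z i) with h | h
      · filter_upwards [nhdsWithin_le_nhds (eventually_lt_nhds h)] with t ht
        simp [ht, h]
      · filter_upwards [self_mem_nhdsWithin] with t ht
        have : z i < t := lt_of_le_of_lt h ht
        simp [not_lt.2 this.le, not_lt.2 h]
    filter_upwards [this] with t ht
    exact Finset.sum_congr rfl fun i hi => by simp only [ht i hi]
  -- The strict inequality in `H` makes it right-continuous; its left limit exceeds its value by the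
  -- weight of the jump at `s`.
  have hHL : ∀ s : ℝ, ∀ᶠ t in 𝓝[<] s, H t = H s + ∑ i ∈ I, if z i = s then w i else 0 := by
    intro s
    have : ∀ᶠ t in 𝓝[<] s, ∀ i ∈ I, (t < z i ↔ s ≤ z i) := by
      rw [Filter.eventually_all_finset]
      intro i _
      rcases lt_or_ge (z i) s with h | h
      · filter_upwards [nhdsWithin_le_nhds (eventually_gt_nhds h)] with t ht
        simp [not_lt.2 ht.le, not_le.2 h]
      · filter_upwards [self_mem_nhdsWithin] with t ht
        have : t < z i := lt_of_lt_of_le ht h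
        simp [this, h]
    filter_upwards [this] with t ht
    simp only [H]
    rw [← Finset.sum_add_distrib]
    refine Finset.sum_congr rfl fun i hi => ?_
    simp only [ht i hi]
    rcases lt_trichotomy s (z i) with h | h | h
    · simp [h, h.le, h.ne']
    · simp [h]
    · simp [not_le.2 h, not_lt.2 h.le, h.ne]
  have hrne : ∀ s, (∀ i ∈ I, z i ≠ s) → r s = a s := by
    intro s hs
    simp only [r]
    rw [if_neg]
    rintro ⟨i, hi, h⟩
    exact hs i hi h
  have hconst : IsLocallyConstant fun s => r s - H s := by
    rw [IsLocallyConstant.iff_eventually_eq]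
    intro s
    have key : ∀ᶠ t in 𝓝[≠] s, a t - H t = r s - H s := by
      by_cases hsI : ∃ i ∈ I, z i = s
      · obtain ⟨i, hi, rfl⟩ := hsI
        have hsum : (∑ i' ∈ I, if z i' = z i then w i' else 0) = w i := by
          rw [Finset.sum_eq_single i]
          · simp
          · intro b hb hbi
            rw [if_neg]
            exact fun h => hbi (hz hb hi h)
          · exact fun h => absurd hi h
        have hL := hHL (z i)
        rw [hsum] at hL
        have hr : r (z i) = if ∀ᶠ t in 𝓝[>] z i, t ∈ A then 1 else 0 := by
          simp only [r]
          rw [if_pos ⟨i, hi, rfl⟩]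
        rw [← nhdsLT_sup_nhdsGT, eventually_sup]
        rcases hjump i hi with ⟨hw, h1, h2⟩ | ⟨hw, h1, h2⟩
        · rw [if_neg] at hr
          · constructor
            · filter_upwards [hL, h1] with t ht ht'
              rw [ht, ha1 t ht', hr, hw]; ring
            · filter_upwards [hHR (z i), h2] with t ht ht'
              rw [ht, ha0 t ht', hr]
          · intro h
            obtain ⟨t, ht, ht'⟩ := (h.and h2).exists
            exact ht' ht
        · rw [if_pos h2] at hr
          constructor
          · filter_upwards [hL, h1] with t ht ht'
            rw [ht, ha0 t ht', hr, hw]; ring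
          · filter_upwards [hHR (z i), h2] with t ht ht'
            rw [ht, ha1 t ht', hr]
      · push Not at hsI
        have hL := hHL s
        rw [Finset.sum_eq_zero (fun i hi => if_neg (hsI i hi)), add_zero] at hL
        have hH : ∀ᶠ t in 𝓝[≠] s, H t = H s := by
          rw [← nhdsLT_sup_nhdsGT, eventually_sup]
          exact ⟨hL, hHR s⟩
        rw [hrne s hsI]
        rcases hloc s hsI with h | h
        · filter_upwards [hH, nhdsWithin_le_nhds h] with t ht ht'
          rw [ht, ha1 t ht', ha1 s h.self_of_nhds]
        · filter_upwards [hH, nhdsWithin_le_nhds h] with t ht ht'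
          rw [ht, ha0 t ht', ha0 s h.self_of_nhds]
    have key2 : ∀ᶠ t in 𝓝[≠] s, r t - H t = r s - H s := by
      filter_upwards [key, hne s] with t ht ht'
      rw [hrne t ht', ht]
    rw [eventually_nhdsWithin_iff] at key2
    filter_upwards [key2] with t ht
    by_cases h : t = s
    · rw [h]
    · exact ht h
  obtain ⟨R, hR⟩ := hA
  obtain ⟨R', hR'⟩ := (I.image z).bddAbove
  -- Beyond all jumps and beyond `A`, both functions vanish, which fixes the constant.
  let u := max R R' + 1
  have hu1 : ∀ i ∈ I, z i < u := fun i hi => by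
    have : z i ≤ R' := hR' (by simpa using ⟨i, hi, rfl⟩)
    have := le_max_right R R'
    simp only [u]; linarith
  have hu2 : u ∉ A := fun h => by
    have h1 := hR h
    have := le_max_left R R'
    simp only [u] at h1; linarith
  have h1 : r s - H s = r u - H u := hconst.apply_eq_of_isPreconnected isPreconnected_univ trivial trivial
  rw [hrne s hs, hrne u (fun i hi => (hu1 i hi).ne), ha0 u hu2] at h1
  have h2 : H u = 0 := Finset.sum_eq_zero fun i hi => if_neg (not_lt.2 (hu1 i hi).le)
  rw [h2, sub_zero, sub_eq_zero] at h1
  exact h1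

/-- The fundamental theorem of calculus over a bounded subset of the line with finitely many
boundary points. -/
theorem integral_deriv_eq_sum_jumps {ι : Type*} (I : Finset ι) (z w : ι → ℝ)
    (hz : Set.InjOn z I) (A : Set ℝ) (hA : Bornology.IsBounded A)
    (hloc : ∀ s, (∀ i ∈ I, z i ≠ s) → (∀ᶠ t in 𝓝 s, t ∈ A) ∨ ∀ᶠ t in 𝓝 s, t ∉ A)
    (hjump : ∀ i ∈ I,
      (w i = 1 ∧ (∀ᶠ t in 𝓝[<] z i, t ∈ A) ∧ ∀ᶠ t in 𝓝[>] z i, t ∉ A) ∨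
      (w i = -1 ∧ (∀ᶠ t in 𝓝[<] z i, t ∉ A) ∧ ∀ᶠ t in 𝓝[>] z i, t ∈ A))
    {f f' : ℝ → ℝ} (hf : ∀ s, HasDerivAt f (f' s) s) (hf' : Continuous f') :
    ∫ s, A.indicator f' s = ∑ i ∈ I, w i * f (z i) := by
  classical
  have hid := fun s hs => indicator_eq_sum_jumps I z w hz A hA.bddAbove hloc hjump (s := s) hs
  obtain ⟨R₀, hR₀⟩ := hA.exists_norm_le
  obtain ⟨R', hR'⟩ := (I.image fun i => |z i|).bddAbove
  let R := max (max R₀ R') 0 + 1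
  have hRz : ∀ i ∈ I, |z i| < R := fun i hi => by
    have h1 : |z i| ≤ R' := hR' (by simpa using ⟨i, hi, rfl⟩)
    have h2 : R' ≤ max (max R₀ R') 0 := le_max_of_le_left (le_max_right _ _)
    simp only [R]; linarith
  have hRA : ∀ s ∈ A, |s| < R := fun s hs => by
    have h1 := hR₀ s hs
    rw [Real.norm_eq_abs] at h1
    have h2 : R₀ ≤ max (max R₀ R') 0 := le_max_of_le_left (le_max_left _ _)
    simp only [R]; linarith
  have hR0 : 0 < R := by
    have := le_max_right (max R₀ R') 0
    simp only [R]; linarith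
  have hae : ∀ᵐ s : ℝ, ∀ i ∈ I, z i ≠ s := by
    rw [Filter.eventually_all_finset]
    intro i _
    filter_upwards [compl_mem_ae_iff.2 (measure_singleton (z i))] with s hs using fun h => hs h.symm
  -- To the left of `A` and of all jumps the indicator is zero while every Heaviside function equals
  -- one, so the weights cancel. This later removes the boundary values at `-R`.
  have hw : ∑ i ∈ I, w i = 0 := by
    have h1 := hid (-R) fun i hi h => by
      have := hRz i hi
      rw [h, abs_neg, abs_of_pos hR0] at this
      exact this.false
    rw [Set.indicator_of_notMem] at h1
    · rw [h1]
      refine Finset.sum_congr rfl fun i hi => ?_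
      rw [if_pos (abs_lt.1 (hRz i hi)).1]
    · intro h
      have := hRA _ h
      rw [abs_neg, abs_of_pos hR0] at this
      exact this.false
  have hint : ∀ a b, IntervalIntegrable f' volume a b := fun a b => hf'.intervalIntegrable a b
  have hft : ∀ a b, ∫ s in a..b, f' s = f b - f a := fun a b =>
    intervalIntegral.integral_eq_sub_of_hasDerivAt (fun s _ => hf s) (hint a b)
  calc ∫ s, A.indicator f' s
      = ∫ s in Set.Ioc (-R) R, A.indicator f' s := by
        rw [← integral_indicator measurableSet_Ioc]
        congr 1
        ext s
        by_cases h : s ∈ Set.Ioc (-R) R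
        · rw [Set.indicator_of_mem h]
        · rw [Set.indicator_of_notMem h, Set.indicator_of_notMem]
          exact fun hs => h ⟨(abs_lt.1 (hRA s hs)).1, (abs_lt.1 (hRA s hs)).2.le⟩
    _ = ∫ s in Set.Ioc (-R) R, ∑ i ∈ I, w i * (Set.Iio (z i)).indicator f' s := by
        refine integral_congr_ae (ae_restrict_of_ae ?_)
        filter_upwards [hae] with s hs
        have h1 : A.indicator f' s = A.indicator (fun _ => (1 : ℝ)) s * f' s := by
          by_cases h : s ∈ A <;> simp [h]
        rw [h1, hid s hs, Finset.sum_mul]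
        refine Finset.sum_congr rfl fun i _ => ?_
        by_cases h : s < z i <;> simp [h, Set.indicator]
    _ = ∑ i ∈ I, w i * ∫ s in Set.Ioc (-R) R, (Set.Iio (z i)).indicator f' s := by
        rw [integral_finsetSum]
        · simp only [integral_const_mul]
        · intro i _
          refine Integrable.const_mul ?_ _
          refine Integrable.indicator ?_ measurableSet_Iio
          exact (intervalIntegrable_iff_integrableOn_Ioc_of_le (by linarith)).1 (hint _ _)
    _ = ∑ i ∈ I, w i * (f (z i) - f (-R)) := by
        refine Finset.sum_congr rfl fun i hi => ?_
        have hi' := abs_lt.1 (hRz i hi)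
        rw [← hft, intervalIntegral.integral_of_le hi'.1.le,
          setIntegral_indicator measurableSet_Iio, integral_Ioc_eq_integral_Ioo]
        congr 3
        ext s
        simp only [Set.mem_inter_iff, Set.mem_Ioc, Set.mem_Iio, Set.mem_Ioo]
        constructor
        · rintro ⟨⟨h1, _⟩, h2⟩; exact ⟨h1, h2⟩
        · rintro ⟨h1, h2⟩; exact ⟨⟨h1, (h2.trans hi'.2).le⟩, h2⟩
    _ = ∑ i ∈ I, w i * f (z i) := by
        simp only [mul_sub, Finset.sum_sub_distrib, ← Finset.sum_mul, hw, zero_mul, sub_zero]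

/-! ### Lines parallel to a coordinate axis -/

/-- The point of `ℝ^(n+1)` whose `j`-th coordinate is `s` and whose other coordinates are
those of `y`. -/
def ins {n : ℕ} (j : Fin (n + 1)) (y : E n) (s : ℝ) : E (n + 1) :=
  WithLp.toLp 2 (j.insertNth s y.ofLp : Fin (n + 1) → ℝ)

section Ins

variable {n : ℕ} (j : Fin (n + 1))

@[simp] theorem ins_apply_same (y : E n) (s : ℝ) : ins j y s j = s := by simp [ins]

@[simp] theorem ins_apply_succAbove (y : E n) (s : ℝ) (i : Fin n) :
    ins j y s (j.succAbove i) = y i := by simp [ins]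

theorem ext_succAbove {x x' : E (n + 1)} (h : x j = x' j)
    (h' : ∀ i, x (j.succAbove i) = x' (j.succAbove i)) : x = x' := by
  ext i
  rcases Fin.eq_self_or_eq_succAbove j i with rfl | ⟨i, rfl⟩
  exacts [h, h' i]

theorem ins_add (y y' : E n) (s s' : ℝ) : ins j (y + y') (s + s') = ins j y s + ins j y' s' :=
  ext_succAbove j (by simp) (by simp)

theorem ins_smul (c : ℝ) (y : E n) (s : ℝ) : ins j (c • y) (c * s) = c • ins j y s :=
  ext_succAbove j (by simp) (by simp)

theorem ins_add_single (y : E n) (s t : ℝ) :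
    ins j y (s + t) = ins j y s + t • EuclideanSpace.single j 1 :=
  ext_succAbove j (by simp) (by simp)

theorem continuous_ins : Continuous fun p : ℝ × E n => ins j p.2 p.1 := by
  refine (PiLp.continuous_toLp 2 _).comp (continuous_pi fun i => ?_)
  rcases Fin.eq_self_or_eq_succAbove j i with rfl | ⟨i, rfl⟩
  · simpa using continuous_fst
  · simp only [Fin.insertNth_apply_succAbove]
    fun_prop

theorem continuous_ins_right (y : E n) : Continuous (ins j y) :=
  (continuous_ins j).comp (Continuous.prodMk_left y)

theorem abs_le_norm_ins (y : E n) (s : ℝ) : |s| ≤ ‖ins j y s‖ := by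
  simpa using PiLp.norm_apply_le (ins j y s) j

theorem measurePreserving_ins : MeasurePreserving fun p : ℝ × E n => ins j p.2 p.1 := by
  have h1 : MeasurePreserving (fun p : ℝ × E n => (p.1, p.2.ofLp)) :=
    (MeasurePreserving.id _).prod (PiLp.volume_preserving_ofLp (Fin n))
  have h2 := (volume_preserving_piFinSuccAbove (fun _ : Fin (n + 1) => ℝ) j).symm
  exact (PiLp.volume_preserving_toLp (Fin (n + 1))).comp (h2.comp h1)

theorem measurableEmbedding_ins : MeasurableEmbedding fun p : ℝ × E n => ins j p.2 p.1 := by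
  refine (continuous_ins j).measurableEmbedding fun p q h => ?_
  have h1 := congrArg (fun x : E (n + 1) => x j) h
  have h2 : p.2 = q.2 := by
    ext i
    have := congrArg (fun x : E (n + 1) => x (j.succAbove i)) h
    simpa using this
  exact Prod.ext (by simpa using h1) h2

/-- Integration along lines parallel to a coordinate axis. -/
theorem integral_eq_integral_integral_ins {f : E (n + 1) → ℝ} (hf : Integrable f) :
    ∫ x, f x = ∫ y : E n, ∫ s, f (ins j y s) := by
  rw [← (measurePreserving_ins j).integral_comp (measurableEmbedding_ins j)]
  have hi : Integrable (fun p : ℝ × E n => f (ins j p.2 p.1)) :=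
    ((measurePreserving_ins j).integrable_comp_emb (measurableEmbedding_ins j)).2 hf
  exact integral_prod_symm _ hi

/-- Affine functions along a line. -/
theorem affine_ins (g : E (n + 1) →ᵃ[ℝ] ℝ) (y : E n) (s : ℝ) :
    g (ins j y s) = g (ins j y 0) + s * g.linear (EuclideanSpace.single j 1) := by
  have h := g.map_vadd (ins j y 0) (s • EuclideanSpace.single j 1)
  rw [vadd_eq_add, add_comm (s • _) (ins j y 0), ← ins_add_single, zero_add s] at h
  rw [h, map_smul, vadd_eq_add, smul_eq_mul, add_comm]

end Ins

/-! ### The surface measure on a graph -/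

section Area

variable {n : ℕ} (j : Fin (n + 1))

/-- The linear part of the parametrisation of a graph over the `j`-th coordinate hyperplane. -/
def graphLin (a : E n) : E n →ₗ[ℝ] E (n + 1) where
  toFun y := ins j y ⟪a, y⟫_ℝ
  map_add' y y' := by rw [inner_add_right, ins_add]
  map_smul' c y := by rw [inner_smul_right, ins_smul]; rfl

/-- The Gram matrix of the images of the standard basis is the rank-one perturbation `1 + a aᵀ` of
the identity, whose determinant is `1 + |a|²`. -/
theorem normDet_graphLin_sq (a : E n) : (graphLin j a).normDet ^ 2 = 1 + ‖a‖ ^ 2 := by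
  have h := (graphLin j a).normDet_sq_eq_det_gram (EuclideanSpace.basisFun (Fin n) ℝ)
  have hg : Matrix.gram ℝ (fun i => graphLin j a (EuclideanSpace.basisFun (Fin n) ℝ i)) =
      1 + Matrix.replicateCol Unit a.ofLp * Matrix.replicateRow Unit a.ofLp := by
    ext i i'
    simp only [Matrix.gram_apply, graphLin, LinearMap.coe_mk, AddHom.coe_mk,
      EuclideanSpace.basisFun_apply, PiLp.inner_apply, Fin.sum_univ_succAbove _ j,
      ins_apply_same, ins_apply_succAbove, Matrix.add_apply, Matrix.mul_apply]
    simp [Matrix.one_apply, PiLp.single_apply, eq_comm, mul_comm, add_comm]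
  rw [hg, Matrix.det_one_add_replicateCol_mul_replicateRow] at h
  simp only [RCLike.ofReal_real_eq_id, id_eq] at h
  rw [h, EuclideanSpace.norm_sq_eq]
  simp [dotProduct, sq]

theorem surface_eq (n : ℕ) : surface (n + 1) = Measure.euclideanHausdorffMeasure n := rfl

/-- The part of the hyperplane `⟪ν, x⟫ = c` lying over a point. -/
def graphPt (ν : E (n + 1)) (c : ℝ) (y : E n) : ℝ :=
  (c - ∑ i, ν (j.succAbove i) * y i) / ν j

variable {ν : E (n + 1)} {c : ℝ}

theorem inner_ins (ν : E (n + 1)) (y : E n) (s : ℝ) :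
    ⟪ν, ins j y s⟫_ℝ = s * ν j + ∑ i, ν (j.succAbove i) * y i := by
  simp [PiLp.inner_apply, Fin.sum_univ_succAbove _ j, mul_comm]

theorem inner_ins_eq_iff (hν : ν j ≠ 0) (y : E n) (s : ℝ) : ⟪ν, ins j y s⟫_ℝ = c ↔ s = graphPt j ν c y := by
  rw [inner_ins, graphPt, eq_div_iff hν]
  constructor <;> intro h <;> linarith

/-- The area formula for a graph. -/
theorem surface_graph_image (hν : ν j ≠ 0) (h1 : ‖ν‖ = 1) (s : Set (E n)) :
    surface (n + 1) ((fun y => ins j y (graphPt j ν c y)) '' s) =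
      ENNReal.ofReal |ν j|⁻¹ * volume s := by
  -- The slope of the hyperplane seen as a graph. Since `ν` is a unit vector, `1 + |a|² = 1 / ν_j²`,
  -- whence the area factor `1 / |ν_j|`.
  let a : E n := WithLp.toLp 2 fun i => -(ν (j.succAbove i) / ν j)
  have ha : ∀ y, ins j y (graphPt j ν c y) =
      graphLin j a y + EuclideanSpace.single j (c / ν j) := by
    intro y
    refine ext_succAbove j ?_ (fun i => by simp [graphLin])
    simp only [ins_apply_same, graphPt, graphLin, LinearMap.coe_mk, AddHom.coe_mk, PiLp.add_apply,
      PiLp.single_apply, if_true, a, PiLp.inner_apply, sub_div, Finset.sum_div]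
    simp only [RCLike.inner_apply, conj_trivial, mul_neg, Finset.sum_neg_distrib]
    rw [sub_eq_add_neg, add_comm]
    congr 2
    exact Finset.sum_congr rfl fun i _ => by ring
  have hdet : (graphLin j a).normDet = |ν j|⁻¹ := by
    rw [← sq_eq_sq₀ (LinearMap.normDet_nonneg _) (by positivity), normDet_graphLin_sq,
      EuclideanSpace.norm_sq_eq]
    have h2 := EuclideanSpace.norm_sq_eq ν
    rw [h1, Fin.sum_univ_succAbove _ j] at h2
    simp only [a, norm_neg, norm_div, Real.norm_eq_abs, div_pow, sq_abs] at h2 ⊢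
    rw [← Finset.sum_div, inv_pow, sq_abs]
    field_simp
    linarith
  have himg : (fun y => ins j y (graphPt j ν c y)) '' s =
      IsometryEquiv.addRight (EuclideanSpace.single j (c / ν j)) '' (graphLin j a '' s) := by
    rw [Set.image_image]
    exact Set.image_congr fun y _ => ha y
  have h3 := (graphLin j a).euclideanHausdorffMeasure_image_eq_normDet_mul_volume s
  rw [finrank_euclideanSpace_fin] at h3
  rw [himg, surface_eq, (IsometryEquiv.isometry _).euclideanHausdorffMeasure_image, h3, hdet]

theorem continuous_graphPt : Continuous (graphPt j ν c) := by
  unfold graphPt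
  fun_prop

theorem measurableEmbedding_graph :
    MeasurableEmbedding fun y : E n => ins j y (graphPt j ν c y) := by
  refine Continuous.measurableEmbedding ?_ fun y y' h => ?_
  · exact (continuous_ins j).comp ((continuous_graphPt j).prodMk continuous_id)
  · ext i
    have := congrArg (fun x : E (n + 1) => x (j.succAbove i)) h
    simpa using this

theorem hyperplane_eq_graph (hν : ν j ≠ 0) (x : E (n + 1)) (hx : ⟪ν, x⟫_ℝ = c) :
    ins j (WithLp.toLp 2 fun i => x (j.succAbove i))
      (graphPt j ν c (WithLp.toLp 2 fun i => x (j.succAbove i))) = x := by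
  have h : ins j (WithLp.toLp 2 fun i => x (j.succAbove i)) (x j) = x :=
    ext_succAbove j (by simp) (by simp)
  have h2 := (inner_ins_eq_iff (c := c) j hν (WithLp.toLp 2 fun i => x (j.succAbove i)) (x j)).1
    (by rw [h]; exact hx)
  rw [← h2, h]

/-- The surface measure on a hyperplane is a multiple of the image of the Lebesgue measure under
the parametrisation of that hyperplane as a graph. -/
theorem map_graph_eq (hν : ν j ≠ 0) (h1 : ‖ν‖ = 1) :
    Measure.map (fun y => ins j y (graphPt j ν c y)) volume =
      ENNReal.ofReal |ν j| • (surface (n + 1)).restrict {x | ⟪ν, x⟫_ℝ = c} := by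
  have hH : MeasurableSet {x : E (n + 1) | ⟪ν, x⟫_ℝ = c} :=
    (isClosed_eq (by fun_prop) continuous_const).measurableSet
  ext s hs
  rw [(measurableEmbedding_graph j).map_apply, Measure.smul_apply,
    Measure.restrict_apply hs, smul_eq_mul]
  have : s ∩ {x | ⟪ν, x⟫_ℝ = c} = (fun y => ins j y (graphPt j ν c y)) ''
      ((fun y => ins j y (graphPt j ν c y)) ⁻¹' s) := by
    rw [Set.image_preimage_eq_inter_range]
    congr 1
    ext x
    constructor
    · intro hx
      exact ⟨_, hyperplane_eq_graph j hν x hx⟩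
    · rintro ⟨y, rfl⟩
      exact (inner_ins_eq_iff j hν _ _).2 rfl
  rw [this, surface_graph_image j hν h1, ← mul_assoc, ← ENNReal.ofReal_mul (abs_nonneg _),
    mul_inv_cancel₀ (abs_ne_zero.2 hν), ENNReal.ofReal_one, one_mul]

/-- Integration over a subset of a hyperplane seen as a graph. -/
theorem integral_graph (hν : ν j ≠ 0) (h1 : ‖ν‖ = 1) {F : Set (E (n + 1))} (hF : MeasurableSet F)
    (hFH : F ⊆ {x | ⟪ν, x⟫_ℝ = c}) (f : E (n + 1) → ℝ) :
    ∫ y, F.indicator f (ins j y (graphPt j ν c y)) = |ν j| * ∫ x, f x ∂onFace F := by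
  rw [← (measurableEmbedding_graph j).integral_map, map_graph_eq j hν h1,
    integral_smul_measure, ENNReal.toReal_ofReal (abs_nonneg _), smul_eq_mul, integral_indicator hF,
    Measure.restrict_restrict hF, Set.inter_eq_left.2 hFH]
  rfl

/-- Almost everywhere statements on a subset of a hyperplane seen as a graph. -/
theorem ae_graph (hν : ν j ≠ 0) (h1 : ‖ν‖ = 1) {F : Set (E (n + 1))} (hF : MeasurableSet F)
    {p : E (n + 1) → Prop}
    (hp : ∀ᵐ x ∂(surface (n + 1)).restrict F, p x) :
    ∀ᵐ y : E n, ins j y (graphPt j ν c y) ∈ F → p (ins j y (graphPt j ν c y)) := by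
  rw [ae_restrict_iff' hF] at hp
  have h2 : ∀ᵐ x ∂(ENNReal.ofReal |ν j| • (surface (n + 1)).restrict {x | ⟪ν, x⟫_ℝ = c}),
      x ∈ F → p x := Measure.ae_smul_measure (ae_restrict_of_ae hp) _
  rw [← map_graph_eq j hν h1, (measurableEmbedding_graph j).ae_map_iff] at h2
  exact h2

end Area

/-! ### The boundary of polytopal sets -/

section Polytopes

/-- The affine basis made of the vertices of a simplex. -/
def simplexBasis {d : ℕ} (s : Affine.Simplex ℝ (E d) d) : AffineBasis (Fin (d + 1)) ℝ (E d) :=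
  ⟨s.points, s.independent, by
    rw [s.independent.affineSpan_eq_top_iff_card_eq_finrank_add_one]
    simp⟩

theorem closedSimplex_eq {d : ℕ} (s : Affine.Simplex ℝ (E d) d) :
    closedSimplex s = {x | ∀ i, 0 ≤ (simplexBasis s).coord i x} :=
  (simplexBasis s).convexHull_eq_nonneg_coord

theorem openSimplex_eq {d : ℕ} (s : Affine.Simplex ℝ (E d) d) :
    openSimplex s = {x | ∀ i, 0 < (simplexBasis s).coord i x} :=
  (simplexBasis s).interior_convexHull

theorem isClosed_closedSimplex {d : ℕ} (s : Affine.Simplex ℝ (E d) d) :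
    IsClosed (closedSimplex s) :=
  (Set.Finite.isCompact_convexHull ℝ (Set.finite_range s.points)).isClosed

variable {n : ℕ}

theorem coord_linear_ne_zero (s : Affine.Simplex ℝ (E (n + 1)) (n + 1)) (i : Fin (n + 2)) :
    ((simplexBasis s).coord i).linear ≠ 0 := by
  intro h
  obtain ⟨i', hi'⟩ := exists_ne i
  have h1 := ((simplexBasis s).coord i).linearMap_vsub (simplexBasis s i) (simplexBasis s i')
  rw [h, (simplexBasis s).coord_apply_eq, (simplexBasis s).coord_apply_ne hi'.symm] at h1
  simp at h1

/-- A boundary point of a simplex lies on the hyperplane spanned by one of the facets. -/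
theorem exists_coord_eq_zero {d : ℕ} {s : Affine.Simplex ℝ (E d) d} {x : E d}
    (h : x ∈ closedSimplex s) (h' : x ∉ openSimplex s) :
    ∃ i, (simplexBasis s).coord i x = 0 := by
  rw [closedSimplex_eq] at h
  rw [openSimplex_eq] at h'
  simp only [Set.mem_ofPred_eq, not_forall, not_lt] at h h'
  obtain ⟨i, hi⟩ := h'
  exact ⟨i, le_antisymm hi (h i)⟩

/-- The union of closed simplices is closed, so taking the closure of its interior adds nothing to
the interior. This property excludes slits, that is, boundary pieces with the set on both sides, and
shows that the elements lie in `Ω`. -/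
theorem IsPolytopal.interior_closure {d : ℕ} {T : Set (E d)} (hT : IsPolytopal T) :
    interior (closure T) = T := by
  obtain ⟨S, rfl⟩ := hT
  have hc : IsClosed (⋃ s ∈ S, closedSimplex s) :=
    isClosed_biUnion_finset fun s _ => isClosed_closedSimplex s
  refine subset_antisymm (interior_mono ?_) (interior_maximal subset_closure isOpen_interior)
  exact closure_minimal interior_subset hc

/-- The boundary of a polytopal set is covered by finitely many hyperplanes. -/
theorem IsPolytopal.exists_hyperplanes {T : Set (E (n + 1))} (hT : IsPolytopal T) :
    ∃ G : Set (E (n + 1) →ᵃ[ℝ] ℝ), G.Finite ∧ (∀ g ∈ G, g.linear ≠ 0) ∧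
      ∀ x ∈ frontier T, ∃ g ∈ G, g x = 0 := by
  obtain ⟨S, rfl⟩ := hT
  have hc : IsClosed (⋃ s ∈ S, closedSimplex s) :=
    isClosed_biUnion_finset fun s _ => isClosed_closedSimplex s
  refine ⟨⋃ s ∈ S, Set.range fun i => (simplexBasis s).coord i,
    S.finite_toSet.biUnion fun s _ => Set.finite_range _, ?_, ?_⟩
  · simp only [Set.mem_iUnion, Set.mem_range]
    rintro g ⟨s, _, i, rfl⟩
    exact coord_linear_ne_zero s i
  · intro x hx
    have h1 : x ∈ ⋃ s ∈ S, closedSimplex s :=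
      closure_minimal interior_subset hc (frontier_subset_closure hx)
    simp only [Set.mem_iUnion] at h1
    obtain ⟨s, hs, hxs⟩ := h1
    have h2 : x ∉ openSimplex s := by
      intro h
      have h3 : x ∈ interior (⋃ s ∈ S, closedSimplex s) :=
        interior_mono (Set.subset_biUnion_of_mem (u := fun s => closedSimplex s) hs) h
      rw [isOpen_interior.frontier_eq] at hx
      exact hx.2 h3
    obtain ⟨i, hi⟩ := exists_coord_eq_zero hxs h2
    refine ⟨(simplexBasis s).coord i, ?_, hi⟩
    simp only [Set.mem_iUnion, Set.mem_range]
    exact ⟨s, hs, i, rfl⟩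

end Polytopes

/-! ### Local structure of the boundary -/

section LocalHalf

variable {d : ℕ}

theorem affine_add_smul (g : E d →ᵃ[ℝ] ℝ) (x v : E d) (t : ℝ) :
    g (x + t • v) = g x + t * g.linear v := by
  have h := g.map_vadd x (t • v)
  rw [vadd_eq_add, vadd_eq_add, add_comm (t • v) x] at h
  rw [h, map_smul, smul_eq_mul, add_comm]

/-- Near `x`, the set `T` coincides with the half space `{σ g > 0}`, up to the hyperplane
`{g = 0}`. -/
def LocalHalf (T : Set (E d)) (g : E d →ᵃ[ℝ] ℝ) (σ : ℝ) (x : E d) : Prop :=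
  ∀ᶠ z in 𝓝 x, (0 < σ * g z → z ∈ T) ∧ (σ * g z < 0 → z ∉ closure T)

/-- Moving from `x` along `σ g(v) v`, where the linear part of `g` does not vanish at `v`, makes `σ
g` positive. Each side of a hyperplane thus accumulates at each of its points. -/
theorem frequently_pos {g : E d →ᵃ[ℝ] ℝ} (hg : g.linear ≠ 0) {x : E d} (hx : g x = 0) {σ : ℝ}
    (hσ : σ ≠ 0) : ∃ᶠ z in 𝓝 x, 0 < σ * g z := by
  obtain ⟨v, hv⟩ := DFunLike.ne_iff.1 hg
  rw [LinearMap.zero_apply] at hv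
  have h1 : Tendsto (fun t : ℝ => x + t • (σ * g.linear v) • v) (𝓝[>] 0) (𝓝 x) := by
    have : Continuous fun t : ℝ => x + t • (σ * g.linear v) • v := by fun_prop
    have h2 := this.tendsto 0
    rw [zero_smul, add_zero] at h2
    exact h2.mono_left nhdsWithin_le_nhds
  refine h1.frequently (Eventually.frequently ?_)
  filter_upwards [self_mem_nhdsWithin] with t ht
  have ht' : 0 < t := ht
  rw [affine_add_smul, hx, zero_add, map_smul, smul_eq_mul,
    show σ * (t * (σ * g.linear v * g.linear v)) = t * (σ * g.linear v) ^ 2 by ring]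
  have : σ * g.linear v ≠ 0 := mul_ne_zero hσ hv
  positivity

/-- A set which is the interior of its closure is a half ball near a boundary point through which
a single hyperplane of the boundary passes. -/
theorem localHalf_of_mem_frontier {T : Set (E d)} (hT : IsOpen T)
    (hTc : interior (closure T) = T) {G : Set (E d →ᵃ[ℝ] ℝ)} (hG : G.Finite)
    (hcov : ∀ x ∈ frontier T, ∃ g ∈ G, g x = 0) {x : E d} (hx : x ∈ frontier T)
    {g₀ : E d →ᵃ[ℝ] ℝ} (hg₀ : g₀.linear ≠ 0)
    (hsame : ∀ g ∈ G, g x = 0 → ∀ z, g z = 0 → g₀ z = 0) :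
    LocalHalf T g₀ 1 x ∨ LocalHalf T g₀ (-1) x := by
  have hcont : ∀ g : E d →ᵃ[ℝ] ℝ, Continuous g := fun g => g.continuous_of_finiteDimensional
  have h1 : ∀ᶠ z in 𝓝 x, ∀ g ∈ G, g z = 0 → g x = 0 := by
    rw [Filter.eventually_all_finite hG]
    intro g _
    by_cases h : g x = 0
    · exact Eventually.of_forall fun _ _ => h
    · filter_upwards [(hcont g).continuousAt.eventually_ne h] with z hz hz'
      exact absurd hz' hz
  obtain ⟨ε, hε, hball⟩ := Metric.eventually_nhds_iff_ball.1 h1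
  have hfr : ∀ z ∈ Metric.ball x ε, z ∈ frontier T → g₀ z = 0 := by
    intro z hz hzT
    obtain ⟨g, hg, hgz⟩ := hcov z hzT
    exact hsame g hg (hball z hz g hg hgz) z hgz
  -- Near `x` the frontier lies in `{g₀ = 0}`, so each open half ball, being convex, lies entirely
  -- in `T` or entirely outside its closure.
  have hdich : ∀ σ : ℝ, σ ≠ 0 → (∀ z ∈ Metric.ball x ε, 0 < σ * g₀ z → z ∈ T) ∨
      (∀ z ∈ Metric.ball x ε, 0 < σ * g₀ z → z ∉ closure T) := by
    intro σ hσ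
    let B := Metric.ball x ε ∩ {z | 0 < σ * g₀ z}
    have hB : IsPreconnected B := by
      refine ((convex_ball x ε).inter ?_).isPreconnected
      have : Convex ℝ ((σ • g₀) ⁻¹' Set.Ioi 0) := (convex_Ioi 0).affine_preimage _
      exact this
    have hsub : B ⊆ T ∪ (closure T)ᶜ := by
      intro z hz
      by_contra hcon
      simp only [Set.mem_union, Set.mem_compl_iff, not_or, not_not] at hcon
      have h2 := hfr z hz.1 (by rw [hT.frontier_eq]; exact ⟨hcon.2, hcon.1⟩)
      have h3 : 0 < σ * g₀ z := hz.2
      rw [h2, mul_zero] at h3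
      exact h3.false
    have hdisj : Disjoint T (closure T)ᶜ :=
      Set.disjoint_left.2 fun z hz hz' => hz' (subset_closure hz)
    rcases hB.subset_or_subset hT isClosed_closure.isOpen_compl hdisj hsub with h | h
    · exact Or.inl fun z hz hz' => h ⟨hz, hz'⟩
    · exact Or.inr fun z hz hz' => h ⟨hz, hz'⟩
  have hev : ∀ᶠ z in 𝓝 x, z ∈ Metric.ball x ε := Metric.ball_mem_nhds x hε
  have hxT : x ∈ closure T ∧ x ∉ T := by rw [hT.frontier_eq] at hx; exact hx
  rcases hdich 1 one_ne_zero with hp | hp <;> rcases hdich (-1) (by norm_num) with hm | hm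
  -- With `T` on both sides, a neighbourhood of `x` lies in the closure of `T`, so `x` is in the
  -- interior of the closure, which is `T`.
  · exfalso
    apply hxT.2
    rw [← hTc, mem_interior_iff_mem_nhds]
    filter_upwards [hev] with z hz
    rcases lt_trichotomy (g₀ z) 0 with h | h | h
    · exact subset_closure (hm z hz (by linarith))
    · rw [mem_closure_iff_frequently]
      refine ((frequently_pos hg₀ h one_ne_zero).and_eventually
        (Metric.isOpen_ball.mem_nhds hz)).mono fun w hw => hp w hw.2 hw.1
    · exact subset_closure (hp z hz (by linarith))
  · left
    filter_upwards [hev] with z hz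
    exact ⟨hp z hz, fun h => hm z hz (by linarith)⟩
  · right
    filter_upwards [hev] with z hz
    exact ⟨hm z hz, fun h => hp z hz (by linarith)⟩
  -- With `T` on neither side, `T` would be contained in a hyperplane near `x`, which is impossible
  -- for an open set having `x` in its closure.
  · exfalso
    obtain ⟨z, hz, hzT⟩ := (mem_closure_iff_frequently.1 hxT.1).and_eventually hev |>.exists
    have hz0 : g₀ z = 0 := by
      rcases lt_trichotomy (g₀ z) 0 with h | h | h
      · exact absurd (subset_closure hz) (hm z hzT (by linarith))
      · exact h
      · exact absurd (subset_closure hz) (hp z hzT (by linarith))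
    have hev' : ∀ᶠ w in 𝓝 z, w ∈ T ∧ w ∈ Metric.ball x ε := by
      filter_upwards [hT.mem_nhds hz, Metric.isOpen_ball.mem_nhds hzT] with w h h' using ⟨h, h'⟩
    obtain ⟨w, hw, hw1, hw2⟩ :=
      ((frequently_pos hg₀ hz0 one_ne_zero).and_eventually hev').exists
    exact hp w hw2 hw (subset_closure hw1)

/-- Two sets lying on the same side of a hyperplane meet. -/
theorem LocalHalf.inter_nonempty {T T' : Set (E d)} {g : E d →ᵃ[ℝ] ℝ} {σ : ℝ} {x : E d}
    (h : LocalHalf T g σ x) (h' : LocalHalf T' g σ x) (hg : g.linear ≠ 0) (hx : g x = 0)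
    (hσ : σ ≠ 0) : (T ∩ T').Nonempty := by
  obtain ⟨z, hz, h1, h2⟩ := ((frequently_pos hg hx hσ).and_eventually (h.and h')).exists
  exact ⟨z, h1.1 hz, h2.1 hz⟩

/-- Two sets lying on opposite sides of a hyperplane are not included in each other. -/
theorem LocalHalf.not_subset {T T' : Set (E d)} {g : E d →ᵃ[ℝ] ℝ} {σ : ℝ} {x : E d}
    (h : LocalHalf T g σ x) (h' : LocalHalf T' g (-σ) x) (hg : g.linear ≠ 0) (hx : g x = 0)
    (hσ : σ ≠ 0) : ¬ T ⊆ T' := by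
  intro hsub
  obtain ⟨z, hz, h1, h2⟩ := ((frequently_pos hg hx hσ).and_eventually (h.and h')).exists
  exact h2.2 (by linarith) (subset_closure (hsub (h1.1 hz)))

end LocalHalf

/-! ### Generic lines -/

section Generic

variable {n : ℕ} (j : Fin (n + 1))

theorem volume_affine_zero {g : E n →ᵃ[ℝ] ℝ} (hg : ∃ y, g y ≠ 0) : volume {y | g y = 0} = 0 := by
  let s : AffineSubspace ℝ (E n) := (AffineSubspace.mk' (0 : ℝ) ⊥).comap g
  have hs : (s : Set (E n)) = {y | g y = 0} := by
    ext y
    simp [s, AffineSubspace.mem_mk']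
  rw [← hs]
  refine Measure.addHaar_affineSubspace _ _ fun htop => ?_
  obtain ⟨y, hy⟩ := hg
  have : y ∈ (s : Set (E n)) := by rw [htop]; trivial
  rw [hs] at this
  exact hy this

theorem exists_ins (x : E (n + 1)) : ∃ y s, ins j y s = x :=
  ⟨WithLp.toLp 2 fun i => x (j.succAbove i), x j, ext_succAbove j (by simp) (by simp)⟩

/-- A hyperplane parallel to the axis projects along it onto a proper affine subspace of the
parameter space, hence onto a null set. -/
theorem ae_affine_ne_zero {g : E (n + 1) →ᵃ[ℝ] ℝ}
    (hg0 : g.linear (EuclideanSpace.single j 1) = 0) (hg : ∃ x, g x ≠ 0) :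
    ∀ᵐ y : E n, g (ins j y 0) ≠ 0 := by
  have h1 : ∀ y, (g.comp (graphLin j (0 : E n)).toAffineMap) y = g (ins j y 0) := by
    intro y
    simp [graphLin]
  have h2 : volume {y | (g.comp (graphLin j (0 : E n)).toAffineMap) y = 0} = 0 := by
    refine volume_affine_zero ?_
    obtain ⟨x, hx⟩ := hg
    obtain ⟨y, s, rfl⟩ := exists_ins j x
    rw [affine_ins, hg0, mul_zero, add_zero] at hx
    exact ⟨y, by rwa [h1]⟩
  simp only [h1] at h2
  exact measure_eq_zero_iff_ae_notMem.1 h2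

/-- A line meets no hyperplane to which it is parallel, and meets distinct hyperplanes at distinct
points. -/
def GenericLine (G : Set (E (n + 1) →ᵃ[ℝ] ℝ)) (y : E n) : Prop :=
  (∀ g ∈ G, ∀ s, g (ins j y s) = 0 → g.linear (EuclideanSpace.single j 1) ≠ 0) ∧
    ∀ g ∈ G, ∀ g' ∈ G, ∀ s, g (ins j y s) = 0 → g' (ins j y s) = 0 → ∀ z, g z = 0 → g' z = 0

/-- Hyperplanes parallel to the axis are missed by almost every line. The common zeros of two
transversal functions lie on the zero set of a combination that is constant along the axis; almost
every line misses that set too, unless the combination vanishes identically and the two hyperplanes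
coincide. -/
theorem ae_genericLine {G : Set (E (n + 1) →ᵃ[ℝ] ℝ)} (hG : G.Finite)
    (hne : ∀ g ∈ G, g.linear ≠ 0) : ∀ᵐ y : E n, GenericLine j G y := by
  have h1 : ∀ᵐ y : E n, ∀ g ∈ G, ∀ s, g (ins j y s) = 0 →
      g.linear (EuclideanSpace.single j 1) ≠ 0 := by
    rw [Filter.eventually_all_finite hG]
    intro g hg
    by_cases h : g.linear (EuclideanSpace.single j 1) = 0
    · have hx : ∃ x, g x ≠ 0 := by
        by_contra! hcon
        refine hne g hg (LinearMap.ext fun v => ?_)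
        have := affine_add_smul g 0 v 1
        rw [hcon, hcon] at this
        simpa using this.symm
      filter_upwards [ae_affine_ne_zero j h hx] with y hy s hs
      rw [affine_ins, h, mul_zero, add_zero] at hs
      exact absurd hs hy
    · exact Eventually.of_forall fun y s _ => h
  have h2 : ∀ᵐ y : E n, ∀ g ∈ G, ∀ g' ∈ G, ∀ s, g.linear (EuclideanSpace.single j 1) ≠ 0 →
      g (ins j y s) = 0 → g' (ins j y s) = 0 → ∀ z, g z = 0 → g' z = 0 := by
    rw [Filter.eventually_all_finite hG]
    intro g hg
    rw [Filter.eventually_all_finite hG]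
    intro g' hg'
    let b := g.linear (EuclideanSpace.single j 1)
    let b' := g'.linear (EuclideanSpace.single j 1)
    -- The coefficients are chosen to cancel the derivative in the direction of the axis.
    let φ : E (n + 1) →ᵃ[ℝ] ℝ := b' • g - b • g'
    have hφ : ∀ x, φ x = b' * g x - b * g' x := fun x => rfl
    have hφ0 : φ.linear (EuclideanSpace.single j 1) = 0 := by
      change b' * b - b * b' = 0
      ring
    by_cases h : ∃ x, φ x ≠ 0
    · filter_upwards [ae_affine_ne_zero j hφ0 h] with y hy s _ hs hs'
      exfalso
      apply hy
      have h3 := affine_ins j φ y s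
      rw [hφ0, mul_zero, add_zero, hφ, hs, hs'] at h3
      rw [← h3]; ring
    · push Not at h
      refine Eventually.of_forall fun y s hb _ _ z hz => ?_
      have h3 := h z
      rw [hφ, hz, mul_zero, zero_sub, neg_eq_zero] at h3
      exact (mul_eq_zero.1 h3).resolve_left hb
  filter_upwards [h1, h2] with y hy1 hy2
  exact ⟨hy1, fun g hg g' hg' s hs hs' => hy2 g hg g' hg' s (hy1 g hg s hs) hs hs'⟩

end Generic

/-! ### The divergence theorem on a mesh element -/

section Divergence

theorem hasFDerivAt_ev {d : ℕ} (p : MvPolynomial (Fin d) ℝ) (x : E d) :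
    HasFDerivAt (ev p) (∑ i, ev (MvPolynomial.pderiv i p) x •
      (EuclideanSpace.proj i : E d →L[ℝ] ℝ)) x := by
  induction p using MvPolynomial.induction_on with
  | C a =>
    have : (ev (MvPolynomial.C a) : E d → ℝ) = fun _ => a := by ext; simp [ev]
    rw [this]
    simpa [ev] using hasFDerivAt_const a x
  | add p q hp hq =>
    have : (ev (p + q) : E d → ℝ) = fun x => ev p x + ev q x := by ext; simp
    rw [this]
    refine (hp.add hq).congr_fderiv ?_
    simp [add_smul, Finset.sum_add_distrib]
  | mul_X p i hp =>
    have : (ev (p * MvPolynomial.X i) : E d → ℝ) =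
        fun x => ev p x * (EuclideanSpace.proj i : E d →L[ℝ] ℝ) x := by ext; simp [ev]
    rw [this]
    refine (hp.mul (EuclideanSpace.proj i : E d →L[ℝ] ℝ).hasFDerivAt).congr_fderiv ?_
    have h1 : ∀ i', ev (MvPolynomial.pderiv i' (p * MvPolynomial.X i)) x =
        (if i' = i then ev p x else 0) + x i * ev (MvPolynomial.pderiv i' p) x := by
      intro i'
      by_cases h : i' = i
      · subst h; simp [ev, Derivation.leibniz, MvPolynomial.pderiv_X]
      · simp [ev, Derivation.leibniz, MvPolynomial.pderiv_X, h]
    simp only [h1, add_smul, Finset.sum_add_distrib, ite_smul, zero_smul, Finset.sum_ite_eq',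
      Finset.mem_univ, if_true, Finset.smul_sum, mul_smul]
    rfl

variable {n : ℕ} (j : Fin (n + 1))

theorem hasDerivAt_ev_ins (p : MvPolynomial (Fin (n + 1)) ℝ) (y : E n) (s : ℝ) :
    HasDerivAt (fun s => ev p (ins j y s)) (ev (MvPolynomial.pderiv j p) (ins j y s)) s := by
  have h1 : HasDerivAt (ins j y) (EuclideanSpace.single j 1) s := by
    have h : ins j y = fun s => ins j y 0 + s • EuclideanSpace.single j 1 := by
      ext1 s; rw [← ins_add_single, zero_add s]
    rw [h]
    simpa using ((hasDerivAt_id s).smul_const (EuclideanSpace.single j (1 : ℝ))).const_add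
      (ins j y 0)
  have h2 := (hasFDerivAt_ev p (ins j y s)).comp_hasDerivAt s h1
  refine h2.congr_deriv ?_
  simp [PiLp.single_apply]

/-- The affine function vanishing on the hyperplane `⟪ν, x⟫ = c`. -/
def planeMap {d : ℕ} (ν : E d) (c : ℝ) : E d →ᵃ[ℝ] ℝ :=
  (innerSL ℝ ν).toLinearMap.toAffineMap + AffineMap.const ℝ (E d) (-c)

theorem planeMap_apply {d : ℕ} (ν : E d) (c : ℝ) (x : E d) : planeMap ν c x = ⟪ν, x⟫_ℝ - c := by
  simp [planeMap, sub_eq_add_neg]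

theorem planeMap_linear {d : ℕ} (ν : E d) (c : ℝ) (v : E d) :
    (planeMap ν c).linear v = ⟪ν, v⟫_ℝ := by
  simp [planeMap]

theorem planeMap_linear_ne_zero {d : ℕ} {ν : E d} (hν : ‖ν‖ = 1) (c : ℝ) :
    (planeMap ν c).linear ≠ 0 := by
  intro h
  have := planeMap_linear ν c ν
  rw [h, real_inner_self_eq_norm_sq, hν] at this
  simp at this

theorem planeMap_linear_single (ν : E (n + 1)) (c : ℝ) :
    (planeMap ν c).linear (EuclideanSpace.single j 1) = ν j := by
  rw [planeMap_linear, EuclideanSpace.inner_single_right]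
  simp

/-! ### Which mesh faces lie on the boundary of an element -/

section Mesh

variable {d : ℕ} {Ω : Set (E d)} (M : PolytopalMesh Ω) {T : Set (E d)}

theorem PolytopalMesh.isOpen_element (hT : T ∈ M.elements) : IsOpen T :=
  isOpen_of_isPolytopal (M.partition.polytopal T hT)

theorem PolytopalMesh.element_subset (hΩ : IsPolytopal Ω) (hT : T ∈ M.elements) : T ⊆ Ω := by
  rw [← hΩ.interior_closure]
  refine interior_maximal ?_ (M.isOpen_element hT)
  rw [M.partition.cover]
  exact subset_closure.trans (Set.subset_biUnion_of_mem (u := fun T => closure T) hT)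

theorem PolytopalMesh.eq_of_inter_nonempty {T' : Set (E d)} (hT : T ∈ M.elements)
    (hT' : T' ∈ M.elements) (h : (T ∩ T').Nonempty) : T = T' := by
  by_contra hne
  exact (Set.not_disjoint_iff_nonempty_inter.2 h) (M.partition.disjoint T hT T' hT' hne)

theorem PolytopalMesh.exists_planes : ∃ c : Set (E d) → ℝ, ∀ F ∈ M.faces,
    MeasurableSet F ∧ F ⊆ {x | ⟪M.normal F, x⟫_ℝ = c F} := by
  have h : ∀ F, ∃ c : ℝ, F ∈ M.faces → MeasurableSet F ∧ F ⊆ {x | ⟪M.normal F, x⟫_ℝ = c} := by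
    intro F
    by_cases hF : F ∈ M.faces
    · obtain ⟨c, U, hU, h⟩ := M.face_hyperplane F hF
      refine ⟨c, fun _ => ⟨?_, ?_⟩⟩
      · rw [h]
        exact hU.measurableSet.inter (isClosed_eq (by fun_prop) continuous_const).measurableSet
      · exact h.subset.trans Set.inter_subset_right
    · exact ⟨0, fun h => absurd h hF⟩
  choose c hc using h
  exact ⟨c, hc⟩

/-- A mesh face that meets the boundary of an element at a generic point is a face of it. -/
theorem PolytopalMesh.face_subset_frontier (hΩ : IsPolytopal Ω) (hT : T ∈ M.elements)
    {F : Set (E d)} (hF : F ∈ M.faces) {x : E d} (hxF : x ∈ F) (hxT : x ∈ frontier T)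
    {g : E d →ᵃ[ℝ] ℝ} (hg : g.linear ≠ 0) (hgx : g x = 0)
    (hloc : ∀ T', T' ∈ M.elements ∨ T' = Ω → x ∈ frontier T' →
      LocalHalf T' g 1 x ∨ LocalHalf T' g (-1) x) : F ⊆ frontier T := by
  -- Two elements on the same side of the hyperplane near `x` overlap, hence are equal. It remains
  -- to find an element bounded by `F` on the same side as `T`.
  have key : ∀ T' ∈ M.elements, ∀ σ : ℝ, σ ≠ 0 → F ⊆ frontier T' → LocalHalf T g σ x →
      LocalHalf T' g σ x → F ⊆ frontier T := by
    intro T' hT' σ hσ hFT' h h'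
    rw [M.eq_of_inter_nonempty hT hT' (h.inter_nonempty h' hg hgx hσ)]
    exact hFT'
  have hT0 := hloc T (Or.inl hT) hxT
  rcases M.face_kind F hF with ⟨T₁, hT₁, T₂, hT₂, hne, hF12⟩ | ⟨T₁, hT₁, hF1⟩
  -- At an interface the two distinct elements occupy opposite sides, so `T` shares its side with
  -- one of them.
  · have hF1 : F ⊆ frontier T₁ := hF12.trans Set.inter_subset_left
    have hF2 : F ⊆ frontier T₂ := hF12.trans Set.inter_subset_right
    have hkey : ∀ σ : ℝ, σ ≠ 0 → LocalHalf T₁ g σ x → ¬ LocalHalf T₂ g σ x :=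
      fun σ hσ h h' =>
        hne (M.eq_of_inter_nonempty hT₁ hT₂ (h.inter_nonempty h' hg hgx hσ))
    have h1 := hloc T₁ (Or.inl hT₁) (hF1 hxF)
    have h2 := hloc T₂ (Or.inl hT₂) (hF2 hxF)
    have e1 : (1 : ℝ) ≠ 0 := one_ne_zero
    have e2 : (-1 : ℝ) ≠ 0 := by norm_num
    rcases hT0 with h0 | h0 <;> rcases h1 with h1 | h1
    · exact key T₁ hT₁ 1 e1 hF1 h0 h1
    · exact key T₂ hT₂ 1 e1 hF2 h0 (h2.resolve_right (hkey _ e2 h1))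
    · exact key T₂ hT₂ (-1) e2 hF2 h0 (h2.resolve_left (hkey _ e1 h1))
    · exact key T₁ hT₁ (-1) e2 hF1 h0 h1
  -- On the boundary, `Ω` occupies only one side, and `T` and `T₁`, being contained in `Ω`, are both
  -- on that side.
  · have hF1' : F ⊆ frontier T₁ := hF1.trans Set.inter_subset_left
    have h1 := hloc T₁ (Or.inl hT₁) (hF1' hxF)
    have h2 := hloc Ω (Or.inr rfl) (hF1 hxF).2
    have e1 : (1 : ℝ) ≠ 0 := one_ne_zero
    have e2 : (-1 : ℝ) ≠ 0 := by norm_num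
    have hs := M.element_subset hΩ hT
    have hs₁ := M.element_subset hΩ hT₁
    rcases h2 with h2 | h2
    · have hno : ∀ T', T' ⊆ Ω → ¬ LocalHalf T' g (-1) x := fun T' hsub h =>
        h.not_subset (by rwa [neg_neg]) hg hgx e2 hsub
      exact key T₁ hT₁ 1 e1 hF1' (hT0.resolve_right (hno T hs)) (h1.resolve_right (hno T₁ hs₁))
    · have hno : ∀ T', T' ⊆ Ω → ¬ LocalHalf T' g 1 x := fun T' hsub h =>
        h.not_subset h2 hg hgx e1 hsub
      exact key T₁ hT₁ (-1) e2 hF1' (hT0.resolve_left (hno T hs)) (h1.resolve_left (hno T₁ hs₁))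

end Mesh

/-! ### Crossings of the boundary of an element by almost every line -/

section Lines

variable {Ω : Set (E (n + 1))} (M : PolytopalMesh Ω) {T : Set (E (n + 1))}

/-- For almost every line parallel to the `j`-th axis: it meets the boundary of `T` in faces of `T`
only, transversally, at points around which `T` is a half ball. -/
theorem PolytopalMesh.ae_line (hΩ : IsPolytopal Ω) (hT : T ∈ M.elements)
    {c : Set (E (n + 1)) → ℝ} (hc : ∀ F ∈ M.faces,
      MeasurableSet F ∧ F ⊆ {x | ⟪M.normal F, x⟫_ℝ = c F}) :
    ∀ᵐ y : E n, ∀ s, ins j y s ∈ frontier T → ∃ F ∈ M.facesOf T, M.normal F j ≠ 0 ∧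
      ins j y s ∈ F ∧ LocalHalf T (planeMap (M.normal F) (c F)) (-M.orient T F) (ins j y s) := by
  classical
  have hex : ∀ T', T' ∈ M.elements ∨ T' = Ω → ∃ G : Set (E (n + 1) →ᵃ[ℝ] ℝ), G.Finite ∧
      (∀ g ∈ G, g.linear ≠ 0) ∧ ∀ x ∈ frontier T', ∃ g ∈ G, g x = 0 := by
    rintro T' (h | rfl)
    exacts [(M.partition.polytopal T' h).exists_hyperplanes, hΩ.exists_hyperplanes]
  have hpoly : ∀ T', T' ∈ M.elements ∨ T' = Ω → IsPolytopal T' := by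
    rintro T' (h | rfl)
    exacts [M.partition.polytopal T' h, hΩ]
  choose! G hGfin hGne hGcov using hex
  let Gf : Set (E (n + 1) →ᵃ[ℝ] ℝ) := (fun F => planeMap (M.normal F) (c F)) '' M.faces
  -- All hyperplanes of the elements, of `Ω` and of the faces are made generic together. At a point
  -- of a face on a generic line, every frontier hyperplane through it is then the hyperplane of
  -- that face.
  let GG : Set (E (n + 1) →ᵃ[ℝ] ℝ) := (⋃ T' ∈ insert Ω M.elements, G T') ∪ Gf
  have hmemT : ∀ T', T' ∈ insert Ω M.elements ↔ T' ∈ M.elements ∨ T' = Ω := fun T' => by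
    rw [Finset.mem_insert, or_comm]
  have hGGfin : GG.Finite := by
    refine Set.Finite.union ?_ (M.faces.finite_toSet.image _)
    exact (insert Ω M.elements).finite_toSet.biUnion fun T' hT' => hGfin T' ((hmemT T').1 hT')
  have hGGne : ∀ g ∈ GG, g.linear ≠ 0 := by
    rintro g (hg | ⟨F, hF, rfl⟩)
    · simp only [Set.mem_iUnion] at hg
      obtain ⟨T', hT', hg⟩ := hg
      exact hGne T' ((hmemT T').1 hT') g hg
    · exact planeMap_linear_ne_zero (M.norm_normal F hF) _
  have hGsub : ∀ T', T' ∈ M.elements ∨ T' = Ω → ∀ g ∈ G T', g ∈ GG := fun T' hT' g hg => by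
    refine Or.inl ?_
    simp only [Set.mem_iUnion]
    exact ⟨T', (hmemT T').2 hT', hg⟩
  have hclo : ∀ F ∈ M.faces, closure F ⊆ {x | ⟪M.normal F, x⟫_ℝ = c F} := fun F hF =>
    closure_minimal (hc F hF).2 (isClosed_eq (by fun_prop) continuous_const)
  -- The skeleton is covered only by the closures of the faces. Since `closure F \ F` has zero
  -- surface measure, almost every line that crosses such a closure transversally does so inside the
  -- face itself.
  have hae1 : ∀ᵐ y : E n, ∀ F ∈ M.faces, M.normal F j ≠ 0 →
      ins j y (graphPt j (M.normal F) (c F) y) ∈ closure F →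
      ins j y (graphPt j (M.normal F) (c F) y) ∈ F := by
    rw [Filter.eventually_all_finset]
    intro F hF
    by_cases h : M.normal F j = 0
    · exact Eventually.of_forall fun y hy => absurd h hy
    · have h1 : ∀ᵐ x ∂(surface (n + 1)).restrict (closure F), x ∈ F := by
        rw [ae_restrict_iff' isClosed_closure.measurableSet]
        refine (measure_eq_zero_iff_ae_notMem.1 (M.face_null F hF)).mono fun x hx hx' => ?_
        by_contra hcon
        exact hx ⟨hx', hcon⟩
      filter_upwards [ae_graph (c := c F) j h (M.norm_normal F hF)
        isClosed_closure.measurableSet h1] with y hy _ using hy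
  have hae2 : ∀ᵐ y : E n, ∀ F ∈ M.facesOf T, M.normal F j ≠ 0 →
      ins j y (graphPt j (M.normal F) (c F) y) ∈ F →
      ∀ᶠ t : ℝ in 𝓝[>] 0, ins j y (graphPt j (M.normal F) (c F) y) -
        t • M.orient T F • M.normal F ∈ T := by
    rw [Filter.eventually_all_finset]
    intro F hF
    obtain ⟨hF, hFT⟩ := M.mem_facesOf.1 hF
    by_cases h : M.normal F j = 0
    · exact Eventually.of_forall fun y hy => absurd h hy
    · filter_upwards [ae_graph (c := c F) j h (M.norm_normal F hF) (hc F hF).1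
        (M.orient_out T hT F hF hFT)] with y hy _ hyF
      exact (hy hyF).mono fun t ht => ht.2
  filter_upwards [ae_genericLine j hGGfin hGGne, hae1, hae2] with y hgen hy1 hy2 s hs
  obtain ⟨F, hF, hxF⟩ : ∃ F ∈ M.faces, ins j y s ∈ closure F := by
    have h1 : ins j y s ∈ ⋃ T ∈ M.elements, frontier T := by
      simp only [Set.mem_iUnion]
      exact ⟨T, hT, hs⟩
    rw [M.skeleton] at h1
    simpa only [Set.mem_iUnion, exists_prop] using h1
  let g := planeMap (M.normal F) (c F)
  have hgx : g (ins j y s) = 0 := by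
    rw [planeMap_apply, sub_eq_zero]
    exact hclo F hF hxF
  have hgG : g ∈ GG := Or.inr ⟨F, hF, rfl⟩
  have hFj : M.normal F j ≠ 0 := by
    have := hgen.1 g hgG s hgx
    rwa [planeMap_linear_single] at this
  have hsg : s = graphPt j (M.normal F) (c F) y :=
    (inner_ins_eq_iff j hFj y s).1 (hclo F hF hxF)
  have hxF' : ins j y s ∈ F := by
    have := hy1 F hF hFj
    rw [← hsg] at this
    exact this hxF
  have hgl : g.linear ≠ 0 := hGGne g hgG
  have hloc : ∀ T', T' ∈ M.elements ∨ T' = Ω → ins j y s ∈ frontier T' →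
      LocalHalf T' g 1 (ins j y s) ∨ LocalHalf T' g (-1) (ins j y s) := by
    intro T' hT' hxT'
    refine localHalf_of_mem_frontier (isOpen_of_isPolytopal (hpoly T' hT'))
      (hpoly T' hT').interior_closure (hGfin T' hT') (hGcov T' hT') hxT' hgl ?_
    intro g' hg' hg'x
    exact hgen.2 g' (hGsub T' hT' g' hg') g hgG s hg'x hgx
  have hFT := M.face_subset_frontier hΩ hT hF hxF' hs hgl hgx hloc
  have hFm : F ∈ M.facesOf T := M.mem_facesOf.2 ⟨hF, hFT⟩
  refine ⟨F, hFm, hFj, hxF', ?_⟩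
  -- By orientation, `T` contains the points `x - t ω n` for small `t > 0`. There `ω g = -t`, which
  -- is the side that `T` would avoid. This settles which of the two half spaces is the right one.
  have hno : ¬ LocalHalf T g (M.orient T F) (ins j y s) := by
    intro hcon
    have h1 := hy2 F hFm hFj (by rwa [← hsg])
    rw [← hsg] at h1
    have h2 : Tendsto (fun t : ℝ => ins j y s - t • M.orient T F • M.normal F) (𝓝[>] 0)
        (𝓝 (ins j y s)) := by
      have : Continuous fun t : ℝ => ins j y s - t • M.orient T F • M.normal F := by fun_prop
      have h3 := this.tendsto 0
      rw [zero_smul, sub_zero] at h3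
      exact h3.mono_left nhdsWithin_le_nhds
    obtain ⟨t, ht1, ht2, ht⟩ := (h1.and ((h2.eventually hcon).and self_mem_nhdsWithin)).exists
    have ht : 0 < t := ht
    refine ht2.2 ?_ (subset_closure ht1)
    have h4 : g (ins j y s - t • M.orient T F • M.normal F) = -(t * M.orient T F) := by
      have := affine_add_smul g (ins j y s) (M.normal F) (-(t * M.orient T F))
      rw [hgx, planeMap_linear, real_inner_self_eq_norm_sq, M.norm_normal F hF] at this
      rw [smul_smul, sub_eq_add_neg, ← neg_smul, this]
      ring
    rw [h4]
    rcases M.orient_sign T hT F hF hFT with h | h <;> rw [h] <;> linarith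
  rcases M.orient_sign T hT F hF hFT with h | h
  · rw [h] at hno ⊢
    exact (hloc T (Or.inl hT) hs).resolve_left hno
  · rw [h] at hno ⊢
    rw [neg_neg]
    exact (hloc T (Or.inl hT) hs).resolve_right hno

end Lines

end Divergence

section Divergence

variable {n : ℕ} (j : Fin (n + 1)) {Ω : Set (E (n + 1))} (M : PolytopalMesh Ω)
  {T : Set (E (n + 1))}

/-- The fundamental theorem of calculus along almost every line. -/
theorem PolytopalMesh.ae_integral_line (hΩ : IsPolytopal Ω) (hT : T ∈ M.elements)
    {c : Set (E (n + 1)) → ℝ} (hc : ∀ F ∈ M.faces,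
      MeasurableSet F ∧ F ⊆ {x | ⟪M.normal F, x⟫_ℝ = c F})
    (p : MvPolynomial (Fin (n + 1)) ℝ) :
    ∀ᵐ y : E n, ∫ s, T.indicator (ev (MvPolynomial.pderiv j p)) (ins j y s) =
      ∑ F ∈ M.facesOf T with M.normal F j ≠ 0, M.orient T F * SignType.sign (M.normal F j) *
        F.indicator (ev p) (ins j y (graphPt j (M.normal F) (c F) y)) := by
  classical
  filter_upwards [M.ae_line j hΩ hT hc] with y hy
  let z : Set (E (n + 1)) → ℝ := fun F => graphPt j (M.normal F) (c F) y
  -- At a crossing, this is `1` if the line leaves `T` through `F` as `s` increases and `-1` if it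
  -- enters.
  let w : Set (E (n + 1)) → ℝ := fun F => M.orient T F * SignType.sign (M.normal F j)
  let I := {F ∈ M.facesOf T | M.normal F j ≠ 0 ∧ ins j y (z F) ∈ F}
  have hmemI : ∀ F, F ∈ I ↔ F ∈ M.facesOf T ∧ M.normal F j ≠ 0 ∧ ins j y (z F) ∈ F :=
    fun F => Finset.mem_filter
  have hTo := M.isOpen_element hT
  have huniq : ∀ F ∈ M.facesOf T, ∀ F' ∈ M.facesOf T, ∀ x, x ∈ F → x ∈ F' → F = F' := by
    intro F hF F' hF' x hx hx'
    by_contra hne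
    exact Set.disjoint_left.1 (M.face_disjoint F (M.mem_facesOf.1 hF).1 F' (M.mem_facesOf.1 hF').1
      hne) hx hx'
  have hinj : Set.InjOn z I := by
    intro F hF F' hF' h
    obtain ⟨h1, _, h3⟩ := (hmemI F).1 hF
    obtain ⟨h1', _, h3'⟩ := (hmemI F').1 hF'
    rw [h] at h3
    exact huniq F h1 F' h1' _ h3 h3'
  have hzs : ∀ F ∈ M.facesOf T, M.normal F j ≠ 0 → ∀ s, ins j y s ∈ F → s = z F :=
    fun F hF hFj s hs => (inner_ins_eq_iff j hFj y s).1 ((hc F (M.mem_facesOf.1 hF).1).2 hs)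
  have hcont := continuous_ins_right j y
  let A : Set ℝ := ins j y ⁻¹' T
  have hA : Bornology.IsBounded A := by
    obtain ⟨R, hR⟩ := (isBounded_of_isPolytopal (M.partition.polytopal T hT)).exists_norm_le
    refine isBounded_iff_forall_norm_le.2 ⟨R, fun s hs => ?_⟩
    exact (abs_le_norm_ins j y s).trans (hR _ hs)
  have hloc : ∀ s, (∀ F ∈ I, z F ≠ s) → (∀ᶠ t in 𝓝 s, t ∈ A) ∨ ∀ᶠ t in 𝓝 s, t ∉ A := by
    intro s hs
    by_cases h1 : ins j y s ∈ T
    · exact Or.inl (hcont.continuousAt.preimage_mem_nhds (hTo.mem_nhds h1))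
    by_cases h2 : ins j y s ∈ closure T
    · exfalso
      obtain ⟨F, hF, hFj, hxF, -⟩ := hy s (by rw [hTo.frontier_eq]; exact ⟨h2, h1⟩)
      have h3 := hzs F hF hFj s hxF
      exact hs F ((hmemI F).2 ⟨hF, hFj, by rwa [← h3]⟩) h3.symm
    · right
      have h3 : ∀ᶠ t in 𝓝 s, ins j y t ∈ (closure T)ᶜ :=
        hcont.continuousAt.preimage_mem_nhds (isClosed_closure.isOpen_compl.mem_nhds h2)
      exact h3.mono fun t ht ht' => ht (subset_closure ht')
  have hjump : ∀ F ∈ I,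
      (w F = 1 ∧ (∀ᶠ t in 𝓝[<] z F, t ∈ A) ∧ ∀ᶠ t in 𝓝[>] z F, t ∉ A) ∨
      (w F = -1 ∧ (∀ᶠ t in 𝓝[<] z F, t ∉ A) ∧ ∀ᶠ t in 𝓝[>] z F, t ∈ A) := by
    intro F hFI
    obtain ⟨hF, hFj, hxF⟩ := (hmemI F).1 hFI
    obtain ⟨hFM, hFT⟩ := M.mem_facesOf.1 hF
    obtain ⟨F', hF', _, hxF', hhalf⟩ := hy (z F) (hFT hxF)
    obtain rfl := huniq F hF F' hF' _ hxF hxF'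
    have hg : ∀ t, planeMap (M.normal F) (c F) (ins j y t) = (t - z F) * M.normal F j := by
      intro t
      have h1 := affine_add_smul (planeMap (M.normal F) (c F)) (ins j y (z F))
        (EuclideanSpace.single j 1) (t - z F)
      have h2 : planeMap (M.normal F) (c F) (ins j y (z F)) = 0 := by
        rw [planeMap_apply, sub_eq_zero]
        exact (hc F hFM).2 hxF
      rw [← ins_add_single, h2, planeMap_linear_single, zero_add, add_sub_cancel] at h1
      exact h1
    have hev : ∀ᶠ t in 𝓝 (z F), (0 < -M.orient T F * ((t - z F) * M.normal F j) → t ∈ A) ∧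
        (-M.orient T F * ((t - z F) * M.normal F j) < 0 → t ∉ A) := by
      filter_upwards [hcont.continuousAt.eventually hhalf] with t ht
      rw [hg] at ht
      exact ⟨ht.1, fun h h' => ht.2 h (subset_closure h')⟩
    have hwsgn : (w F = 1 ∧ 0 < M.orient T F * M.normal F j) ∨
        (w F = -1 ∧ M.orient T F * M.normal F j < 0) := by
      simp only [w]
      rcases M.orient_sign T hT F hFM hFT with h | h <;> rcases hFj.lt_or_gt with h' | h' <;>
        simp [h, h']
    rcases hwsgn with ⟨h1, h2⟩ | ⟨h1, h2⟩
    · refine Or.inl ⟨h1, ?_, ?_⟩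
      · filter_upwards [nhdsWithin_le_nhds hev, self_mem_nhdsWithin] with t ht ht'
        have : 0 < (z F - t) * (M.orient T F * M.normal F j) :=
          mul_pos (sub_pos.2 ht') h2
        exact ht.1 (by linarith)
      · filter_upwards [nhdsWithin_le_nhds hev, self_mem_nhdsWithin] with t ht ht'
        have : 0 < (t - z F) * (M.orient T F * M.normal F j) :=
          mul_pos (sub_pos.2 ht') h2
        exact ht.2 (by linarith)
    · refine Or.inr ⟨h1, ?_, ?_⟩
      · filter_upwards [nhdsWithin_le_nhds hev, self_mem_nhdsWithin] with t ht ht'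
        have : (z F - t) * (M.orient T F * M.normal F j) < 0 :=
          mul_neg_of_pos_of_neg (sub_pos.2 ht') h2
        exact ht.2 (by linarith)
      · filter_upwards [nhdsWithin_le_nhds hev, self_mem_nhdsWithin] with t ht ht'
        have : (t - z F) * (M.orient T F * M.normal F j) < 0 :=
          mul_neg_of_pos_of_neg (sub_pos.2 ht') h2
        exact ht.1 (by linarith)
  have hftc := integral_deriv_eq_sum_jumps I z w hinj A hA hloc hjump
    (hasDerivAt_ev_ins j p y) ((ev_continuous _).comp hcont)
  calc ∫ s, T.indicator (ev (MvPolynomial.pderiv j p)) (ins j y s)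
      = ∫ s, A.indicator (fun s => ev (MvPolynomial.pderiv j p) (ins j y s)) s := rfl
    _ = ∑ F ∈ I, w F * ev p (ins j y (z F)) := hftc
    _ = _ := by
      have hI : I = {F ∈ {F ∈ M.facesOf T | M.normal F j ≠ 0} | ins j y (z F) ∈ F} := by
        rw [Finset.filter_filter]
      rw [hI, Finset.sum_filter]
      refine Finset.sum_congr rfl fun F _ => ?_
      by_cases h : ins j y (z F) ∈ F
      · rw [if_pos h, Set.indicator_of_mem h]
      · rw [if_neg h, Set.indicator_of_notMem h, mul_zero]

/-- The divergence theorem on a mesh element, for polynomials. -/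
theorem PolytopalMesh.integral_pderiv (hΩ : IsPolytopal Ω) (hT : T ∈ M.elements)
    (p : MvPolynomial (Fin (n + 1)) ℝ) :
    ∫ x, ev (MvPolynomial.pderiv j p) x ∂onElement T =
      ∑ F : M.facesOf T, M.orient T F * M.normal F j * ∫ x, ev p x ∂onFace F.1 := by
  classical
  obtain ⟨c, hc⟩ := M.exists_planes
  have hTm := (M.isOpen_element hT).measurableSet
  have hint : Integrable (T.indicator (ev (MvPolynomial.pderiv j p))) :=
    (integrable_indicator_iff hTm).2 ((M.nice_element hT).integrable (ev_continuous _))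
  rw [onElement, ← integral_indicator hTm, integral_eq_integral_integral_ins j hint,
    integral_congr_ae (M.ae_integral_line j hΩ hT hc p), integral_finsetSum,
    Finset.sum_coe_sort (M.facesOf T)
      (fun F => M.orient T F * M.normal F j * ∫ x, ev p x ∂onFace F), Finset.sum_filter]
  · refine Finset.sum_congr rfl fun F hF => ?_
    have hFM := (M.mem_facesOf.1 hF).1
    by_cases h : M.normal F j = 0
    · simp [h]
    -- The parametrisation of `F` over the coordinate hyperplane contributes `|ν_j|`, which combines
    -- with the sign of the crossing to give `ν_j`. Faces with `ν_j = 0` are invisible to the lines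
    -- and contribute nothing on either side.
    · rw [if_pos h, integral_const_mul,
        integral_graph j h (M.norm_normal F hFM) (hc F hFM).1 (hc F hFM).2, ← mul_assoc,
        mul_assoc (M.orient T F), sign_mul_abs]
  · intro F hF
    obtain ⟨hF, h⟩ := Finset.mem_filter.1 hF
    have hFM := (M.mem_facesOf.1 hF).1
    refine Integrable.const_mul ?_ _
    have h1 : Integrable (F.indicator (ev p))
        (Measure.map (fun y => ins j y (graphPt j (M.normal F) (c F) y)) volume) := by
      rw [map_graph_eq j h (M.norm_normal F hFM)]
      refine Integrable.smul_measure ?_ ENNReal.ofReal_ne_top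
      rw [integrable_indicator_iff (hc F hFM).1, IntegrableOn,
        Measure.restrict_restrict (hc F hFM).1, Set.inter_eq_left.2 (hc F hFM).2]
      exact (M.nice_face hT ⟨F, hF⟩).integrable (ev_continuous p)
    exact (measurableEmbedding_graph j).integrable_map_iff.1 h1

end Divergence

/-! ### Geometry of the elements of a regular mesh -/

section Geometry

theorem nonempty_openSimplex {d : ℕ} (s : Affine.Simplex ℝ (E d) d) : (openSimplex s).Nonempty :=
  ⟨_, (simplexBasis s).centroid_mem_interior_convexHull⟩

theorem closure_openSimplex {d : ℕ} (s : Affine.Simplex ℝ (E d) d) :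
    closure (openSimplex s) = closedSimplex s := by
  rw [openSimplex, closedSimplex, (convex_convexHull ℝ _).closure_interior_eq_closure_of_nonempty_interior
    (nonempty_openSimplex s)]
  exact (isClosed_closedSimplex s).closure_eq

variable {n : ℕ}

/-- The surface measure of a bounded piece of a hyperplane. -/
theorem surface_hyperplane_inter_closedBall_le {g : E (n + 1) →ᵃ[ℝ] ℝ} (hg : g.linear ≠ 0)
    (c : E (n + 1)) {h : ℝ} (hh : 0 ≤ h) :
    surface (n + 1) ({x | g x = 0} ∩ Metric.closedBall c h) ≤
      ENNReal.ofReal ((2 * h) ^ n) * volume (Metric.ball (0 : E n) 1) := by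
  rcases ({x | g x = 0} ∩ Metric.closedBall c h).eq_empty_or_nonempty with he | ⟨x₀, hx₀⟩
  · simp [he]
  let W : Submodule ℝ (E (n + 1)) := LinearMap.ker g.linear
  have hW : Module.finrank ℝ W = n := by
    have h1 := Module.Dual.finrank_ker_add_one_of_ne_zero hg
    rw [finrank_euclideanSpace_fin] at h1
    exact Nat.succ_injective h1
  let b : OrthonormalBasis (Fin n) ℝ W := (stdOrthonormalBasis ℝ W).reindex (finCongr hW)
  let φ : E n → E (n + 1) := fun y => x₀ + (b.repr.symm y : W)
  have hφ : Isometry φ :=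
    (IsometryEquiv.addLeft x₀).isometry.comp (isometry_subtype_coe.comp b.repr.symm.isometry)
  let A := {x | g x = 0} ∩ Metric.closedBall c h
  have himg : φ '' (φ ⁻¹' A) = A := by
    rw [Set.image_preimage_eq_iff]
    intro x hx
    have hmem : x - x₀ ∈ W := by
      have h1 := g.linearMap_vsub x x₀
      rw [vsub_eq_sub, vsub_eq_sub, hx.1, hx₀.1, sub_zero] at h1
      exact h1
    exact ⟨b.repr ⟨x - x₀, hmem⟩, by simp [φ]⟩
  -- The parametrisation is centred at a point `x₀` of the section instead of `c`, which doubles the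
  -- radius.
  have hsub : φ ⁻¹' A ⊆ Metric.closedBall 0 (2 * h) := by
    intro y hy
    have h1 : dist (φ y) x₀ ≤ h + h :=
      (dist_triangle_right _ _ c).trans (add_le_add hy.2 hx₀.2)
    have h2 : φ 0 = x₀ := by simp [φ]
    rw [Metric.mem_closedBall, ← hφ.dist_eq, h2]
    linarith
  calc surface (n + 1) A = surface (n + 1) (φ '' (φ ⁻¹' A)) := by rw [himg]
    _ = volume (φ ⁻¹' A) := by
      rw [surface_eq, hφ.euclideanHausdorffMeasure_image,
        EuclideanSpace.euclideanHausdorffMeasure_eq_volume]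
    _ ≤ volume (Metric.closedBall (0 : E n) (2 * h)) := measure_mono hsub
    _ = _ := by
      rw [Measure.addHaar_closedBall _ _ (by positivity), finrank_euclideanSpace_fin]

variable {Ω : Set (E (n + 1))} (M : PolytopalMesh Ω) {T : Set (E (n + 1))} {ρ : ℝ}

theorem PolytopalMesh.diam_pos (hT : T ∈ M.elements) : 0 < Metric.diam T := by
  obtain ⟨x, hx⟩ := M.partition.nonempty T hT
  obtain ⟨ε, hε, hball⟩ := Metric.isOpen_iff.1 (M.isOpen_element hT) x hx
  have h1 : x + EuclideanSpace.single 0 (ε / 2) ∈ T := hball (by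
    simp [abs_of_pos hε, hε])
  have h2 := Metric.dist_le_diam_of_mem
    (isBounded_of_isPolytopal (M.partition.polytopal T hT)) h1 hx
  have h3 : dist (x + EuclideanSpace.single 0 (ε / 2)) x = ε / 2 := by
    simp [abs_of_pos hε]
  linarith

/-- The constant in the bound on the boundary measure of an element. -/
def boundaryConst (n : ℕ) (ρ : ℝ) : ℝ :=
  ((ρ ^ 2) ^ (n + 1))⁻¹ * (n + 2) * (2 ^ n * volume.real (Metric.ball (0 : E n) 1))

open Classical in
/-- The simplices of the submesh contained in an element cover it. -/
theorem PolytopalMesh.closure_subset_simplices {S : Finset (Affine.Simplex ℝ (E (n + 1)) (n + 1))}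
    (hS : M.IsMatchingSimplicialSubmesh S) (hT : T ∈ M.elements) :
    closure T ⊆ ⋃ s ∈ {s ∈ S | openSimplex s ⊆ T}, closedSimplex s := by
  have hc : IsClosed (⋃ s ∈ {s ∈ S | openSimplex s ⊆ T}, closedSimplex s) :=
    isClosed_biUnion_finset fun s _ => isClosed_closedSimplex s
  refine closure_minimal (fun x hx => ?_) hc
  by_contra hcon
  have hV : IsOpen (T ∩ (⋃ s ∈ {s ∈ S | openSimplex s ⊆ T}, closedSimplex s)ᶜ) :=
    (M.isOpen_element hT).inter hc.isOpen_compl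
  have h1 : x ∈ ⋃ s ∈ S, closedSimplex s := by
    rw [← hS.cover, M.partition.cover]
    exact Set.mem_biUnion (t := fun T => closure T) hT (subset_closure hx)
  simp only [Set.mem_iUnion] at h1
  obtain ⟨s, hs, hxs⟩ := h1
  -- The open set `T` minus the union contains a point in the closure of the open simplex, so this
  -- simplex meets `T`. The unique element containing it is therefore `T`, and the simplex already
  -- belongs to the union.
  rw [← closure_openSimplex] at hxs
  obtain ⟨z, ⟨hzT, -⟩, hzs⟩ := mem_closure_iff.1 hxs _ hV ⟨hx, hcon⟩
  obtain ⟨T', ⟨hT', hsT'⟩, -⟩ := hS.subordinate s hs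
  obtain rfl := M.eq_of_inter_nonempty hT hT' ⟨z, hzT, hsT' hzs⟩
  apply hcon
  rw [closure_openSimplex] at hxs
  exact Set.mem_biUnion (t := fun s => closedSimplex s) (Finset.mem_filter.2 ⟨hs, hsT'⟩) hxs

/-- The geometric bounds on an element of a regular mesh. -/
theorem PolytopalMesh.IsRegular.geometry {M : PolytopalMesh Ω} (hρ : 0 < ρ) (hM : M.IsRegular ρ)
    (hT : T ∈ M.elements) :
    (∃ c, Metric.ball c (ρ ^ 2 * Metric.diam T) ⊆ T ∧ T ⊆ Metric.closedBall c (Metric.diam T)) ∧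
    ∑ F : M.facesOf T, (surface (n + 1)).real F.1 ≤
      boundaryConst n ρ * Metric.diam T ^ n := by
  classical
  obtain ⟨S, hS, hin, hdiam⟩ := hM
  set h := Metric.diam T with hh
  have hpos : 0 < h := M.diam_pos hT
  have hTb := isBounded_of_isPolytopal (M.partition.polytopal T hT)
  let S' := {s ∈ S | openSimplex s ⊆ T}
  have hcov := M.closure_subset_simplices hS hT
  -- The inradius is at least `ρ h_s`, and `h_s` is at least `ρ h_T`; hence the factor `ρ²`.
  have hball : ∀ s ∈ S', ∃ c, Metric.ball c (ρ ^ 2 * h) ⊆ openSimplex s := by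
    intro s hs
    obtain ⟨hsS, hsT⟩ := Finset.mem_filter.1 hs
    obtain ⟨c, hc⟩ := hin s hsS
    refine ⟨c, (Metric.ball_subset_ball ?_).trans hc⟩
    have := mul_le_mul_of_nonneg_left (hdiam T hT s hsS hsT) hρ.le
    rw [← mul_assoc, ← sq] at this
    exact this
  choose! ctr hctr using hball
  have hr : 0 < ρ ^ 2 * h := by positivity
  have hTin : ∀ c ∈ T, T ⊆ Metric.closedBall c h := fun c hc x hx =>
    Metric.dist_le_diam_of_mem hTb hx hc
  obtain ⟨s₀, hs₀⟩ : S'.Nonempty := by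
    obtain ⟨x, hx⟩ := M.partition.nonempty T hT
    have := hcov (subset_closure hx)
    simp only [Set.mem_iUnion] at this
    obtain ⟨s, hs, -⟩ := this
    exact ⟨s, hs⟩
  have hb₀ : Metric.ball (ctr s₀) (ρ ^ 2 * h) ⊆ T :=
    (hctr s₀ hs₀).trans (Finset.mem_filter.1 hs₀).2
  have hc₀ := hTin _ (hb₀ (Metric.mem_ball_self hr))
  refine ⟨⟨ctr s₀, hb₀, hc₀⟩, ?_⟩
  -- the number of simplices
  have hcard : (S'.card : ℝ) ≤ ((ρ ^ 2) ^ (n + 1))⁻¹ := by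
    -- Comparison of volumes: the disjoint simplices contain disjoint balls of radius `ρ² h`, all
    -- inside a ball of radius `h`.
    have h1 : volume (⋃ s ∈ S', Metric.ball (ctr s) (ρ ^ 2 * h)) =
        ∑ s ∈ S', volume (Metric.ball (ctr s) (ρ ^ 2 * h)) := by
      refine measure_biUnion_finset (fun s hs s' hs' hne => ?_) fun _ _ => measurableSet_ball
      exact (hS.disjoint s (Finset.mem_filter.1 hs).1 s' (Finset.mem_filter.1 hs').1 hne).mono
        (hctr s hs) (hctr s' hs')
    have h2 : (⋃ s ∈ S', Metric.ball (ctr s) (ρ ^ 2 * h)) ⊆ Metric.closedBall (ctr s₀) h :=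
      Set.iUnion₂_subset fun s hs => ((hctr s hs).trans (Finset.mem_filter.1 hs).2).trans hc₀
    have h3 := measure_mono (μ := volume) h2
    have hV := (measure_ball_lt_top (μ := (volume : Measure (E (n + 1)))) (x := 0) (r := 1)).ne
    have hV0 := (Metric.measure_ball_pos (volume : Measure (E (n + 1))) 0 one_pos).ne'
    simp only [h1, Measure.addHaar_ball _ _ hr.le, Measure.addHaar_closedBall _ _ hpos.le,
      finrank_euclideanSpace_fin, Finset.sum_const, nsmul_eq_mul, ← mul_assoc] at h3
    rw [ENNReal.mul_le_mul_iff_left hV0 hV, ← ENNReal.ofReal_natCast,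
      ← ENNReal.ofReal_mul (by positivity), ENNReal.ofReal_le_ofReal_iff (by positivity),
      mul_pow, ← mul_assoc] at h3
    rw [← one_div, le_div_iff₀ (by positivity)]
    exact le_of_mul_le_mul_right (by rwa [one_mul]) (pow_pos hpos (n + 1))
  -- The total area is bounded without counting faces: they all lie on the `n + 2` facet hyperplanes
  -- of each of the boundedly many simplices.
  have hsub : (⋃ F ∈ M.facesOf T, F) ⊆ ⋃ s ∈ S', ⋃ i ∈ (Finset.univ : Finset (Fin (n + 2))),
      {x | (simplexBasis s).coord i x = 0} ∩ Metric.closedBall (ctr s₀) h := by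
    intro x hx
    simp only [Set.mem_iUnion] at hx
    obtain ⟨F, hF, hxF⟩ := hx
    have hxT := (M.mem_facesOf.1 hF).2 hxF
    have hx1 := hcov (frontier_subset_closure hxT)
    simp only [Set.mem_iUnion] at hx1
    obtain ⟨s, hs, hxs⟩ := hx1
    have hx2 : x ∉ openSimplex s := fun hcon => by
      rw [(M.isOpen_element hT).frontier_eq] at hxT
      exact hxT.2 ((Finset.mem_filter.1 hs).2 hcon)
    obtain ⟨i, hi⟩ := exists_coord_eq_zero hxs hx2
    simp only [Set.mem_iUnion]
    exact ⟨s, hs, i, Finset.mem_univ i, hi,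
      closure_minimal hc₀ Metric.isClosed_closedBall (frontier_subset_closure hxT)⟩
  obtain ⟨cc, hcc⟩ := M.exists_planes
  have hsum : ∑ F ∈ M.facesOf T, surface (n + 1) F = surface (n + 1) (⋃ F ∈ M.facesOf T, F) := by
    rw [measure_biUnion_finset]
    · intro F hF F' hF' hne
      exact M.face_disjoint F (M.mem_facesOf.1 hF).1 F' (M.mem_facesOf.1 hF').1 hne
    · exact fun F hF => (hcc F (M.mem_facesOf.1 hF).1).1
  have hbound : ∑ F ∈ M.facesOf T, surface (n + 1) F ≤
      S'.card * ((n + 2 : ℕ) * (ENNReal.ofReal ((2 * h) ^ n) *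
        volume (Metric.ball (0 : E n) 1))) := by
    rw [hsum]
    refine (measure_mono hsub).trans ((measure_biUnion_finset_le _ _).trans ?_)
    rw [← nsmul_eq_mul]
    refine Finset.sum_le_card_nsmul _ _ _ fun s _ => (measure_biUnion_finset_le _ _).trans ?_
    rw [← nsmul_eq_mul]
    refine (Finset.sum_le_card_nsmul _ _ _ fun i _ =>
      surface_hyperplane_inter_closedBall_le (coord_linear_ne_zero s i) _ hpos.le).trans ?_
    simp
  have hfin : (S'.card * ((n + 2 : ℕ) * (ENNReal.ofReal ((2 * h) ^ n) *
        volume (Metric.ball (0 : E n) 1))) : ENNReal) ≠ ⊤ := by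
    have := (measure_ball_lt_top (μ := (volume : Measure (E n))) (x := 0) (r := 1)).ne
    finiteness
  have hreal := ENNReal.toReal_mono hfin hbound
  rw [ENNReal.toReal_sum] at hreal
  swap
  · intro F hF
    exact ne_top_of_le_ne_top hfin ((Finset.single_le_sum (f := fun F => surface (n + 1) F)
      (fun _ _ => zero_le) hF).trans hbound)
  rw [Finset.sum_coe_sort (M.facesOf T) fun F => (surface (n + 1)).real F]
  refine hreal.trans ?_
  rw [ENNReal.toReal_mul, ENNReal.toReal_mul, ENNReal.toReal_mul, ENNReal.toReal_natCast,
    ENNReal.toReal_natCast, ENNReal.toReal_ofReal (by positivity), boundaryConst, mul_pow]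
  push_cast
  calc (S'.card : ℝ) * ((n + 2) * (2 ^ n * h ^ n * (volume (Metric.ball (0 : E n) 1)).toReal))
      ≤ ((ρ ^ 2) ^ (n + 1))⁻¹ *
        ((n + 2) * (2 ^ n * h ^ n * (volume (Metric.ball (0 : E n) 1)).toReal)) :=
        mul_le_mul_of_nonneg_right hcard (by positivity)
    _ = _ := by rw [Measure.real]; ring

end Geometry

/-! ### Inequalities for polynomials -/

section Reference

/-- A linear map on a finite-dimensional space is bounded with respect to any inner product. -/
theorem exists_norm_sq_le {V W : Type*} [AddCommGroup V] [Module ℝ V] [FiniteDimensional ℝ V]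
    [NormedAddCommGroup W] [NormedSpace ℝ W] (B : V →ₗ[ℝ] V →ₗ[ℝ] ℝ)
    (hsymm : ∀ v w, B v w = B w v) (hnonneg : ∀ v, 0 ≤ B v v) (hdef : ∀ v, B v v = 0 → v = 0)
    (f : V →ₗ[ℝ] W) : ∃ C : ℝ, 0 ≤ C ∧ ∀ v, ‖f v‖ ^ 2 ≤ C * B v v := by
  let core : InnerProductSpace.Core ℝ V :=
    { inner := fun v w => B v w
      conj_inner_symm := fun v w => hsymm w v
      re_inner_nonneg := fun v => hnonneg v
      add_left := fun v w z => by simp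
      smul_left := fun v w c => by simp
      definite := hdef }
  let _ : NormedAddCommGroup V := core.toNormedAddCommGroup
  let _ : InnerProductSpace ℝ V := InnerProductSpace.ofCore core.toCore
  let L : V →L[ℝ] W := f.toContinuousLinearMap
  refine ⟨‖L‖ ^ 2, sq_nonneg _, fun v => ?_⟩
  have h1 : ‖f v‖ ≤ ‖L‖ * ‖v‖ := L.le_opNorm v
  have h2 : ‖v‖ ^ 2 = B v v := (real_inner_self_eq_norm_sq v).symm
  rw [← h2, ← mul_pow]
  exact pow_le_pow_left₀ (norm_nonneg _) h1 2

variable {d : ℕ}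

theorem pderiv_mem_restrictTotalDegree {m : ℕ} {p : MvPolynomial (Fin d) ℝ}
    (hp : p ∈ MvPolynomial.restrictTotalDegree (Fin d) ℝ m) (j : Fin d) :
    MvPolynomial.pderiv j p ∈ MvPolynomial.restrictTotalDegree (Fin d) ℝ m := by
  rw [MvPolynomial.mem_restrictTotalDegree] at hp ⊢
  rw [p.as_sum, map_sum]
  refine MvPolynomial.totalDegree_finsetSum_le fun s hs => ?_
  rw [MvPolynomial.pderiv_monomial]
  refine (MvPolynomial.totalDegree_monomial_le _ _).trans ((?_ : _ ≤ _).trans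
    ((MvPolynomial.le_totalDegree hs).trans hp))
  change (s - Finsupp.single j 1).degree ≤ s.degree
  exact Finsupp.degree_mono tsub_le_self

/-- The polynomial `y ↦ p (c + h y)`. -/
def rescale (c : E d) (h : ℝ) (p : MvPolynomial (Fin d) ℝ) : MvPolynomial (Fin d) ℝ :=
  MvPolynomial.bind₁ (fun i => MvPolynomial.C (c i) + MvPolynomial.C h * MvPolynomial.X i) p

theorem ev_rescale (c : E d) (h : ℝ) (p : MvPolynomial (Fin d) ℝ) (y : E d) :
    ev (rescale c h p) y = ev p (c + h • y) := by
  simp only [ev, rescale]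
  induction p using MvPolynomial.induction_on with
  | C a => simp
  | add p q hp hq => rw [map_add, map_add, map_add, hp, hq]
  | mul_X p i hp => rw [map_mul, map_mul, map_mul, hp]; simp

/-- The chain rule, read off by differentiating `ev_rescale` along the `j`-th axis in two ways. -/
theorem ev_pderiv_rescale (c : E d) (h : ℝ) (p : MvPolynomial (Fin d) ℝ) (y : E d) (j : Fin d) :
    ev (MvPolynomial.pderiv j (rescale c h p)) y =
      h * ev (MvPolynomial.pderiv j p) (c + h • y) := by
  have hline : HasDerivAt (fun t : ℝ => y + t • EuclideanSpace.single j (1 : ℝ))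
      (EuclideanSpace.single j 1) 0 := by
    simpa using ((hasDerivAt_id (0 : ℝ)).smul_const (EuclideanSpace.single j (1 : ℝ))).const_add y
  have hev : ∀ (q : MvPolynomial (Fin d) ℝ) (z : E d) (l : ℝ),
      HasDerivAt (fun t : ℝ => ev q (z + l • (y + t • EuclideanSpace.single j (1 : ℝ))))
        (l * ev (MvPolynomial.pderiv j q) (z + l • y)) 0 := by
    intro q z l
    have h1 := (hline.const_smul l).const_add z
    have h2 := (hasFDerivAt_ev q (z + l • (y + (0 : ℝ) • EuclideanSpace.single j (1 : ℝ)))).comp_hasDerivAt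
      (0 : ℝ) h1
    refine h2.congr_deriv ?_
    simp [PiLp.single_apply, mul_comm]
  have h1 := hev p c h
  have h2 := hev (rescale c h p) 0 1
  simp only [zero_add, one_smul, one_mul, ev_rescale] at h2
  exact h2.unique h1

theorem rescale_mem {m : ℕ} {p : MvPolynomial (Fin d) ℝ}
    (hp : p ∈ MvPolynomial.restrictTotalDegree (Fin d) ℝ m) (c : E d) (h : ℝ) :
    rescale c h p ∈ MvPolynomial.restrictTotalDegree (Fin d) ℝ m := by
  rw [MvPolynomial.mem_restrictTotalDegree] at hp ⊢
  rw [p.as_sum, rescale, map_sum]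
  refine MvPolynomial.totalDegree_finsetSum_le fun s hs => ?_
  rw [MvPolynomial.bind₁_monomial]
  refine (MvPolynomial.totalDegree_mul _ _).trans ?_
  rw [MvPolynomial.totalDegree_C, zero_add]
  refine (MvPolynomial.totalDegree_finsetProd _ _).trans (le_trans ?_
    ((MvPolynomial.le_totalDegree hs).trans hp))
  refine Finset.sum_le_sum fun i _ => (MvPolynomial.totalDegree_pow _ _).trans ?_
  have h1 : (MvPolynomial.C (c i) + MvPolynomial.C h * MvPolynomial.X i :
      MvPolynomial (Fin d) ℝ).totalDegree ≤ 1 := by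
    refine (MvPolynomial.totalDegree_add _ _).trans (max_le (by simp) ?_)
    refine (MvPolynomial.totalDegree_mul _ _).trans ?_
    simp
  calc s i * _ ≤ s i * 1 := Nat.mul_le_mul_left _ h1
    _ = s i := mul_one _

theorem nice_ball (c : E d) (r : ℝ) : Nice (onElement (Metric.ball c r)) := by
  refine ⟨⟨by simpa [onElement] using measure_ball_lt_top⟩, ‖c‖ + r, ?_⟩
  filter_upwards [ae_restrict_mem measurableSet_ball] with x hx
  exact (norm_le_norm_add_norm_sub' x c).trans
    (by gcongr; exact (mem_ball_iff_norm.1 hx).le)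

/-- On polynomials of bounded degree, the supremum norm on the unit ball of the values and of the
derivatives is controlled by the `L²`-norm on a smaller ball. -/
theorem exists_reference_bound (d m : ℕ) {r : ℝ} (hr : 0 < r) : ∃ C : ℝ, 0 ≤ C ∧
    ∀ p ∈ MvPolynomial.restrictTotalDegree (Fin d) ℝ m, ∀ x ∈ Metric.closedBall (0 : E d) 1,
      ev p x ^ 2 ≤ C * ∫ y in Metric.ball 0 r, ev p y ^ 2 ∧
      ∀ j, ev (MvPolynomial.pderiv j p) x ^ 2 ≤ C * ∫ y in Metric.ball 0 r, ev p y ^ 2 := by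
  let X := polyFields d Unit m
  let K := Metric.closedBall (0 : E d) 1
  have : CompactSpace K := isCompact_iff_compactSpace.1 (isCompact_closedBall _ _)
  let f₀ : X →ₗ[ℝ] C(K, ℝ) :=
    { toFun := fun v => ⟨fun x => ev (v.1 ()) x, (ev_continuous _).comp continuous_subtype_val⟩
      map_add' := fun v w => by ext x; simp
      map_smul' := fun c v => by ext x; simp }
  let f₁ : Fin d → X →ₗ[ℝ] C(K, ℝ) := fun j =>
    { toFun := fun v => ⟨fun x => ev (MvPolynomial.pderiv j (v.1 ())) x,
        (ev_continuous _).comp continuous_subtype_val⟩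
      map_add' := fun v w => by ext x; simp
      map_smul' := fun c v => by ext x; simp }
  -- Values and all first derivatives are collected in one linear map with finite-dimensional
  -- domain, so that a single constant serves for both.
  let f : X →ₗ[ℝ] C(K, ℝ) × (Fin d → C(K, ℝ)) := f₀.prod (LinearMap.pi f₁)
  have hn := nice_ball (0 : E d) r
  have hBself : ∀ v : X, innerLin hn X v v = ∫ y in Metric.ball 0 r, ev (v.1 ()) y ^ 2 := by
    intro v
    change innerL2 _ v.1 v.1 = _
    simp [innerL2, onElement, sq]
  obtain ⟨C, hC, hle⟩ := exists_norm_sq_le (innerLin hn X) (fun v w => innerL2_comm _ _ _)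
    (fun v => by rw [hBself]; exact integral_nonneg fun y => sq_nonneg _)
    (fun v hv => by
      ext1
      funext i
      refine ev_zero_of_isOpen (T := Metric.ball (0 : E d) r) Metric.isOpen_ball
        (Metric.nonempty_ball.2 hr) ?_
      have h1 : Integrable (fun y => ev (v.1 ()) y ^ 2) (onElement (Metric.ball 0 r)) :=
        hn.integrable ((ev_continuous _).pow 2)
      rw [hBself] at hv
      have h2 := (integral_eq_zero_iff_of_nonneg (fun y => sq_nonneg _) h1).1 hv
      filter_upwards [h2] with x hx
      exact pow_eq_zero_iff two_ne_zero |>.1 hx) f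
  refine ⟨C, hC, fun p hp x hx => ?_⟩
  let v : X := ⟨fun _ => p, fun _ _ => hp⟩
  have hv := hle v
  rw [hBself] at hv
  have hsq : ∀ a : ℝ, |a| ≤ ‖f v‖ → a ^ 2 ≤ C * ∫ y in Metric.ball 0 r, ev p y ^ 2 := by
    intro a ha
    refine le_trans ?_ hv
    rw [← sq_abs]
    exact pow_le_pow_left₀ (abs_nonneg _) ha 2
  refine ⟨hsq _ ?_, fun j => hsq _ ?_⟩
  · exact ((f₀ v).norm_coe_le_norm ⟨x, hx⟩).trans (norm_fst_le (f v))
  · exact ((f₁ j v).norm_coe_le_norm ⟨x, hx⟩).trans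
      ((norm_le_pi_norm (fun j => f₁ j v) j).trans (norm_snd_le (f v)))

theorem setIntegral_ball_rescale (p : E d → ℝ) (c : E d) {h : ℝ} (hh : 0 < h) (r : ℝ) :
    ∫ y in Metric.ball 0 r, p (c + h • y) = (h ^ d)⁻¹ * ∫ x in Metric.ball c (r * h), p x := by
  rw [Measure.setIntegral_comp_smul_of_pos volume (fun z => p (c + z)) _ hh,
    finrank_euclideanSpace_fin, smul_eq_mul, smul_ball hh.ne', smul_zero, Real.norm_eq_abs,
    abs_of_pos hh, mul_comm h r, ← integral_indicator measurableSet_ball,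
    ← integral_indicator measurableSet_ball,
    ← integral_add_left_eq_self (fun x => (Metric.ball c (r * h)).indicator p x) c]
  congr 2
  ext z
  simp [Set.indicator]

end Reference

/-! ### Discrete functional inequalities on an element -/

section Chunky

/-- A set of size `h` around `c` which contains the ball of radius `r h`. -/
structure Chunky {d : ℕ} (T : Set (E d)) (r h : ℝ) (c : E d) : Prop where
  pos : 0 < h
  isOpen : IsOpen T
  ball_subset : Metric.ball c (r * h) ⊆ T
  subset_closedBall : T ⊆ Metric.closedBall c h

variable {d : ℕ} {T : Set (E d)} {r h : ℝ} {c : E d}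

theorem Chunky.nice (hT : Chunky T r h c) : Nice (onElement T) := by
  refine ⟨⟨?_⟩, ‖c‖ + h, ?_⟩
  · rw [onElement, Measure.restrict_apply_univ]
    exact (measure_mono hT.subset_closedBall).trans_lt measure_closedBall_lt_top
  · filter_upwards [ae_restrict_mem hT.isOpen.measurableSet] with x hx
    exact (norm_le_norm_add_norm_sub' x c).trans
      (by gcongr; exact mem_closedBall_iff_norm.1 (hT.subset_closedBall hx))

/-- The measure of the unit ball. -/
def ballVol (d : ℕ) : ℝ := volume.real (Metric.ball (0 : E d) 1)

theorem ballVol_nonneg (d : ℕ) : 0 ≤ ballVol d := measureReal_nonneg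

theorem Chunky.volume_le (hT : Chunky T r h c) :
    (onElement T).real Set.univ ≤ h ^ d * ballVol d := by
  rw [onElement, Measure.real, Measure.restrict_apply_univ]
  refine (ENNReal.toReal_mono measure_closedBall_lt_top.ne
    (measure_mono hT.subset_closedBall)).trans ?_
  rw [Measure.addHaar_closedBall _ _ hT.pos.le, finrank_euclideanSpace_fin, ENNReal.toReal_mul,
    ENNReal.toReal_ofReal (pow_nonneg hT.pos.le _)]
  rfl

theorem innerL2_self_nonneg {ι : Type} [Fintype ι] (σ : Measure (E d))
    (f : ι → MvPolynomial (Fin d) ℝ) : 0 ≤ innerL2 σ f f :=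
  integral_nonneg fun _ => Finset.sum_nonneg fun _ _ => mul_self_nonneg _

theorem innerL2_self_eq_sum {ι : Type} [Fintype ι] {σ : Measure (E d)} (hσ : Nice σ)
    (f : ι → MvPolynomial (Fin d) ℝ) : innerL2 σ f f = ∑ i, ∫ x, ev (f i) x ^ 2 ∂σ := by
  rw [innerL2, integral_finsetSum]
  · simp only [sq]
  · exact fun i _ => hσ.integrable ((ev_continuous _).mul (ev_continuous _))

theorem innerL2_self_le_of_bound {ι : Type} [Fintype ι] {σ : Measure (E d)} (hσ : Nice σ)
    (f : ι → MvPolynomial (Fin d) ℝ) {K : ℝ} (hK : ∀ᵐ x ∂σ, ∑ i, ev (f i) x ^ 2 ≤ K) :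
    innerL2 σ f f ≤ K * σ.real Set.univ := by
  have := hσ.1
  have h1 : ∫ _, K ∂σ = K * σ.real Set.univ := by
    rw [integral_const, smul_eq_mul, mul_comm]
  rw [← h1]
  refine integral_mono_ae (hσ.integrable (continuous_inner_sum f f)) (integrable_const K) ?_
  filter_upwards [hK] with x hx
  simpa only [← sq] using hx

/-- The supremum of a polynomial and of its derivatives is controlled by its `L²`-norm. -/
theorem Chunky.exists_sup_bound (d m : ℕ) {r : ℝ} (hr : 0 < r) : ∃ C : ℝ, 0 ≤ C ∧
    ∀ (T : Set (E d)) (h : ℝ) (c : E d), Chunky T r h c →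
    ∀ p ∈ MvPolynomial.restrictTotalDegree (Fin d) ℝ m, ∀ x ∈ Metric.closedBall c h,
      ev p x ^ 2 ≤ C * ((h ^ d)⁻¹ * ∫ y, ev p y ^ 2 ∂onElement T) ∧
      ∀ j, h ^ 2 * ev (MvPolynomial.pderiv j p) x ^ 2 ≤
        C * ((h ^ d)⁻¹ * ∫ y, ev p y ^ 2 ∂onElement T) := by
  obtain ⟨C, hC, hle⟩ := exists_reference_bound d m hr
  refine ⟨C, hC, fun T h c hT p hp x hx => ?_⟩
  have hh := hT.pos
  have hxy : c + h • (h⁻¹ • (x - c)) = x := by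
    rw [smul_smul, mul_inv_cancel₀ hh.ne', one_smul, add_sub_cancel]
  have hy : h⁻¹ • (x - c) ∈ Metric.closedBall (0 : E d) 1 := by
    rw [mem_closedBall_zero_iff, norm_smul, norm_inv, Real.norm_eq_abs, abs_of_pos hh,
      inv_mul_le_one₀ hh]
    exact mem_closedBall_iff_norm.1 hx
  obtain ⟨h1, h2⟩ := hle _ (rescale_mem hp c h) _ hy
  -- The reference ball of radius `r` corresponds to the ball of radius `r h`, which is contained in
  -- `T`. The irregular shape of `T` therefore plays no role.
  have hI : C * ∫ y in Metric.ball 0 r, ev (rescale c h p) y ^ 2 ≤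
      C * ((h ^ d)⁻¹ * ∫ y, ev p y ^ 2 ∂onElement T) := by
    refine mul_le_mul_of_nonneg_left ?_ hC
    simp only [ev_rescale]
    rw [setIntegral_ball_rescale (fun x => ev p x ^ 2) c hh r]
    refine mul_le_mul_of_nonneg_left ?_ (inv_nonneg.2 (pow_nonneg hh.le _))
    exact setIntegral_mono_set (hT.nice.integrable ((ev_continuous p).pow 2))
      (Eventually.of_forall fun _ => sq_nonneg _) hT.ball_subset.eventuallyLE
  rw [ev_rescale, hxy] at h1
  refine ⟨h1.trans hI, fun j => ?_⟩
  have h3 := (h2 j).trans hI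
  rwa [ev_pderiv_rescale, hxy, mul_pow] at h3

/-- The supremum of a polynomial field is controlled by its `L²`-norm. -/
theorem Chunky.exists_field_sup_bound (d m : ℕ) {r : ℝ} (hr : 0 < r) : ∃ C : ℝ, 0 ≤ C ∧
    ∀ (T : Set (E d)) (h : ℝ) (c : E d), Chunky T r h c →
    ∀ (ι : Type) [Fintype ι], ∀ f ∈ polyFields d ι m, ∀ x ∈ Metric.closedBall c h,
      ∑ i, ev (f i) x ^ 2 ≤ C * ((h ^ d)⁻¹ * innerL2 (onElement T) f f) := by
  obtain ⟨C, hC, hle⟩ := Chunky.exists_sup_bound d m hr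
  refine ⟨C, hC, fun T h c hT ι _ f hf x hx => ?_⟩
  rw [innerL2_self_eq_sum hT.nice, Finset.mul_sum, Finset.mul_sum]
  exact Finset.sum_le_sum fun i _ => (hle T h c hT (f i) (hf i trivial) x hx).1

/-- The inverse inequality. -/
theorem Chunky.exists_inverse_ineq (d m : ℕ) {r : ℝ} (hr : 0 < r) : ∃ C : ℝ, 0 ≤ C ∧
    ∀ (T : Set (E d)) (h : ℝ) (c : E d), Chunky T r h c → ∀ v ∈ polyFields d (Fin d) m,
      h ^ 2 * innerL2 (onElement T) (gradVec v) (gradVec v) ≤ C * innerL2 (onElement T) v v := by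
  obtain ⟨C, hC, hle⟩ := Chunky.exists_sup_bound d m hr
  refine ⟨d * C * ballVol d, mul_nonneg (by positivity) (ballVol_nonneg d),
    fun T h c hT v hv => ?_⟩
  have hh := hT.pos
  have hh2 : 0 < h ^ 2 := by positivity
  set I := innerL2 (onElement T) v v
  have hI : 0 ≤ I := innerL2_self_nonneg _ _
  have h1 : innerL2 (onElement T) (gradVec v) (gradVec v) ≤
      ((h ^ 2)⁻¹ * (d * (C * ((h ^ d)⁻¹ * I)))) * (onElement T).real Set.univ := by
    refine innerL2_self_le_of_bound hT.nice _ ?_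
    filter_upwards [ae_restrict_mem hT.isOpen.measurableSet] with x hx
    rw [← mul_le_mul_iff_right₀ hh2, mul_inv_cancel_left₀ hh2.ne', Fintype.sum_prod_type,
      Finset.sum_comm]
    have : ∀ j : Fin d, h ^ 2 * ∑ i, ev (gradVec v (i, j)) x ^ 2 ≤ C * ((h ^ d)⁻¹ * I) := by
      intro j
      simp only [I]
      rw [innerL2_self_eq_sum hT.nice]
      simp only [Finset.mul_sum]
      exact Finset.sum_le_sum fun i _ =>
        (hle T h c hT (v i) (hv i trivial) x (hT.subset_closedBall hx)).2 j
    rw [Finset.mul_sum]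
    refine (Finset.sum_le_card_nsmul _ _ _ fun j _ => this j).trans ?_
    simp
  -- The factor `h^d` from the measure of `T` cancels the `h^(-d)` of the supremum bound.
  calc h ^ 2 * innerL2 (onElement T) (gradVec v) (gradVec v)
      ≤ h ^ 2 * (((h ^ 2)⁻¹ * (d * (C * ((h ^ d)⁻¹ * I)))) * (h ^ d * ballVol d)) := by
        refine mul_le_mul_of_nonneg_left (h1.trans ?_) hh2.le
        exact mul_le_mul_of_nonneg_left hT.volume_le (by positivity)
    _ = d * C * ballVol d * I := by field_simp

theorem gradVec_mem {m : ℕ} {v : Fin d → MvPolynomial (Fin d) ℝ} (hv : v ∈ polyFields d (Fin d) m) :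
    gradVec v ∈ polyFields d (Fin d × Fin d) m :=
  fun ij _ => pderiv_mem_restrictTotalDegree (hv ij.1 trivial) ij.2

/-- The mean value inequality for polynomials. -/
theorem ev_sub_sq_le {p : MvPolynomial (Fin d) ℝ} {c x : E d} {h B : ℝ} (hh : 0 ≤ h)
    (hx : x ∈ Metric.closedBall c h)
    (hB : ∀ z ∈ Metric.closedBall c h, ∑ j, ev (MvPolynomial.pderiv j p) z ^ 2 ≤ B) :
    (ev p x - ev p c) ^ 2 ≤ h ^ 2 * B := by
  have hc : c ∈ Metric.closedBall c h := Metric.mem_closedBall_self hh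
  have hB0 : 0 ≤ B := (Finset.sum_nonneg fun _ _ => sq_nonneg _).trans (hB c hc)
  have h1 : ‖ev p x - ev p c‖ ≤ √B * ‖x - c‖ := by
    refine (convex_closedBall c h).norm_image_sub_le_of_norm_hasFDerivWithin_le
      (fun z _ => (hasFDerivAt_ev p z).hasFDerivWithinAt) (fun z hz => ?_) hc hx
    refine ContinuousLinearMap.opNorm_le_bound _ (Real.sqrt_nonneg _) fun v => ?_
    have h2 : (∑ i, ev (MvPolynomial.pderiv i p) z • (EuclideanSpace.proj i : E d →L[ℝ] ℝ)) v =
        ⟪(WithLp.toLp 2 fun i => ev (MvPolynomial.pderiv i p) z : E d), v⟫_ℝ := by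
      simp [PiLp.inner_apply, mul_comm]
    rw [h2, Real.norm_eq_abs]
    refine (abs_real_inner_le_norm _ _).trans (mul_le_mul_of_nonneg_right ?_ (norm_nonneg _))
    rw [EuclideanSpace.norm_eq]
    refine Real.sqrt_le_sqrt ?_
    simpa using hB z hz
  have h3 : ‖ev p x - ev p c‖ ≤ √B * h :=
    h1.trans (mul_le_mul_of_nonneg_left (mem_closedBall_iff_norm.1 hx) (Real.sqrt_nonneg _))
  have h4 := pow_le_pow_left₀ (norm_nonneg _) h3 2
  rw [Real.norm_eq_abs, sq_abs, mul_pow, Real.sq_sqrt hB0] at h4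
  linarith

/-- The constant field which takes the value of `v` at `c`. -/
def constAt (v : Fin d → MvPolynomial (Fin d) ℝ) (c : E d) : Fin d → MvPolynomial (Fin d) ℝ :=
  fun i => MvPolynomial.C (ev (v i) c)

theorem ev_constAt (v : Fin d → MvPolynomial (Fin d) ℝ) (c x : E d) (i : Fin d) :
    ev (constAt v c i) x = ev (v i) c := by simp [constAt, ev]

@[simp] theorem ev_sub (p q : MvPolynomial (Fin d) ℝ) (x : E d) :
    ev (p - q) x = ev p x - ev q x := by simp [ev]

theorem constAt_mem (v : Fin d → MvPolynomial (Fin d) ℝ) (c : E d) (m : ℕ) :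
    constAt v c ∈ polyFields d (Fin d) m := by
  intro i _
  rw [SetLike.mem_coe, MvPolynomial.mem_restrictTotalDegree, constAt, MvPolynomial.totalDegree_C]
  exact Nat.zero_le _

theorem gradVec_sub_constAt (v w : Fin d → MvPolynomial (Fin d) ℝ) (c : E d) :
    gradVec (v - constAt w c) = gradVec v := by
  funext ij
  simp [gradVec, grad, constAt]

/-- The Poincaré inequality for polynomials. -/
theorem Chunky.exists_poincare (d m : ℕ) {r : ℝ} (hr : 0 < r) : ∃ C : ℝ, 0 ≤ C ∧
    ∀ (T : Set (E d)) (h : ℝ) (c : E d), Chunky T r h c → ∀ v ∈ polyFields d (Fin d) m,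
      innerL2 (onElement T) (v - constAt v c) (v - constAt v c) ≤
        C * (h ^ 2 * innerL2 (onElement T) (gradVec v) (gradVec v)) := by
  obtain ⟨C, hC, hle⟩ := Chunky.exists_field_sup_bound d m hr
  refine ⟨d * (C * ballVol d), mul_nonneg (by positivity) (mul_nonneg hC (ballVol_nonneg d)),
    fun T h c hT v hv => ?_⟩
  have hh := hT.pos
  set I := innerL2 (onElement T) (gradVec v) (gradVec v)
  have hI : 0 ≤ I := innerL2_self_nonneg _ _
  -- Since `T` may be disconnected, the mean value inequality is applied in the convex ball around
  -- it, where the polynomial gradient is still controlled by its `L²`-norm on `T`.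
  have h1 : innerL2 (onElement T) (v - constAt v c) (v - constAt v c) ≤
      (d * (h ^ 2 * (C * ((h ^ d)⁻¹ * I)))) * (onElement T).real Set.univ := by
    refine innerL2_self_le_of_bound hT.nice _ ?_
    filter_upwards [ae_restrict_mem hT.isOpen.measurableSet] with x hx
    have : ∀ i ∈ Finset.univ, ev ((v - constAt v c) i) x ^ 2 ≤ h ^ 2 * (C * ((h ^ d)⁻¹ * I)) := by
      intro i _
      rw [Pi.sub_apply, ev_sub, ev_constAt]
      refine ev_sub_sq_le hh.le (hT.subset_closedBall hx) fun z hz => ?_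
      refine le_trans ?_ (hle T h c hT _ (gradVec v) (gradVec_mem hv) z hz)
      rw [Fintype.sum_prod_type]
      exact Finset.single_le_sum (f := fun i => ∑ j, ev (gradVec v (i, j)) z ^ 2)
        (fun _ _ => Finset.sum_nonneg fun _ _ => sq_nonneg _) (Finset.mem_univ i)
    refine (Finset.sum_le_card_nsmul _ _ _ this).trans ?_
    simp
  calc innerL2 (onElement T) (v - constAt v c) (v - constAt v c)
      ≤ (d * (h ^ 2 * (C * ((h ^ d)⁻¹ * I)))) * (h ^ d * ballVol d) :=
        h1.trans (mul_le_mul_of_nonneg_left hT.volume_le (by positivity))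
    _ = d * (C * ballVol d) * (h ^ 2 * I) := by field_simp

end Chunky

/-! ### Traces on the faces of an element -/

section Trace

variable {n : ℕ}

/-- The discrete trace inequality. -/
theorem exists_trace_ineq (n m : ℕ) {r K : ℝ} (hr : 0 < r) (hK : 0 ≤ K) : ∃ C : ℝ, 0 ≤ C ∧
    ∀ (Ω : Set (E (n + 1))) (M : PolytopalMesh Ω), ∀ T ∈ M.elements, ∀ (h : ℝ) (c : E (n + 1)),
      Chunky T r h c → ∑ F : M.facesOf T, (surface (n + 1)).real F.1 ≤ K * h ^ n →
      ∀ (ι : Type) [Fintype ι], ∀ f ∈ polyFields (n + 1) ι m,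
        h * ∑ F : M.facesOf T, innerL2 (onFace F.1) f f ≤ C * innerL2 (onElement T) f f := by
  obtain ⟨C, hC, hle⟩ := Chunky.exists_field_sup_bound (n + 1) m hr
  refine ⟨K * C, mul_nonneg hK hC, fun Ω M T hT h c hch hsurf ι _ f hf => ?_⟩
  have hh := hch.pos
  set I := innerL2 (onElement T) f f
  have hI : 0 ≤ I := innerL2_self_nonneg _ _
  obtain ⟨cc, hcc⟩ := M.exists_planes
  -- The supremum bound on the enclosing ball also holds on the faces. Only their total area matters
  -- after summation, so arbitrarily small faces are harmless.
  have h1 : ∀ F : M.facesOf T, innerL2 (onFace F.1) f f ≤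
      (C * ((h ^ (n + 1))⁻¹ * I)) * (surface (n + 1)).real F.1 := by
    intro F
    obtain ⟨hF, hFT⟩ := M.mem_facesOf.1 F.2
    have h2 := innerL2_self_le_of_bound (M.nice_face hT F) f
      (K := C * ((h ^ (n + 1))⁻¹ * I)) (by
        filter_upwards [ae_restrict_mem (hcc F.1 hF).1] with x hx
        exact hle T h c hch ι f hf x (closure_minimal hch.subset_closedBall
          Metric.isClosed_closedBall (frontier_subset_closure (hFT hx))))
    rwa [onFace, Measure.real, Measure.restrict_apply_univ] at h2
  calc h * ∑ F : M.facesOf T, innerL2 (onFace F.1) f f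
      ≤ h * ((C * ((h ^ (n + 1))⁻¹ * I)) * (K * h ^ n)) := by
        refine mul_le_mul_of_nonneg_left ?_ hh.le
        refine (Finset.sum_le_sum fun F _ => h1 F).trans ?_
        rw [← Finset.mul_sum]
        exact mul_le_mul_of_nonneg_left hsurf (by positivity)
    _ = K * C * I := by
        rw [pow_succ]
        field_simp

end Trace

/-! ### Calculus with the `L²`-product -/

section Calculus

variable {d : ℕ} {ι : Type} [Fintype ι] {σ : Measure (E d)}

theorem innerL2_add_left (hσ : Nice σ) (f f' g : ι → MvPolynomial (Fin d) ℝ) :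
    innerL2 σ (f + f') g = innerL2 σ f g + innerL2 σ f' g := by
  rw [innerL2_comm, innerL2_add_right hσ, innerL2_comm σ g, innerL2_comm σ g]

theorem innerL2_neg_right (σ : Measure (E d)) (f g : ι → MvPolynomial (Fin d) ℝ) :
    innerL2 σ f (-g) = -innerL2 σ f g := by
  rw [← neg_one_smul ℝ g, innerL2_smul_right, neg_one_mul]

theorem innerL2_sub_right (hσ : Nice σ) (f g g' : ι → MvPolynomial (Fin d) ℝ) :
    innerL2 σ f (g - g') = innerL2 σ f g - innerL2 σ f g' := by
  rw [sub_eq_add_neg, innerL2_add_right hσ, innerL2_neg_right, sub_eq_add_neg]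

theorem innerL2_sub_left (hσ : Nice σ) (f f' g : ι → MvPolynomial (Fin d) ℝ) :
    innerL2 σ (f - f') g = innerL2 σ f g - innerL2 σ f' g := by
  rw [innerL2_comm, innerL2_sub_right hσ, innerL2_comm σ g, innerL2_comm σ g]

theorem innerL2_sub_self (hσ : Nice σ) (f g : ι → MvPolynomial (Fin d) ℝ) :
    innerL2 σ (f - g) (f - g) = innerL2 σ f f - 2 * innerL2 σ f g + innerL2 σ g g := by
  rw [innerL2_sub_left hσ, innerL2_sub_right hσ, innerL2_sub_right hσ, innerL2_comm σ g f]
  ring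

theorem innerL2_add_self (hσ : Nice σ) (f g : ι → MvPolynomial (Fin d) ℝ) :
    innerL2 σ (f + g) (f + g) = innerL2 σ f f + 2 * innerL2 σ f g + innerL2 σ g g := by
  rw [innerL2_add_left hσ, innerL2_add_right hσ, innerL2_add_right hσ, innerL2_comm σ g f]
  ring

theorem innerL2_sub_self_comm (hσ : Nice σ) (f g : ι → MvPolynomial (Fin d) ℝ) :
    innerL2 σ (f - g) (f - g) = innerL2 σ (g - f) (g - f) := by
  rw [innerL2_sub_self hσ, innerL2_sub_self hσ, innerL2_comm σ g f]
  ring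

theorem two_innerL2_le (hσ : Nice σ) (f g : ι → MvPolynomial (Fin d) ℝ) :
    2 * innerL2 σ f g ≤ innerL2 σ f f + innerL2 σ g g := by
  have h := innerL2_self_nonneg σ (f - g)
  rw [innerL2_sub_self hσ] at h
  linarith

theorem innerL2_add_self_le (hσ : Nice σ) (f g : ι → MvPolynomial (Fin d) ℝ) :
    innerL2 σ (f + g) (f + g) ≤ 2 * innerL2 σ f f + 2 * innerL2 σ g g := by
  rw [innerL2_add_self hσ]
  linarith [two_innerL2_le hσ f g]

theorem innerL2_sub_self_le (hσ : Nice σ) (f g : ι → MvPolynomial (Fin d) ℝ) :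
    innerL2 σ (f - g) (f - g) ≤ 2 * innerL2 σ f f + 2 * innerL2 σ g g := by
  have h := innerL2_self_nonneg σ (f + g)
  rw [innerL2_add_self hσ] at h
  rw [innerL2_sub_self hσ]
  linarith

/-- The projection of `f` is closer than `f` to every element of the subspace. -/
theorem l2Proj_sub_le (hσ : Nice σ) (X : Submodule ℝ (ι → MvPolynomial (Fin d) ℝ))
    [FiniteDimensional ℝ X] (f : ι → MvPolynomial (Fin d) ℝ) {g : ι → MvPolynomial (Fin d) ℝ}
    (hg : g ∈ X) :
    innerL2 σ ((l2Proj σ X f).1 - g) ((l2Proj σ X f).1 - g) ≤ innerL2 σ (f - g) (f - g) := by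
  set u := (l2Proj σ X f).1 - g with hu
  have hspec := l2Proj_spec hσ X f (l2Proj σ X f - ⟨g, hg⟩)
  -- The difference `u` belongs to `X`, so the projection may be replaced by `f` when tested against
  -- it.
  have h1 : innerL2 σ u u = innerL2 σ (f - g) u := by
    conv_lhs => rw [hu]
    rw [innerL2_sub_left hσ, innerL2_sub_left hσ]
    exact congrArg (· - innerL2 σ g u) hspec
  have h2 := two_innerL2_le hσ (f - g) u
  linarith

theorem l2Proj_self_le (hσ : Nice σ) (X : Submodule ℝ (ι → MvPolynomial (Fin d) ℝ))
    [FiniteDimensional ℝ X] (f : ι → MvPolynomial (Fin d) ℝ) :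
    innerL2 σ (l2Proj σ X f).1 (l2Proj σ X f).1 ≤ innerL2 σ f f := by
  simpa using l2Proj_sub_le hσ X f X.zero_mem

theorem innerL2_prod_self (hσ : Nice σ) {κ : Type} [Fintype κ]
    (f : ι × κ → MvPolynomial (Fin d) ℝ) :
    innerL2 σ f f = ∑ i, innerL2 σ (fun j => f (i, j)) fun j => f (i, j) := by
  simp only [innerL2_self_eq_sum hσ, Fintype.sum_prod_type]

/-- Subtracting constants increases the norm of a field of zero mean. -/
theorem innerL2_self_le_sub_const (hσ : Nice σ) {f : ι → MvPolynomial (Fin d) ℝ}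
    (hf : ∀ i, ∫ x, ev (f i) x ∂σ = 0) (a : ι → ℝ) :
    innerL2 σ f f ≤ innerL2 σ (f - fun i => MvPolynomial.C (a i))
      (f - fun i => MvPolynomial.C (a i)) := by
  have h1 : innerL2 σ f (fun i => MvPolynomial.C (a i)) = 0 := by
    rw [innerL2, integral_finsetSum]
    · refine Finset.sum_eq_zero fun i _ => ?_
      have : ∀ x : E d, ev (MvPolynomial.C (a i)) x = a i := fun x => by simp [ev]
      simp only [this]
      rw [integral_mul_const, hf, zero_mul]
    · exact fun i _ => hσ.integrable ((ev_continuous _).mul (ev_continuous _))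
  rw [innerL2_sub_self hσ, h1]
  linarith [innerL2_self_nonneg σ (fun i => (MvPolynomial.C (a i) : MvPolynomial (Fin d) ℝ))]

theorem polyFields_mono (d : ℕ) (ι : Type) {m m' : ℕ} (h : m ≤ m') :
    polyFields d ι m ≤ polyFields d ι m' := by
  intro f hf i hi
  have := hf i hi
  rw [SetLike.mem_coe, MvPolynomial.mem_restrictTotalDegree] at this ⊢
  exact this.trans h

theorem gradVec_add (v w : Fin d → MvPolynomial (Fin d) ℝ) :
    gradVec (v + w) = gradVec v + gradVec w := by
  funext ij
  simp [gradVec]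

theorem gradVec_sub (v w : Fin d → MvPolynomial (Fin d) ℝ) :
    gradVec (v - w) = gradVec v - gradVec w := by
  funext ij
  simp [gradVec]

end Calculus

/-! ### The discrete gradient -/

section Gradient

theorem ev_mul {d : ℕ} (p q : MvPolynomial (Fin d) ℝ) (x : E d) :
    ev (p * q) x = ev p x * ev q x := by simp [ev]

theorem ev_sum {d : ℕ} {κ : Type*} (s : Finset κ) (p : κ → MvPolynomial (Fin d) ℝ) (x : E d) :
    ev (∑ i ∈ s, p i) x = ∑ i ∈ s, ev (p i) x := by simp [ev]

variable {n : ℕ} {Ω : Set (E (n + 1))} (M : PolytopalMesh Ω) {T : Set (E (n + 1))} {k : ℕ}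

/-- The pairing of the traces of a vector field and of the normal component of a tensor field. -/
def facePairing {d : ℕ} (σ : Measure (E d)) (ν : E d) (v : Fin d → MvPolynomial (Fin d) ℝ)
    (τ : Fin d × Fin d → MvPolynomial (Fin d) ℝ) : ℝ :=
  ∫ x, ∑ i, ev (v i) x * ∑ j, ev (τ (i, j)) x * ν j ∂σ

theorem continuous_facePairing {d : ℕ} (ν : E d) (v : Fin d → MvPolynomial (Fin d) ℝ)
    (τ : Fin d × Fin d → MvPolynomial (Fin d) ℝ) :
    Continuous fun x : E d => ∑ i, ev (v i) x * ∑ j, ev (τ (i, j)) x * ν j := by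
  have := @ev_continuous d
  fun_prop

theorem facePairing_sub {d : ℕ} {σ : Measure (E d)} (hσ : Nice σ) (ν : E d)
    (v w : Fin d → MvPolynomial (Fin d) ℝ) (τ : Fin d × Fin d → MvPolynomial (Fin d) ℝ) :
    facePairing σ ν (v - w) τ = facePairing σ ν v τ - facePairing σ ν w τ := by
  rw [facePairing, facePairing, facePairing,
    ← integral_sub (hσ.integrable (continuous_facePairing ν v τ))
      (hσ.integrable (continuous_facePairing ν w τ))]
  simp [sub_mul, Finset.sum_sub_distrib]

/-- Pointwise, the Cauchy–Schwarz inequality with the unit vector `ν` bounds the normal component of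
`τ`, and Young's inequality splits the product. The free weight `β` serves to absorb the tensor term
later. -/
theorem abs_facePairing_le {d : ℕ} {σ : Measure (E d)} (hσ : Nice σ) {ν : E d} (hν : ‖ν‖ = 1)
    (v : Fin d → MvPolynomial (Fin d) ℝ) (τ : Fin d × Fin d → MvPolynomial (Fin d) ℝ)
    {β : ℝ} (hβ : 0 < β) :
    |facePairing σ ν v τ| ≤ β / 2 * innerL2 σ v v + (2 * β)⁻¹ * innerL2 σ τ τ := by
  rw [innerL2, innerL2, ← integral_const_mul, ← integral_const_mul,
    ← integral_add ((hσ.integrable (continuous_inner_sum v v)).const_mul _)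
      ((hσ.integrable (continuous_inner_sum τ τ)).const_mul _), facePairing]
  refine abs_integral_le_integral_abs.trans (integral_mono
    (hσ.integrable (continuous_facePairing ν v τ)).abs
    (((hσ.integrable (continuous_inner_sum v v)).const_mul _).add
      ((hσ.integrable (continuous_inner_sum τ τ)).const_mul _)) fun x => ?_)
  have hν2 : ∑ j, ν j ^ 2 = 1 := by
    have := EuclideanSpace.norm_sq_eq ν
    rw [hν] at this
    simpa using this.symm
  simp only [Fintype.sum_prod_type, Finset.mul_sum (Finset.univ) _ (β / 2),
    Finset.mul_sum (Finset.univ) _ (2 * β)⁻¹, ← Finset.sum_add_distrib]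
  refine (Finset.abs_sum_le_sum_abs _ _).trans (Finset.sum_le_sum fun i _ => ?_)
  have h1 := Finset.sum_mul_sq_le_sq_mul_sq Finset.univ (fun j => ev (τ (i, j)) x) fun j => ν j
  rw [hν2, mul_one] at h1
  rw [← Finset.mul_sum]
  simp only [← sq]
  set a := ev (v i) x
  set b := ∑ j, ev (τ (i, j)) x * ν j
  have h2 : (2 * β)⁻¹ * b ^ 2 ≤ (2 * β)⁻¹ * ∑ j, ev (τ (i, j)) x ^ 2 :=
    mul_le_mul_of_nonneg_left h1 (by positivity)
  have h3 : |a * b| ≤ β / 2 * a ^ 2 + (2 * β)⁻¹ * b ^ 2 := by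
    have h4 : 0 ≤ (2 * β)⁻¹ * (β * |a| - |b|) ^ 2 := by positivity
    have h5 : (2 * β)⁻¹ * (β * |a| - |b|) ^ 2 =
        β / 2 * |a| ^ 2 + (2 * β)⁻¹ * |b| ^ 2 - |a| * |b| := by
      field_simp
      ring
    rw [sq_abs, sq_abs] at h5
    rw [abs_mul]
    linarith
  linarith

/-- Integration by parts on an element. -/
theorem PolytopalMesh.integration_by_parts (hΩ : IsPolytopal Ω) (hT : T ∈ M.elements)
    (v : Fin (n + 1) → MvPolynomial (Fin (n + 1)) ℝ)
    (τ : Fin (n + 1) × Fin (n + 1) → MvPolynomial (Fin (n + 1)) ℝ) :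
    innerL2 (onElement T) (gradVec v) τ + innerL2 (onElement T) v (divTensor τ) =
      ∑ F : M.facesOf T, M.orient T F * facePairing (onFace F.1) (M.normal F) v τ := by
  have hn := M.nice_element hT
  have h1 : ∀ i j, ∫ x, ev (MvPolynomial.pderiv j (v i * τ (i, j))) x ∂onElement T =
      ∫ x, ev (gradVec v (i, j)) x * ev (τ (i, j)) x +
        ev (v i) x * ev (MvPolynomial.pderiv j (τ (i, j))) x ∂onElement T := by
    intro i j
    congr 1
    ext x
    have hgv : gradVec v (i, j) = MvPolynomial.pderiv j (v i) := rfl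
    simp only [Derivation.leibniz, hgv, ev_add, smul_eq_mul, ev_mul]
    ring
  have hc := @ev_continuous (n + 1)
  have h2 : innerL2 (onElement T) (gradVec v) τ + innerL2 (onElement T) v (divTensor τ) =
      ∑ i, ∑ j, ∫ x, ev (MvPolynomial.pderiv j (v i * τ (i, j))) x ∂onElement T := by
    rw [innerL2, innerL2, ← integral_add (hn.integrable (continuous_inner_sum _ _))
      (hn.integrable (continuous_inner_sum _ _))]
    simp only [h1]
    have h3 : ∀ i, ∑ j, ∫ x, ev (gradVec v (i, j)) x * ev (τ (i, j)) x +
        ev (v i) x * ev (MvPolynomial.pderiv j (τ (i, j))) x ∂onElement T =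
        ∫ x, ∑ j, (ev (gradVec v (i, j)) x * ev (τ (i, j)) x +
        ev (v i) x * ev (MvPolynomial.pderiv j (τ (i, j))) x) ∂onElement T := by
      intro i
      rw [integral_finsetSum]
      exact fun j _ => hn.integrable (by fun_prop)
    simp only [h3]
    rw [← integral_finsetSum]
    · congr 1
      ext x
      simp only [Fintype.sum_prod_type, divTensor, ev_sum, Finset.mul_sum,
        Finset.sum_add_distrib]
    · exact fun j _ => hn.integrable (by fun_prop)
  rw [h2]
  simp only [M.integral_pderiv _ hΩ hT,
    Finset.sum_comm (s := (Finset.univ : Finset (Fin (n + 1))))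
      (t := (Finset.univ : Finset (M.facesOf T)))]
  refine Finset.sum_congr rfl fun F _ => ?_
  have hF := M.nice_face hT F
  rw [facePairing, integral_finsetSum, Finset.mul_sum]
  · refine Finset.sum_congr rfl fun i _ => ?_
    simp only [Finset.mul_sum]
    rw [integral_finsetSum, Finset.mul_sum]
    · refine Finset.sum_congr rfl fun j _ => ?_
      rw [mul_assoc, ← integral_const_mul]
      congr 2
      ext x
      rw [ev_mul]
      ring
    · exact fun j _ => hF.integrable (by fun_prop)
  · exact fun j _ => hF.integrable (by fun_prop)

/-- Integration by parts in the element term turns the face values `v_F` into the jumps `v_T - v_F`.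
This is where the divergence theorem enters the estimates. -/
theorem gradRhs_eq (hΩ : IsPolytopal Ω) (hT : T ∈ M.elements) (v : LocalHHO M T k)
    (τ : Fin (n + 1) × Fin (n + 1) → MvPolynomial (Fin (n + 1)) ℝ) :
    gradRhs M T v τ = innerL2 (onElement T) (gradVec v.1.1) τ -
      ∑ F : M.facesOf T, M.orient T F *
        facePairing (onFace F.1) (M.normal F) (v.1.1 - (v.2 F).1) τ := by
  have h1 := M.integration_by_parts hΩ hT v.1.1 τ
  have h2 : ∀ F : M.facesOf T, M.orient T F *
        facePairing (onFace F.1) (M.normal F) (v.1.1 - (v.2 F).1) τ =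
      M.orient T F * facePairing (onFace F.1) (M.normal F) v.1.1 τ -
      M.orient T F * facePairing (onFace F.1) (M.normal F) (v.2 F).1 τ := fun F => by
    rw [facePairing_sub (M.nice_face hT F), mul_sub]
  simp only [h2, Finset.sum_sub_distrib, ← h1]
  change -innerL2 (onElement T) v.1.1 (divTensor τ) + ∑ F : M.facesOf T,
    M.orient T F * facePairing (onFace F.1) (M.normal F) (v.2 F).1 τ = _
  ring

/-- The discrete gradient is bounded by the discrete `H¹`-seminorm. -/
theorem discreteGradient_le (hΩ : IsPolytopal Ω) (hT : T ∈ M.elements) (v : LocalHHO M T k)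
    {C : ℝ} (hC : 0 ≤ C) (htr : ∀ f ∈ polyFields (n + 1) (Fin (n + 1) × Fin (n + 1)) k,
      Metric.diam T * ∑ F : M.facesOf T, innerL2 (onFace F.1) f f ≤
        C * innerL2 (onElement T) f f) :
    innerL2 (onElement T) (discreteGradient M T v).1 (discreteGradient M T v).1 ≤
      (4 + 2 * (C + 1)) * hhoNormSq M T v := by
  have hh := M.diam_pos hT
  set h := Metric.diam T
  set G := (discreteGradient M T v).1 with hG
  have hn := M.nice_element hT
  have h1 : innerL2 (onElement T) G G = _ := discreteGradient_spec M hT v (discreteGradient M T v)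
  rw [← hG, gradRhs_eq M hΩ hT] at h1
  -- With this weight the trace inequality bounds the face terms in `G` by half of `‖G‖²`. The
  -- remaining term costs another quarter, so a quarter of `‖G‖²` is left after absorption. Adding
  -- `1` keeps the weight positive when `C = 0`.
  have hβ : 0 < (C + 1) / h := by positivity
  have h2 : ∀ F : M.facesOf T, -(M.orient T F *
        facePairing (onFace F.1) (M.normal F) (v.1.1 - (v.2 F).1) G) ≤
      (C + 1) / h / 2 * innerL2 (onFace F.1) (v.1.1 - (v.2 F).1) (v.1.1 - (v.2 F).1) +
        (2 * ((C + 1) / h))⁻¹ * innerL2 (onFace F.1) G G := by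
    intro F
    obtain ⟨hF, hFT⟩ := M.mem_facesOf.1 F.2
    refine le_trans ?_ (abs_facePairing_le (M.nice_face hT F) (M.norm_normal F hF) _ G hβ)
    rcases M.orient_sign T hT F hF hFT with h | h <;> rw [h]
    · rw [one_mul]; exact neg_le_abs _
    · rw [neg_one_mul, neg_neg]; exact le_abs_self _
  have h3 := Finset.sum_le_sum fun F (_ : F ∈ Finset.univ) => h2 F
  rw [Finset.sum_neg_distrib, Finset.sum_add_distrib, ← Finset.mul_sum, ← Finset.mul_sum] at h3
  have h4 := htr G (discreteGradient M T v).2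
  have h5 : (2 * ((C + 1) / h))⁻¹ * ∑ F : M.facesOf T, innerL2 (onFace F.1) G G ≤
      1 / 2 * innerL2 (onElement T) G G := by
    have hG0 := innerL2_self_nonneg (onElement T) G
    have e : (2 * ((C + 1) / h))⁻¹ * ∑ F : M.facesOf T, innerL2 (onFace F.1) G G =
        (2 * (C + 1))⁻¹ * (h * ∑ F : M.facesOf T, innerL2 (onFace F.1) G G) := by
      field_simp
    rw [e]
    calc (2 * (C + 1))⁻¹ * (h * ∑ F : M.facesOf T, innerL2 (onFace F.1) G G)
        ≤ (2 * (C + 1))⁻¹ * ((C + 1) * innerL2 (onElement T) G G) := by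
          refine mul_le_mul_of_nonneg_left (h4.trans ?_) (by positivity)
          linarith
      _ = 1 / 2 * innerL2 (onElement T) G G := by field_simp
  have h6 : innerL2 (onElement T) (gradVec v.1.1) G ≤
      innerL2 (onElement T) (gradVec v.1.1) (gradVec v.1.1) +
        1 / 4 * innerL2 (onElement T) G G := by
    have := two_innerL2_le hn (gradVec v.1.1) ((1 / 2 : ℝ) • G)
    rw [innerL2_smul_right, innerL2_smul_right, innerL2_comm _ (_ • G) G,
      innerL2_smul_right] at this
    linarith
  rw [hhoNormSq]
  set a := innerL2 (onElement T) (gradVec v.1.1) (gradVec v.1.1)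
  set D := ∑ F : M.facesOf T, innerL2 (onFace F.1) (v.1.1 - (v.2 F).1) (v.1.1 - (v.2 F).1)
  have ha : 0 ≤ a := innerL2_self_nonneg _ _
  have hD : 0 ≤ h⁻¹ * D :=
    mul_nonneg (inv_nonneg.2 hh.le) (Finset.sum_nonneg fun F _ => innerL2_self_nonneg _ _)
  have e2 : (C + 1) / h / 2 * D = (C + 1) / 2 * (h⁻¹ * D) := by field_simp
  rw [e2] at h3
  have h7 : innerL2 (onElement T) G G ≤ 4 * a + 2 * (C + 1) * (h⁻¹ * D) := by linarith
  nlinarith [mul_nonneg hC ha]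

end Gradient

/-! ### The Stokes seminorm -/

section Coefficients

variable {d : ℕ} {Ω : Set (E d)}

/-- Averages of almost everywhere nonnegative functions are nonnegative; only signs are needed, not
the values of the constants. -/
theorem Coefficients.friction_nonneg (D : Coefficients Ω) {T : Set (E d)} (hT : T ⊆ Ω) :
    0 ≤ D.friction T := by
  have hac : ∀ {p : E d → Prop}, (∀ᵐ x ∂volume.restrict Ω, p x) →
      ∀ᵐ x ∂volume.restrict T, p x := fun h => ae_restrict_of_ae_restrict_of_subset hT h
  have h1 : 0 ≤ D.nuOn T := by
    rw [Coefficients.nuOn, average_eq, smul_eq_mul]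
    exact mul_nonneg (inv_nonneg.2 measureReal_nonneg)
      (integral_nonneg_of_ae ((hac D.nu_bounds).mono fun x hx => hx.1))
  have h2 : 0 ≤ D.muOn T := by
    rw [Coefficients.muOn, average_eq, smul_eq_mul]
    exact mul_nonneg (inv_nonneg.2 measureReal_nonneg)
      (integral_nonneg_of_ae ((hac D.mu_bounds).mono fun x hx => D.muMin_pos.le.trans hx.1))
  exact div_nonneg (mul_nonneg h1 (sq_nonneg _)) h2

theorem minOneInv_nonneg {C : ℝ} (hC : 0 ≤ C) : 0 ≤ minOneInv C := by
  unfold minOneInv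
  split_ifs
  · exact zero_le_one
  · exact le_min zero_le_one (inv_nonneg.2 hC)

theorem minOneInv_le_one (C : ℝ) : minOneInv C ≤ 1 := by
  unfold minOneInv
  split_ifs
  · exact le_rfl
  · exact min_le_left _ _

theorem minOneInv_eq_one {C : ℝ} (hC : 0 ≤ C) (hC1 : C < 1) : minOneInv C = 1 := by
  unfold minOneInv
  split_ifs with h
  · rfl
  · exact min_eq_left ((one_le_inv₀ (lt_of_le_of_ne hC (Ne.symm h))).2 hC1.le)

end Coefficients

section Seminorm

variable {n : ℕ} {Ω : Set (E (n + 1))} (M : PolytopalMesh Ω) {T : Set (E (n + 1))} {k : ℕ}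

/-- The gradient of the Stokes potential is bounded by the discrete gradient. -/
theorem gradVec_stokesPotential_le (hT : T ∈ M.elements) (v : LocalHHO M T k) :
    innerL2 (onElement T) (gradVec (stokesPotential M T v).1) (gradVec (stokesPotential M T v).1) ≤
      innerL2 (onElement T) (discreteGradient M T v).1 (discreteGradient M T v).1 := by
  have hn := M.nice_element hT
  rw [innerL2_prod_self hn, innerL2_prod_self hn]
  refine Finset.sum_le_sum fun i _ => ?_
  have h1 : (fun j => gradVec (stokesPotential M T v).1 (i, j)) =
      grad (n + 1) ((stokesPotential M T v).1 i) := rfl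
  rw [h1, (stokesPotential_spec M hT v i).1]
  exact l2Proj_self_le hn _ _

/-- The sum of the squared norms of the face components of `v - I P v`. -/
def faceDiffSq (v : LocalHHO M T k) : ℝ :=
  ∑ F : M.facesOf T, innerL2 (onFace F.1) ((stokesDiff M T v).2 F).1 ((stokesDiff M T v).2 F).1

/-- The sum of the squared norms of the differences between element and face components. -/
def faceJumpSq (v : LocalHHO M T k) : ℝ :=
  ∑ F : M.facesOf T, innerL2 (onFace F.1) (v.1.1 - (v.2 F).1) (v.1.1 - (v.2 F).1)

theorem faceDiffSq_nonneg (v : LocalHHO M T k) : 0 ≤ faceDiffSq M v :=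
  Finset.sum_nonneg fun _ _ => innerL2_self_nonneg _ _

theorem faceJumpSq_nonneg (v : LocalHHO M T k) : 0 ≤ faceJumpSq M v :=
  Finset.sum_nonneg fun _ _ => innerL2_self_nonneg _ _

theorem hhoNormSq_eq (v : LocalHHO M T k) :
    hhoNormSq M T v = innerL2 (onElement T) (gradVec v.1.1) (gradVec v.1.1) +
      (Metric.diam T)⁻¹ * faceJumpSq M v := rfl

theorem prodU_self_nonneg {C lam : ℝ} (hlam : 0 ≤ lam) (w : LocalHHO M T k) :
    0 ≤ prodU M T C lam w w := by
  refine add_nonneg (mul_nonneg hlam (innerL2_self_nonneg _ _))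
    (mul_nonneg Metric.diam_nonneg (Finset.sum_nonneg fun F _ => mul_nonneg ?_
      (innerL2_self_nonneg _ _)))
  split_ifs <;> norm_num

theorem prodU_stokesDiff_le {C lam : ℝ} (v : LocalHHO M T k) :
    prodU M T C lam (stokesDiff M T v) (stokesDiff M T v) ≤
      lam * innerL2 (onElement T) (stokesDiff M T v).1.1 (stokesDiff M T v).1.1 +
        Metric.diam T * faceDiffSq M v := by
  refine add_le_add_right (mul_le_mul_of_nonneg_left (Finset.sum_le_sum fun F _ => ?_)
    Metric.diam_nonneg) _
  refine mul_le_of_le_one_left (innerL2_self_nonneg _ _) ?_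
  split_ifs <;> norm_num

/-- For `C < 1` no boundary face is dropped from the product. This is what lets the seminorm control
all face components in the lower bound. -/
theorem prodU_stokesDiff_eq {C lam : ℝ} (hC : C < 1) (v : LocalHHO M T k) :
    prodU M T C lam (stokesDiff M T v) (stokesDiff M T v) =
      lam * innerL2 (onElement T) (stokesDiff M T v).1.1 (stokesDiff M T v).1.1 +
        Metric.diam T * faceDiffSq M v := by
  simp [prodU, hC, faceDiffSq]

theorem stokesForm_self_nonneg {C lam : ℝ} (hC : 0 ≤ C) (hlam : 0 ≤ lam) (v : LocalHHO M T k) :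
    0 ≤ stokesForm M T C lam v v :=
  add_nonneg (innerL2_self_nonneg _ _) (mul_nonneg
    (div_nonneg (minOneInv_nonneg hC) (sq_nonneg _)) (prodU_self_nonneg M hlam _))

theorem stokesSeminorm_sq {C lam : ℝ} (hC : 0 ≤ C) (hlam : 0 ≤ lam) (v : LocalHHO M T k) :
    stokesSeminorm M T C lam v ^ 2 = stokesForm M T C lam v v :=
  Real.sq_sqrt (stokesForm_self_nonneg M hC hlam v)

theorem stokesDiff_fst (v : LocalHHO M T k) : (stokesDiff M T v).1.1 =
    v.1.1 - (l2Proj (onElement T) (polyFields (n + 1) (Fin (n + 1)) k)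
      (stokesPotential M T v).1).1 := rfl

theorem stokesDiff_snd (v : LocalHHO M T k) (F : M.facesOf T) : ((stokesDiff M T v).2 F).1 =
    (v.2 F).1 - (l2Proj (onFace F.1) (polyFields (n + 1) (Fin (n + 1)) k)
      (stokesPotential M T v).1).1 := rfl

variable {r : ℝ} {c : E (n + 1)}

/-- The Stokes seminorm is bounded by the discrete `H¹`-seminorm, given the Poincaré inequality
with constant `Cp` and the discrete trace inequality with constant `Ct`. -/
theorem stokesForm_le (hΩ : IsPolytopal Ω) (hT : T ∈ M.elements) {Cp Ct : ℝ} (hCp : 0 ≤ Cp)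
    (hCt : 0 ≤ Ct)
    (hp : ∀ w ∈ polyFields (n + 1) (Fin (n + 1)) (k + 1),
      innerL2 (onElement T) (w - constAt w c) (w - constAt w c) ≤
        Cp * (Metric.diam T ^ 2 * innerL2 (onElement T) (gradVec w) (gradVec w)))
    (htr : ∀ (ι : Type) [Fintype ι], ∀ f ∈ polyFields (n + 1) ι (k + 1),
      Metric.diam T * ∑ F : M.facesOf T, innerL2 (onFace F.1) f f ≤
        Ct * innerL2 (onElement T) f f)
    {Cf lam lamMax : ℝ} (hlam : 0 ≤ lam) (hlam' : lam ≤ lamMax)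
    (v : LocalHHO M T k) :
    stokesForm M T Cf lam v v ≤ ((4 + 2 * (Ct + 1)) + (lamMax + 2 * Ct) *
      (2 * Cp * (5 + 2 * (Ct + 1))) + 2) * hhoNormSq M T v := by
  have hh := M.diam_pos hT
  have hn := M.nice_element hT
  have hmono := polyFields_mono (n + 1) (Fin (n + 1)) (Nat.le_succ k)
  have hG := discreteGradient_le M hΩ hT v hCt fun f hf =>
    htr _ f (polyFields_mono _ _ (Nat.le_succ k) hf)
  have hGP := gradVec_stokesPotential_le M hT v
  have hspec := stokesPotential_spec M hT v
  have hU := prodU_stokesDiff_le M (C := Cf) (lam := lam) v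
  have hN0 : 0 ≤ hhoNormSq M T v := by
    rw [hhoNormSq_eq]
    exact add_nonneg (innerL2_self_nonneg _ _)
      (mul_nonneg (inv_nonneg.2 hh.le) (faceJumpSq_nonneg M v))
  have hgN : innerL2 (onElement T) (gradVec v.1.1) (gradVec v.1.1) ≤ hhoNormSq M T v := by
    rw [hhoNormSq_eq]
    exact le_add_of_nonneg_right (mul_nonneg (inv_nonneg.2 hh.le) (faceJumpSq_nonneg M v))
  have hJN : Metric.diam T * faceJumpSq M v ≤ Metric.diam T ^ 2 * hhoNormSq M T v := by
    rw [hhoNormSq_eq, mul_add]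
    have : Metric.diam T ^ 2 * ((Metric.diam T)⁻¹ * faceJumpSq M v) =
        Metric.diam T * faceJumpSq M v := by field_simp
    rw [this]
    exact le_add_of_nonneg_left (mul_nonneg (sq_nonneg _) (innerL2_self_nonneg _ _))
  set h := Metric.diam T
  set N := hhoNormSq M T v
  set P := stokesPotential M T v with hP
  let e := P.1 - v.1.1
  have he : e ∈ polyFields (n + 1) (Fin (n + 1)) (k + 1) := Submodule.sub_mem _ P.2 (hmono v.1.2)
  -- the distance between the potential and the element component
  have hE : innerL2 (onElement T) e e ≤ 2 * Cp * (5 + 2 * (Ct + 1)) * (h ^ 2 * N) := by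
    -- The potential and `v_T` have equal means, so `e` has zero mean and its norm is at most that
    -- of `e` minus its value at `c`, to which the Poincaré inequality applies.
    have h1 : ∀ i, ∫ x, ev (e i) x ∂onElement T = 0 := by
      intro i
      simp only [e, Pi.sub_apply, ev_sub]
      rw [integral_sub (hn.integrable (ev_continuous _)) (hn.integrable (ev_continuous _)),
        (hspec i).2, sub_self]
    have h2 := innerL2_self_le_sub_const hn h1 fun i => ev (e i) c
    have h3 : innerL2 (onElement T) (gradVec e) (gradVec e) ≤ 2 * (5 + 2 * (Ct + 1)) * N := by
      rw [gradVec_sub]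
      refine (innerL2_sub_self_le hn _ _).trans ?_
      linarith [hGP.trans hG]
    calc innerL2 (onElement T) e e ≤ _ := h2
      _ ≤ Cp * (h ^ 2 * innerL2 (onElement T) (gradVec e) (gradVec e)) := hp e he
      _ ≤ Cp * (h ^ 2 * (2 * (5 + 2 * (Ct + 1)) * N)) := by gcongr
      _ = _ := by ring
  set Ce := 2 * Cp * (5 + 2 * (Ct + 1))
  have hCe : 0 ≤ Ce := by positivity
  -- the element component of the difference
  have hdT : innerL2 (onElement T) (stokesDiff M T v).1.1 (stokesDiff M T v).1.1 ≤
      Ce * (h ^ 2 * N) := by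
    rw [stokesDiff_fst, innerL2_sub_self_comm hn]
    exact (l2Proj_sub_le hn _ _ v.1.2).trans hE
  -- the face components of the difference
  have hdF : h * faceDiffSq M v ≤ (2 * Ct * Ce + 2) * (h ^ 2 * N) := by
    have h1 : ∀ F : M.facesOf T,
        innerL2 (onFace F.1) ((stokesDiff M T v).2 F).1 ((stokesDiff M T v).2 F).1 ≤
          2 * innerL2 (onFace F.1) e e +
            2 * innerL2 (onFace F.1) (v.1.1 - (v.2 F).1) (v.1.1 - (v.2 F).1) := by
      intro F
      have hF := M.nice_face hT F
      -- As `v_F` has degree at most `k`, it is admissible in the best approximation property: `π_F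
      -- P - v_F` is no larger than `P - v_F`, which splits into `e` and the jump.
      rw [stokesDiff_snd, innerL2_sub_self_comm hF]
      refine (l2Proj_sub_le hF _ _ (v.2 F).2).trans ?_
      have : P.1 - (v.2 F).1 = e + (v.1.1 - (v.2 F).1) := by simp only [e]; abel
      rw [← hP, this]
      exact innerL2_add_self_le hF _ _
    have h2 : faceDiffSq M v ≤ 2 * ∑ F : M.facesOf T, innerL2 (onFace F.1) e e +
        2 * faceJumpSq M v := by
      refine (Finset.sum_le_sum fun F _ => h1 F).trans_eq ?_
      rw [Finset.sum_add_distrib, ← Finset.mul_sum, ← Finset.mul_sum]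
      rfl
    have h3 := htr _ e he
    have h4 : Ct * innerL2 (onElement T) e e ≤ Ct * (Ce * (h ^ 2 * N)) :=
      mul_le_mul_of_nonneg_left hE hCt
    have h5 := mul_le_mul_of_nonneg_left h2 hh.le
    linarith
  have hh2 : 0 < h ^ 2 := by positivity
  have hm : minOneInv Cf / h ^ 2 * prodU M T Cf lam (stokesDiff M T v) (stokesDiff M T v) ≤
      ((lamMax + 2 * Ct) * Ce + 2) * N := by
    have h1 : prodU M T Cf lam (stokesDiff M T v) (stokesDiff M T v) ≤
        ((lamMax + 2 * Ct) * Ce + 2) * (h ^ 2 * N) := by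
      have h2 : lam * innerL2 (onElement T) (stokesDiff M T v).1.1 (stokesDiff M T v).1.1 ≤
          lamMax * (Ce * (h ^ 2 * N)) :=
        mul_le_mul hlam' hdT (innerL2_self_nonneg _ _) (hlam.trans hlam')
      linarith
    have h0 := prodU_self_nonneg M (C := Cf) hlam (stokesDiff M T v)
    calc minOneInv Cf / h ^ 2 * prodU M T Cf lam (stokesDiff M T v) (stokesDiff M T v)
        ≤ 1 / h ^ 2 * prodU M T Cf lam (stokesDiff M T v) (stokesDiff M T v) := by
          gcongr
          exact minOneInv_le_one Cf
      _ ≤ 1 / h ^ 2 * (((lamMax + 2 * Ct) * Ce + 2) * (h ^ 2 * N)) := by gcongr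
      _ = _ := by field_simp
  calc stokesForm M T Cf lam v v = innerL2 (onElement T) (discreteGradient M T v).1
        (discreteGradient M T v).1 +
        minOneInv Cf / h ^ 2 * prodU M T Cf lam (stokesDiff M T v) (stokesDiff M T v) := rfl
    _ ≤ _ := by linarith

/-- The discrete `H¹`-seminorm is bounded by the Stokes seminorm in the Stokes-dominated regime,
given the inverse inequality with constant `Ci`, the Poincaré inequality with constant `Cp` and the
discrete trace inequality with constant `Ct`. -/
theorem hhoNormSq_le (hT : T ∈ M.elements) {Ci Cp Ct : ℝ} (hCi : 0 ≤ Ci)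
    (hCt : 0 ≤ Ct)
    (hi : ∀ w ∈ polyFields (n + 1) (Fin (n + 1)) (k + 1),
      Metric.diam T ^ 2 * innerL2 (onElement T) (gradVec w) (gradVec w) ≤
        Ci * innerL2 (onElement T) w w)
    (hp : ∀ w ∈ polyFields (n + 1) (Fin (n + 1)) (k + 1),
      innerL2 (onElement T) (w - constAt w c) (w - constAt w c) ≤
        Cp * (Metric.diam T ^ 2 * innerL2 (onElement T) (gradVec w) (gradVec w)))
    (hCp : 0 ≤ Cp)
    (htr : ∀ (ι : Type) [Fintype ι], ∀ f ∈ polyFields (n + 1) ι (k + 1),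
      Metric.diam T * ∑ F : M.facesOf T, innerL2 (onFace F.1) f f ≤
        Ct * innerL2 (onElement T) f f)
    {Cf lam lamMin : ℝ} (hCf : 0 ≤ Cf) (hCf1 : Cf < 1) (hlamMin : 0 < lamMin) (hlam : lamMin ≤ lam)
    (v : LocalHHO M T k) :
    hhoNormSq M T v ≤ (2 * Ci * (lamMin⁻¹ + Cp) + (4 * Ct * lamMin⁻¹ + 4 + 8 * Ct * Cp)) *
      stokesForm M T Cf lam v v := by
  have hh := M.diam_pos hT
  have hn := M.nice_element hT
  have hmono := polyFields_mono (n + 1) (Fin (n + 1)) (Nat.le_succ k)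
  have hGP := gradVec_stokesPotential_le M hT v
  have hU := prodU_stokesDiff_eq M (lam := lam) hCf1 v
  have hform : stokesForm M T Cf lam v v = innerL2 (onElement T) (discreteGradient M T v).1
      (discreteGradient M T v).1 + minOneInv Cf / Metric.diam T ^ 2 *
        prodU M T Cf lam (stokesDiff M T v) (stokesDiff M T v) := rfl
  rw [minOneInv_eq_one hCf hCf1, hU] at hform
  have hFD := faceDiffSq_nonneg M v
  rw [hhoNormSq_eq]
  set h := Metric.diam T
  set S := stokesForm M T Cf lam v v
  set P := stokesPotential M T v with hP
  set G2 := innerL2 (onElement T) (discreteGradient M T v).1 (discreteGradient M T v).1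
  have hG0 : 0 ≤ G2 := innerL2_self_nonneg _ _
  have hh2 : 0 < h ^ 2 := by positivity
  set δ := (stokesDiff M T v).1.1 with hδ
  have hδ0 := innerL2_self_nonneg (onElement T) δ
  have hprod : lam * innerL2 (onElement T) δ δ + h * faceDiffSq M v ≤ h ^ 2 * S := by
    rw [hform, mul_add]
    have : h ^ 2 * (1 / h ^ 2 * (lam * innerL2 (onElement T) δ δ + h * faceDiffSq M v)) =
      lam * innerL2 (onElement T) δ δ + h * faceDiffSq M v := by field_simp
    rw [this]
    exact le_add_of_nonneg_left (mul_nonneg hh2.le hG0)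
  have hGS : G2 ≤ S := by
    rw [hform]
    refine le_add_of_nonneg_right (mul_nonneg (by positivity) (add_nonneg
      (mul_nonneg (hlamMin.le.trans hlam) hδ0) (mul_nonneg hh.le hFD)))
  have hδS : innerL2 (onElement T) δ δ ≤ lamMin⁻¹ * (h ^ 2 * S) := by
    rw [← div_eq_inv_mul, le_div_iff₀ hlamMin]
    have h1 := mul_le_mul_of_nonneg_right hlam hδ0
    have h2 := mul_nonneg hh.le hFD
    linarith
  have hFS : h * faceDiffSq M v ≤ h ^ 2 * S := by
    have h1 := mul_nonneg (hlamMin.le.trans hlam) hδ0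
    linarith
  -- the projection of the potential on the element
  set πP := l2Proj (onElement T) (polyFields (n + 1) (Fin (n + 1)) k) P.1
  have hδe : δ = v.1.1 - πP.1 := rfl
  have hPa : innerL2 (onElement T) (P.1 - constAt P.1 c) (P.1 - constAt P.1 c) ≤
      Cp * (h ^ 2 * S) := by
    refine (hp P.1 P.2).trans ?_
    have := hGP.trans hGS
    gcongr
  have hπa : innerL2 (onElement T) (πP.1 - constAt P.1 c) (πP.1 - constAt P.1 c) ≤
      Cp * (h ^ 2 * S) := (l2Proj_sub_le hn _ _ (constAt_mem _ _ _)).trans hPa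
  have hπgrad : h ^ 2 * innerL2 (onElement T) (gradVec πP.1) (gradVec πP.1) ≤
      Ci * (Cp * (h ^ 2 * S)) := by
    -- The gradient ignores the constant, so the inverse inequality applies to `π_T P` minus a
    -- constant, already of size `h` in `L²`. No separate stability of the projector in `H¹` is
    -- required.
    have h1 := hi (πP.1 - constAt P.1 c) (Submodule.sub_mem _ (hmono πP.2) (constAt_mem _ _ _))
    rw [gradVec_sub_constAt] at h1
    exact h1.trans (mul_le_mul_of_nonneg_left hπa hCi)
  have hδmem : δ ∈ polyFields (n + 1) (Fin (n + 1)) (k + 1) := hmono (stokesDiff M T v).1.2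
  have hδgrad : h ^ 2 * innerL2 (onElement T) (gradVec δ) (gradVec δ) ≤
      Ci * (lamMin⁻¹ * (h ^ 2 * S)) :=
    (hi δ hδmem).trans (mul_le_mul_of_nonneg_left hδS hCi)
  have hgrad : innerL2 (onElement T) (gradVec v.1.1) (gradVec v.1.1) ≤
      2 * Ci * (lamMin⁻¹ + Cp) * S := by
    have h1 : v.1.1 = δ + πP.1 := by rw [hδe]; abel
    rw [h1, gradVec_add]
    refine (innerL2_add_self_le hn _ _).trans ?_
    rw [← mul_le_mul_iff_right₀ hh2]
    linarith
  -- the jumps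
  let q := P.1 - πP.1
  have hqmem : q ∈ polyFields (n + 1) (Fin (n + 1)) (k + 1) :=
    Submodule.sub_mem _ P.2 (hmono πP.2)
  have hq : innerL2 (onElement T) q q ≤ 4 * (Cp * (h ^ 2 * S)) := by
    have h1 : q = (P.1 - constAt P.1 c) - (πP.1 - constAt P.1 c) := by simp only [q]; abel
    rw [h1]
    refine (innerL2_sub_self_le hn _ _).trans ?_
    linarith
  have hjF : ∀ F : M.facesOf T,
      innerL2 (onFace F.1) (v.1.1 - (v.2 F).1) (v.1.1 - (v.2 F).1) ≤
        4 * innerL2 (onFace F.1) δ δ +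
        4 * innerL2 (onFace F.1) ((stokesDiff M T v).2 F).1 ((stokesDiff M T v).2 F).1 +
        2 * innerL2 (onFace F.1) q q := by
    intro F
    have hF := M.nice_face hT F
    set πF := l2Proj (onFace F.1) (polyFields (n + 1) (Fin (n + 1)) k) P.1
    -- The trace of `π_T P` on `F` has degree at most `k`, so it is admissible in the best
    -- approximation property of `π_F`. The last bracket is therefore at most `P - π_T P` on `F`, to
    -- which the trace inequality applies.
    have h1 : v.1.1 - (v.2 F).1 =
        (δ - ((stokesDiff M T v).2 F).1) - (πF.1 - πP.1) := by
      rw [hδe, stokesDiff_snd, ← hP]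
      abel
    have h2 : innerL2 (onFace F.1) (πF.1 - πP.1) (πF.1 - πP.1) ≤ innerL2 (onFace F.1) q q :=
      l2Proj_sub_le hF _ _ πP.2
    rw [h1]
    have h3 := innerL2_sub_self_le hF (δ - ((stokesDiff M T v).2 F).1) (πF.1 - πP.1)
    have h4 := innerL2_sub_self_le hF δ ((stokesDiff M T v).2 F).1
    linarith
  have hj : faceJumpSq M v ≤ 4 * ∑ F : M.facesOf T, innerL2 (onFace F.1) δ δ +
      4 * faceDiffSq M v + 2 * ∑ F : M.facesOf T, innerL2 (onFace F.1) q q := by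
    refine (Finset.sum_le_sum fun F _ => hjF F).trans_eq ?_
    rw [Finset.sum_add_distrib, Finset.sum_add_distrib, ← Finset.mul_sum, ← Finset.mul_sum,
      ← Finset.mul_sum]
    rfl
  have hjump : h⁻¹ * faceJumpSq M v ≤ (4 * Ct * lamMin⁻¹ + 4 + 8 * Ct * Cp) * S := by
    have h1 := htr _ δ hδmem
    have h2 := htr _ q hqmem
    have h3 := mul_le_mul_of_nonneg_left hδS hCt
    have h4 := mul_le_mul_of_nonneg_left hq hCt
    have h5 := mul_le_mul_of_nonneg_left hj hh.le
    rw [← mul_le_mul_iff_right₀ hh2]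
    have h6 : h ^ 2 * (h⁻¹ * faceJumpSq M v) = h * faceJumpSq M v := by field_simp
    rw [h6]
    linarith
  linarith

end Seminorm

/-! ### Uniform constants and conclusion -/

/-- The bounds relating the Stokes seminorm and the discrete `H¹`-seminorm, in dimension `n + 1`. -/
theorem exists_norm_equivalence {n : ℕ} (k : ℕ) {ρ lamMin : ℝ} (hρ : 0 < ρ) (lamMax : ℝ)
    (hlam : 0 < lamMin) (hlam' : 0 ≤ lamMax) {Ω : Set (E (n + 1))} (hΩ : IsPolytopal Ω) :
    ∃ C : ℝ, 0 < C ∧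
      ∀ M : PolytopalMesh Ω, M.IsRegular ρ →
      ∀ D : Coefficients Ω,
      ∀ T ∈ M.elements, ∀ lam : ℝ, lamMin ≤ lam → lam ≤ lamMax →
      ∀ v : LocalHHO M T k,
        stokesSeminorm M T (D.friction T) lam v ^ 2 ≤ C * hhoNormSq M T v ∧
        (D.friction T < 1 →
          hhoNormSq M T v ≤ C * stokesSeminorm M T (D.friction T) lam v ^ 2) := by
  have hr : 0 < ρ ^ 2 := by positivity
  have hK : 0 ≤ boundaryConst n ρ := by
    have := ballVol_nonneg n
    unfold ballVol at this
    unfold boundaryConst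
    positivity
  -- The constants are fixed before the mesh, from the dimension, `k` and `ρ`. Degree `k + 1` covers
  -- the potential as well as the components of degree `k`.
  obtain ⟨Ci, hCi, hi⟩ := Chunky.exists_inverse_ineq (n + 1) (k + 1) hr
  obtain ⟨Cp, hCp, hp⟩ := Chunky.exists_poincare (n + 1) (k + 1) hr
  obtain ⟨Ct, hCt, ht⟩ := exists_trace_ineq n (k + 1) hr hK
  set C₁ := (4 + 2 * (Ct + 1)) + (lamMax + 2 * Ct) * (2 * Cp * (5 + 2 * (Ct + 1))) + 2
  set C₂ := 2 * Ci * (lamMin⁻¹ + Cp) + (4 * Ct * lamMin⁻¹ + 4 + 8 * Ct * Cp)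
  have hC₁ : 0 < C₁ := by positivity
  have hC₂ : 0 < C₂ := by positivity
  refine ⟨C₁ + C₂, by positivity, fun M hM D T hT lam hl hl' v => ?_⟩
  obtain ⟨⟨c, hc1, hc2⟩, hsurf⟩ := hM.geometry hρ hT
  have hch : Chunky T (ρ ^ 2) (Metric.diam T) c :=
    ⟨M.diam_pos hT, M.isOpen_element hT, hc1, hc2⟩
  have hlam0 : 0 ≤ lam := hlam.le.trans hl
  have hf0 := D.friction_nonneg (M.element_subset hΩ hT)
  have htr := ht Ω M T hT _ c hch hsurf
  have hS0 := stokesForm_self_nonneg M (T := T) hf0 hlam0 v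
  have hN0 : 0 ≤ hhoNormSq M T v := by
    rw [hhoNormSq_eq]
    exact add_nonneg (innerL2_self_nonneg _ _)
      (mul_nonneg (inv_nonneg.2 Metric.diam_nonneg) (faceJumpSq_nonneg M v))
  rw [stokesSeminorm_sq M hf0 hlam0]
  refine ⟨?_, fun hf1 => ?_⟩
  · refine (stokesForm_le M hΩ hT hCp hCt (hp T _ c hch) htr hlam0 hl' v).trans ?_
    exact mul_le_mul_of_nonneg_right (by linarith) hN0
  · refine (hhoNormSq_le M hT hCi hCt (hi T _ c hch) (hp T _ c hch) hCp htr hf0 hf1 hlam hl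
      v).trans ?_
    exact mul_le_mul_of_nonneg_right (by linarith) hS0

end

end HHO

theorem mainTheorem5 {d : ℕ} (hd : d = 2 ∨ d = 3) (Ω : Set (HHO.E d))
    (hΩ : HHO.IsPolytopalDomain Ω) (k : ℕ) (ρ : ℝ) (hρ₀ : 0 < ρ) (hρ₁ : ρ < 1)
    (lamMin lamMax : ℝ) (hlam : 0 < lamMin) :
    ∃ C : ℝ, 0 < C ∧
      ∀ M : HHO.PolytopalMesh Ω, M.IsRegular ρ →
      ∀ D : HHO.Coefficients Ω, D.Compatible M →
      ∀ T ∈ M.elements, ∀ lam : ℝ, lamMin ≤ lam → lam ≤ lamMax →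
      ∀ v : HHO.LocalHHO M T k,
        HHO.stokesSeminorm M T (D.friction T) lam v ^ 2 ≤ C * HHO.hhoNormSq M T v ∧
        (D.friction T < 1 →
          HHO.hhoNormSq M T v ≤ C * HHO.stokesSeminorm M T (D.friction T) lam v ^ 2) := by
  obtain ⟨n, rfl⟩ : ∃ n, d = n + 1 := by
    rcases hd with rfl | rfl
    exacts [⟨1, rfl⟩, ⟨2, rfl⟩]
  -- If the interval of admissible factors is empty, any positive constant works; otherwise `lamMax`
  -- is nonnegative, as the upper bound requires.
  by_cases hle : lamMin ≤ lamMax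
  · obtain ⟨C, hC, h⟩ :=
      HHO.exists_norm_equivalence k hρ₀ lamMax hlam (hlam.le.trans hle) hΩ.1
    exact ⟨C, hC, fun M hM D _ => h M hM D⟩
  · exact ⟨1, one_pos, fun M _ D _ T _ lam h1 h2 => absurd (h1.trans h2) hle⟩
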